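/- **Setting.** Let $\rho_n=\sum_{i=1}^{2n+1}(-1)^{n+i-1}e_{i,2n+2-i}$, $\langle X,Y\rangle=X^t\rho_nY$, $A^\sharp=\rho_nA^t\rho_n$, $o(n+1,n)=\{A\in gl(2n+1,\mathbb R): A^t\rho_n+\rho_nA=0\}$, and let $\mathcal B_n^+$ be the set of upper triangular matrices in $o(n+1,n)$. Put $\beta=\frac12(e_{1,2n}+e_{2,2n+1})$, $b=\sum_{i=1}^{2n}e_{i+1,i}$, $J_B(\lambda)=\beta\lambda+b$. For a smooth $\mathcal B_n^+$-valued $q(x,t)$ let $T(q,\lambda)=\beta\lambda+\sum_{i\le0}T_{1,i}(q)\lambda^i$ be the unique series with smooth coefficients in $o(n+1,n)$ such that $[\partial_x+J_B(\lambda)+q,\,T]=0$ and $T^{2n+1}=\lambda T$, and let $T_{m,0}(q)$ and $(T^m)_+$ be the $\lambda^0$-coefficient and the part with exponents $\ge0$ of $T^m$. For $j\ge1$ a solution of the $(2j-1)$-th $\hat B_n^{(1)}$-flow on an open set is a smooth $\mathcal B_n^+$-valued $q$ with $q_t=[\partial_x+b+q,\,T_{2j-1,0}(q)]$. Its normalized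 frame is a map $F(x,t,\lambda)\in O_{\mathbb C}(n+1,n)$, holomorphic in $\lambda\in\mathbb C$, with $\overline{F(x,t,\bar\lambda)}=F(x,t,\lambda)$, $F^{-1}F_x=J_B(\lambda)+q$, $F^{-1}F_t=(T^{2j-1}(q,\lambda))_+$, $F(0,0,\lambda)=I$. If $f$ is a rational loop ($f^t\rho_nf=\rho_n$, $\overline{f(\bar\lambda)}=f(\lambda)$, $f(\infty)=I$) and $f(\lambda)F(x,t,\lambda)=\tilde F(x,t,\lambda)\tilde f(x,t,\lambda)$ on a neighbourhood $\mathcal O$ of $(0,0)$, where $\tilde F(x,t,\cdot)$ is entire with the same two symmetries and $\tilde f(x,t,\cdot)$ is a rational loop, then $f\bullet q:=q+[\tilde f_{-1},\beta]$ on $\mathcal O$, with $\tilde f_{-1}$ the $\lambda^{-1}$-coefficient of $\tilde f$ at $\infty$; $\tilde F$ is used as its frame when $\bullet$ is iterated. For reals $\alpha\ne\alpha'$ and a projection $\pi$ of $\mathbb R^{2n+1}$ that satisfies (*) $\pi\pi^\sharp=\pi^\sharp\pi=0$, put $g_{\alpha,\alpha',\pi}(\lambda)=I+\frac{\alpha'-\alpha}{\lambda-\alpha'}\pi+\frac{\alpha-\alpha'}{\lambda-\alpha}\pi^\sharp$.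 **Theorem.** Let $\alpha_1,\beta_1,\alpha_2,\beta_2$ be distinct reals and $\pi_1,\pi_2$ rank one projections satisfying (*). Suppose that there are projections $\tau_1,\tau_2$ with $$\mathrm{Im}\,\tau_1=g_{\alpha_2,\beta_2,\pi_2}(\alpha_1)\mathrm{Im}\,\pi_1,\quad \mathrm{Ker}\,\tau_1=g_{\alpha_2,\beta_2,\pi_2}(\beta_1)\mathrm{Ker}\,\pi_1,\quad \mathrm{Im}\,\tau_2=g_{\alpha_1,\beta_1,\pi_1}(\alpha_2)\mathrm{Im}\,\pi_2,\quad \mathrm{Ker}\,\tau_2=g_{\alpha_1,\beta_1,\pi_1}(\beta_2)\mathrm{Ker}\,\pi_2.\qquad(1)$$ (A) Then $\tau_1,\tau_2$ satisfy (*) and $$g_{\alpha_2,\beta_2,\tau_2}\,g_{\alpha_1,\beta_1,\pi_1}=g_{\alpha_1,\beta_1,\tau_1}\,g_{\alpha_2,\beta_2,\pi_2}.\qquad(2)$$ Conversely, any projections $\tau_1,\tau_2$ that satisfy (*) and (2) satisfy (1). (B) Let $q$ be a solution of the $(2j-1)$-th $\hat B_n^{(1)}$-flow on an open set $\Omega\ni(0,0)$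 (for instance $\Omega=\mathbb R^2$), with normalized frame $F$. On some connected open neighbourhood of $(0,0)$ there are projections $\tilde\pi_i(x,t)$ onto $F(x,t,\alpha_i)^{-1}\mathrm{Im}\,\pi_i$ along $F(x,t,\beta_i)^{-1}\mathrm{Ker}\,\pi_i$ ($i=1,2$), and projections $\tilde\tau_1(x,t),\tilde\tau_2(x,t)$ given by (1) with $\tilde\pi_i(x,t)$ in place of $\pi_i$. On every open $\mathcal O\subseteq\Omega$ with $(0,0)\in\mathcal O$ on which these four projections exist, $$q_1:=g_{\alpha_1,\beta_1,\pi_1}\bullet q=q+(\alpha_1-\beta_1)[\beta,\tilde\pi_1-\tilde\pi_1^\sharp],\qquad q_2:=g_{\alpha_2,\beta_2,\pi_2}\bullet q=q+(\alpha_2-\beta_2)[\beta,\tilde\pi_2-\tilde\pi_2^\sharp],$$ $$q_{12}:=g_{\alpha_2,\beta_2,\tau_2}\bullet(g_{\alpha_1,\beta_1,\pi_1}\bullet q)=g_{\alpha_1,\beta_1,\tau_1}\bullet(g_{\alpha_2,\beta_2,\pi_2}\bullet q)=q_1+(\alpha_2-\beta_2)[\beta,\tilde\tau_2-\tilde\tau_2^\sharp]=q_2+(\alpha_1-\beta_1)[\beta,\tilde\tau_1-\tilde\tau_1^\sharp].$$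 All these transforms exist on $\mathcal O$ and are uniquely determined there by $q$ and $F$; $q_1,q_2,q_{12}$ are solutions of the same flow on $\mathcal O$ with normalized frames, and the two iterated transforms have the same frame. -/

import Mathlib

open Filter Topology Set
open scoped ContDiff

noncomputable section

namespace BnFlow

/-- Square matrices of size `2n+1`, with rows and columns numbered `0, …, 2n`. -/
abbrev Mat (n : ℕ) (K : Type*) : Type _ := Matrix (Fin (2 * n + 1)) (Fin (2 * n + 1)) K

/-- `ρ_n = ∑_{i=1}^{2n+1} (-1)^{n+i-1} e_{i,2n+2-i}` (here with indices starting at `0`), the Gram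
matrix of the index `n` bilinear form `⟨X, Y⟩ = Xᵗ ρ_n Y`. -/
def rho (n : ℕ) (K : Type*) [Ring K] : Mat n K :=
  Matrix.of fun i j => if i.val + j.val = 2 * n then (-1) ^ (n + i.val) else 0

/-- `β = ½ (e_{1,2n} + e_{2,2n+1})`. -/
def beta (n : ℕ) : Mat n ℝ :=
  Matrix.of fun i j =>
    if (i.val = 0 ∧ j.val + 1 = 2 * n) ∨ (i.val = 1 ∧ j.val = 2 * n) then 1 / 2 else 0

/-- `b = ∑_{i=1}^{2n} e_{i+1,i}`. -/
def bMat (n : ℕ) : Mat n ℝ :=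
  Matrix.of fun i j => if i.val = j.val + 1 then 1 else 0

/-- `J_B(z) = β z + b`. -/
def JB (n : ℕ) (z : ℂ) : Mat n ℂ :=
  z • (beta n).map Complex.ofReal + (bMat n).map Complex.ofReal

/-- The Lie algebra `o(n+1,n)` of real matrices `A` with `Aᵗ ρ_n + ρ_n A = 0`. -/
def IsSkew (n : ℕ) (A : Mat n ℝ) : Prop :=
  A.transpose * rho n ℝ + rho n ℝ * A = 0

/-- `𝓑_n⁺`: the upper triangular matrices in `o(n+1,n)`. -/
def IsBorel (n : ℕ) (A : Mat n ℝ) : Prop :=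
  IsSkew n A ∧ ∀ i j, j < i → A i j = 0

/-- The adjoint `A^♯ = ρ_n Aᵗ ρ_n` of `A` with respect to `⟨ , ⟩`. -/
def sharp (n : ℕ) (A : Mat n ℝ) : Mat n ℝ :=
  rho n ℝ * A.transpose * rho n ℝ

/-- Entrywise partial derivative in `x` of a matrix function of `(x,t)`. -/
def pdx {n : ℕ} {K : Type*} [NormedAddCommGroup K] [NormedSpace ℝ K]
    (A : ℝ × ℝ → Mat n K) (p : ℝ × ℝ) : Mat n K :=
  Matrix.of fun i j => deriv (fun x : ℝ => A (x, p.2) i j) p.1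

/-- Entrywise partial derivative in `t` of a matrix function of `(x,t)`. -/
def pdt {n : ℕ} {K : Type*} [NormedAddCommGroup K] [NormedSpace ℝ K]
    (A : ℝ × ℝ → Mat n K) (p : ℝ × ℝ) : Mat n K :=
  Matrix.of fun i j => deriv (fun t : ℝ => A (p.1, t) i j) p.2

/-- Entrywise `C^∞` on an (open) set of the `(x,t)`-plane. -/
def SmoothOn {n : ℕ} {K : Type*} [NormedAddCommGroup K] [NormedSpace ℝ K]
    (A : ℝ × ℝ → Mat n K) (U : Set (ℝ × ℝ)) : Prop :=
  ∀ i j, ContDiffOn ℝ ∞ (fun p => A p i j) U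

/-- `T(q,λ) = β λ + ∑_{i ≤ 0} T_{1,i}(q) λ^i` is a Laurent series in `λ⁻¹` with coefficients in
`o(n+1,n)`.  It is stored as the power series `S` in `μ = λ⁻¹` with `T = λ S`, so that the
coefficient of `μ^k` in `S` is `T_{1,1-k}(q)`.  `T` is the (unique) series of this form with
`[∂_x + β λ + b + q, T] = 0` and `T^{2n+1} = λ T`. -/
structure IsT (n : ℕ) (U : Set (ℝ × ℝ)) (q : ℝ × ℝ → Mat n ℝ)
    (S : ℝ × ℝ → PowerSeries (Mat n ℝ)) : Prop where
  smooth : ∀ k, SmoothOn (fun p => PowerSeries.coeff k (S p)) U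
  skew : ∀ p ∈ U, ∀ k, IsSkew n (PowerSeries.coeff k (S p))
  leading : ∀ p ∈ U, PowerSeries.coeff 0 (S p) = beta n
  /-- the coefficient of `λ^{1-k}` in `T_x + [β λ + b + q, T] = 0` -/
  commute : ∀ p ∈ U, ∀ k,
    pdx (fun p' => PowerSeries.coeff k (S p')) p + ⁅bMat n + q p, PowerSeries.coeff k (S p)⁆
      + ⁅beta n, PowerSeries.coeff (k + 1) (S p)⁆ = 0
  /-- `T^{2n+1} = λ T`, that is `S^{2n+1} = μ^{2n-1} S`, multiplied by `μ` -/
  power : ∀ p ∈ U,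
    PowerSeries.X * S p ^ (2 * n + 1) = PowerSeries.X ^ (2 * n) * S p

/-- `T_{m,0}(q)`: the coefficient of `λ^0` in `T^m = λ^m S^m`. -/
def TZero {n : ℕ} (m : ℕ) (S : PowerSeries (Mat n ℝ)) : Mat n ℝ :=
  PowerSeries.coeff m (S ^ m)

/-- `(T^m)_+` at the point `λ = z`: the part of `T^m = λ^m S^m` with exponents `≥ 0`. -/
def TPlus {n : ℕ} (m : ℕ) (S : PowerSeries (Mat n ℝ)) (z : ℂ) : Mat n ℂ :=
  ∑ k ∈ Finset.range (m + 1),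
    z ^ (m - k) • (PowerSeries.coeff k (S ^ m)).map Complex.ofReal

/-- `q` is a smooth solution on `U` of the `(2j-1)`-th flow
`q_t = [∂_x + b + q, T_{2j-1,0}(q)]`, with values in `𝓑_n⁺`. -/
structure IsSolution (n j : ℕ) (U : Set (ℝ × ℝ)) (q : ℝ × ℝ → Mat n ℝ) : Prop where
  smooth : SmoothOn q U
  borel : ∀ p ∈ U, IsBorel n (q p)
  flow : ∃ S, IsT n U q S ∧ ∀ p ∈ U,
    pdt q p = pdx (fun p' => TZero (2 * j - 1) (S p')) p
      + ⁅bMat n + q p, TZero (2 * j - 1) (S p)⁆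

/-- The group of holomorphic maps `f` on `ℂ` with `f(z)ᵗ ρ_n f(z) = ρ_n` and
`conj (f (conj z)) = f z`. -/
structure IsPosLoop (n : ℕ) (f : ℂ → Mat n ℂ) : Prop where
  holo : ∀ i j, Differentiable ℂ fun z => f z i j
  orth : ∀ z, (f z).transpose * rho n ℂ * f z = rho n ℂ
  real : ∀ z, (f (starRingEnd ℂ z)).map (starRingEnd ℂ) = f z

/-- The group of rational maps `f` with `f(z)ᵗ ρ_n f(z) = ρ_n`, `conj (f (conj z)) = f z` and
`f(∞) = I`.  The values of the function `f` at finitely many points (its poles among them) carry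
no information. -/
structure IsRatLoop (n : ℕ) (f : ℂ → Mat n ℂ) : Prop where
  rational : ∃ (d : Polynomial ℂ) (N : Mat n (Polynomial ℂ)), d ≠ 0 ∧
    ∀ z, d.eval z ≠ 0 → d.eval z • f z = N.map (Polynomial.eval z)
  orth : ∀ᶠ z in cofinite, (f z).transpose * rho n ℂ * f z = rho n ℂ
  real : ∀ᶠ z in cofinite, (f (starRingEnd ℂ z)).map (starRingEnd ℂ) = f z
  infty : Tendsto f (Bornology.cobounded ℂ) (𝓝 1)

/-- `F(x,t,λ)` is the frame on `U` of the solution `q` of the `(2j-1)`-th flow with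
`F(0,0,λ) = I`: it takes values in `O_ℂ(n+1,n)`, is holomorphic in `λ ∈ ℂ`, real for real `λ`, and
`F⁻¹F_x = J_B(λ) + q`, `F⁻¹F_t = (T^{2j-1}(q,λ))_+`.  (Joint continuity is automatic for
solutions of this linear system and is recorded for convenience.) -/
structure IsFrame (n j : ℕ) (U : Set (ℝ × ℝ)) (q : ℝ × ℝ → Mat n ℝ)
    (F : ℝ × ℝ → ℂ → Mat n ℂ) : Prop where
  smooth : ∀ z, SmoothOn (fun p => F p z) U
  cont : ContinuousOn (fun w : (ℝ × ℝ) × ℂ => F w.1 w.2) (U ×ˢ univ)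
  loop : ∀ p ∈ U, IsPosLoop n (F p)
  det_one : ∀ p ∈ U, ∀ z, (F p z).det = 1
  eq_x : ∀ p ∈ U, ∀ z, pdx (fun p' => F p' z) p = F p z * (JB n z + (q p).map Complex.ofReal)
  eq_t : ∃ S, IsT n U q S ∧ ∀ p ∈ U, ∀ z,
    pdt (fun p' => F p' z) p = F p z * TPlus (2 * j - 1) (S p) z
  base : (0, 0) ∈ U
  normalized : ∀ z, F (0, 0) z = 1

/-- `q' = f • q` on `O`, where `F` is the normalized frame of `q` and `F'` is the new frame:
`f(λ) F(x,t,λ) = F'(x,t,λ) h(x,t,λ)` with `F'(x,t,·)` in the positive and `h(x,t,·)` in the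
rational loop group, and `q' = q + [h_{-1}, β]`, where `h_{-1}` is the coefficient of `λ⁻¹` in the
expansion of `h` at `λ = ∞`. -/
structure IsDressing (n j : ℕ) (O : Set (ℝ × ℝ)) (f : ℂ → Mat n ℂ)
    (q : ℝ × ℝ → Mat n ℝ) (F : ℝ × ℝ → ℂ → Mat n ℂ)
    (q' : ℝ × ℝ → Mat n ℝ) (F' : ℝ × ℝ → ℂ → Mat n ℂ) : Prop where
  frame : IsFrame n j O q F
  rat : IsRatLoop n f
  factor : ∃ (h : ℝ × ℝ → ℂ → Mat n ℂ) (R : ℝ × ℝ → Mat n ℝ), ∀ p ∈ O,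
    IsPosLoop n (F' p) ∧ IsRatLoop n (h p) ∧
    (∀ᶠ z in cofinite, f z * F p z = F' p z * h p z) ∧
    Tendsto (fun z : ℂ => z • (h p z - 1)) (Bornology.cobounded ℂ)
      (𝓝 ((R p).map Complex.ofReal)) ∧
    q' p = q p + ⁅R p, beta n⁆

/-- Image of a real matrix. -/
def im {n : ℕ} (A : Mat n ℝ) : Submodule ℝ (Fin (2 * n + 1) → ℝ) := LinearMap.range A.mulVecLin

/-- Kernel of a real matrix. -/
def ke {n : ℕ} (A : Mat n ℝ) : Submodule ℝ (Fin (2 * n + 1) → ℝ) := LinearMap.ker A.mulVecLin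

/-- `A` is the projection onto `V` along `W`. -/
def IsProj {n : ℕ} (A : Mat n ℝ) (V W : Submodule ℝ (Fin (2 * n + 1) → ℝ)) : Prop :=
  A * A = A ∧ im A = V ∧ ke A = W

/-- `A A^♯ = A^♯ A = 0`. -/
def IsIsotropic (n : ℕ) (A : Mat n ℝ) : Prop :=
  A * sharp n A = 0 ∧ sharp n A * A = 0

/-- `g_{a,c,A}(z) = I + (c-a)/(z-c) A + (a-c)/(z-a) A^♯`, at a real or complex point `z`. -/
def simpleElt {n : ℕ} {K : Type*} [Field K] [Algebra ℝ K] (a c : ℝ) (A : Mat n ℝ) (z : K) :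
    Mat n K :=
  1 + (algebraMap ℝ K (c - a) / (z - algebraMap ℝ K c)) • A.map (algebraMap ℝ K)
    + (algebraMap ℝ K (a - c) / (z - algebraMap ℝ K a)) • (sharp n A).map (algebraMap ℝ K)

/-- The relations
`Im τ₁ = g_{a₂,c₂,P₂}(a₁) Im P₁`, `Ker τ₁ = g_{a₂,c₂,P₂}(c₁) Ker P₁`,
`Im τ₂ = g_{a₁,c₁,P₁}(a₂) Im P₂`, `Ker τ₂ = g_{a₁,c₁,P₁}(c₂) Ker P₂`,
for projections `τ₁`, `τ₂`. -/
def IsPermuted {n : ℕ} (a₁ c₁ a₂ c₂ : ℝ) (P₁ P₂ τ₁ τ₂ : Mat n ℝ) : Prop :=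
  IsProj τ₁ ((im P₁).map (simpleElt a₂ c₂ P₂ a₁).mulVecLin)
    ((ke P₁).map (simpleElt a₂ c₂ P₂ c₁).mulVecLin) ∧
  IsProj τ₂ ((im P₂).map (simpleElt a₁ c₁ P₁ a₂).mulVecLin)
    ((ke P₂).map (simpleElt a₁ c₁ P₁ c₂).mulVecLin)

/-- `g_{a₂,c₂,τ₂} g_{a₁,c₁,P₁} = g_{a₁,c₁,τ₁} g_{a₂,c₂,P₂}` as rational maps, that is, at every
point other than the poles. -/
def GRelation {n : ℕ} (a₁ c₁ a₂ c₂ : ℝ) (P₁ P₂ τ₁ τ₂ : Mat n ℝ) : Prop :=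
  ∀ z : ℂ, z ≠ a₁ → z ≠ c₁ → z ≠ a₂ → z ≠ c₂ →
    simpleElt a₂ c₂ τ₂ z * simpleElt a₁ c₁ P₁ z = simpleElt a₁ c₁ τ₁ z * simpleElt a₂ c₂ P₂ z

/-- The real matrix `F(x,t,a)`, for a frame `F` and a real number `a`. -/
def frameAt {n : ℕ} (F : ℝ × ℝ → ℂ → Mat n ℂ) (p : ℝ × ℝ) (a : ℝ) : Mat n ℝ :=
  (F p (a : ℂ)).map Complex.re

/-- `Pt(x,t)` is the projection onto `F(x,t,a)⁻¹(Im P)` along `F(x,t,c)⁻¹(Ker P)`, for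
`(x,t) ∈ O`. -/
def IsTransported {n : ℕ} (O : Set (ℝ × ℝ)) (F : ℝ × ℝ → ℂ → Mat n ℂ) (a c : ℝ) (P : Mat n ℝ)
    (Pt : ℝ × ℝ → Mat n ℝ) : Prop :=
  ∀ p ∈ O, IsProj (Pt p) ((im P).comap (frameAt F p a).mulVecLin)
    ((ke P).comap (frameAt F p c).mulVecLin)

/-- `q + (a - c) [β, P - P^♯]`. -/
def darboux {n : ℕ} (a c : ℝ) (q P : ℝ × ℝ → Mat n ℝ) (p : ℝ × ℝ) : Mat n ℝ :=
  q p + (a - c) • ⁅beta n, P p - sharp n (P p)⁆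

end BnFlow

end

open BnFlow

/-! The argument rests on the simple factor `dress`, that is `1 + d v P - d u P'` with `d u v = v -
u`. For `u = (z - a)⁻¹`, `v = (z - b)⁻¹`, `d = b - a` and `P' = P♯` it is the simple element at the
point `z`; with the geometric series of `(λ - a)⁻¹` and `(λ - b)⁻¹` in place of `u`, `v` it is the
expansion at infinity. Both readings share the identities `dress_mul_dress_swap` (inverse) and
`dress_gauge` (action on the connection). Conditions on images and kernels are replaced by matrix
equations, `Link`, which pass from `ℝ` to `ℂ`, compose, and for rank one have an explicit solution
(`Link.eq_smul`).

(A) If `Q` is linked to `P` by an orthogonal holomorphic `F`, then `g_P F g_Q⁻¹` has no poles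
(`Link.exists_extension`). The link equations and isotropy remove the residues and the leading
double-pole terms; the derivative term `P♯ F' Q` vanishes because `F' F⁻¹` is skew and `P♯ X P = 0`
for `P` of rank one and `X` skew. Hence `g_{τ₁} g_{π₂} g_{π₁}⁻¹ g_{τ₂}⁻¹` extends to an entire
function with limit `I` at infinity, and Liouville's theorem gives (2) (`gRelation_of_link`).
Conversely, the residues of (2) write each `τᵢ` as a product from which its image and kernel can be
read (`GRelation.link`).

(B) For one transform (`exists_darboux`) put `F₁ = g_π F g_π̃⁻¹`, entire in `λ` by the same lemma.
The explicit formula for `π̃` gives Riccati equations in `x` and `t` (`hasMDerivAt_link`), and these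
are what makes the gauge transform by `g_π̃` free of poles: in `x` it is `J_B + q₁` (`conn_gauge`),
in `t` it is entire. Conjugating `T(q)` by the expansion of `g_π̃` gives a series with the defining
properties of `T(q₁)` (`IsT.gauge`), and comparison at infinity identifies the entire function with
`(T^{2j-1})_+` of that series (`TPlus_gauge`). The flow is then the zero curvature equation at `λ =
0`.

For the iteration, `τ̃₂` is the transport of `τ₂` along `F₁` (`isTransported_dressed`), so
`exists_darboux` applies again, and likewise in the other order. Relation (2), for the constant
projections and at every `(x,t)`, shows that the two final frames agree; a frame determines its
potential. Uniqueness of the transforms is Liouville's theorem again (`factorization_unique`). -/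

noncomputable section

namespace BnFlow

/-! ### Algebra of simple factors over an arbitrary ring -/

section Dress

variable {K R : Type*} [CommRing K] [Ring R] [Algebra K R]

/-- A pair of complementary idempotents whose products vanish. -/
structure OrthIdem (P P' : R) : Prop where
  idem : P * P = P
  idem' : P' * P' = P'
  mul_zero' : P * P' = 0
  zero_mul' : P' * P = 0

theorem OrthIdem.symm {P P' : R} (h : OrthIdem P P') : OrthIdem P' P :=
  ⟨h.idem', h.idem, h.zero_mul', h.mul_zero'⟩

/-- The abstract simple factor `1 + d v P - d u P'`. -/
def dress (d u v : K) (P P' : R) : R := 1 + (d * v) • P - (d * u) • P'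

/-- The mixed products vanish, and the quadratic terms from `P²`, `P'²` cancel the linear ones by `d
u v = v - u`. When `P' = P♯`, the swapped factor is the adjoint, so this is the orthogonality of the
simple elements. -/
theorem dress_mul_dress_swap {d u v : K} (huv : d * u * v = v - u) {P P' : R}
    (h : OrthIdem P P') : dress d u v P P' * dress d u v P' P = 1 := by
  simp only [dress, add_mul, mul_add, sub_mul, mul_sub, smul_mul_assoc, mul_smul_comm, one_mul,
    mul_one, h.idem, h.idem', h.mul_zero', h.zero_mul', smul_zero]
  match_scalars
  · ring
  · linear_combination (-d) * huv
  · linear_combination (-d) * huv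

/-- The gauge transformation of a connection by a simple factor. -/
theorem dress_gauge {d u v x : K} {P P' β A B E D D' : R} (h : OrthIdem P P')
    (hu : u • E = x • β + (x * u) • A) (hv : v • E = x • β + (x * v) • B)
    (hd : d • β = B - A)
    (hD : D = -(A * P) + P * B - P * (B - A) * P)
    (hD' : D' = P' * A - B * P' + P' * (B - A) * P')
    (ht : P * β * P' = 0) (ht' : P' * β * P = 0) :
    (E + (x * d) • ⁅P - P', β⁆) * dress d u v P P' =
      dress d u v P P' * E - x • ((d * v) • D - (d * u) • D') := by
  have hB : B = A + d • β := by rw [hd]; abel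
  -- Partial fractions: each product of `E` with a pole factor is traded for `β` and the values `A`,
  -- `B` of the connection at the two poles. The scalar `x` is `1` at a point and `λ⁻¹` for series.
  have e1 : (d * v) • (P * E) = d • (P * (x • β + (x * v) • B)) := by
    rw [← hv, mul_smul_comm, smul_smul]
  have e2 : (d * u) • (P' * E) = d • (P' * (x • β + (x * u) • A)) := by
    rw [← hu, mul_smul_comm, smul_smul]
  have e3 : (d * v) • (E * P) = d • ((x • β + (x * v) • B) * P) := by
    rw [← hv, smul_mul_assoc, smul_smul]
  have e4 : (d * u) • (E * P') = d • ((x • β + (x * u) • A) * P') := by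
    rw [← hu, smul_mul_assoc, smul_smul]
  have i1 : ∀ X, P * (P * X) = P * X := fun X => by rw [← mul_assoc, h.idem]
  have i2 : ∀ X, P' * (P' * X) = P' * X := fun X => by rw [← mul_assoc, h.idem']
  have i3 : ∀ X, P * (P' * X) = 0 := fun X => by rw [← mul_assoc, h.mul_zero', zero_mul]
  have i4 : ∀ X, P' * (P * X) = 0 := fun X => by rw [← mul_assoc, h.zero_mul', zero_mul]
  rw [mul_assoc] at ht ht'
  simp only [dress, add_mul, mul_add, sub_mul, mul_sub, mul_one, one_mul, smul_mul_assoc,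
    mul_smul_comm, smul_add, smul_sub, e1, e2, e3, e4]
  subst hB
  simp only [hD, hD', Ring.lie_def, add_mul, mul_add, sub_mul, mul_sub, smul_add, smul_sub,
    smul_neg, smul_mul_assoc, mul_smul_comm, mul_assoc, h.idem, h.idem', h.mul_zero', h.zero_mul',
    ht, ht', smul_zero, mul_zero]
  match_scalars <;> ring

end Dress

/-! ### The adjoint for the bilinear form, rank one idempotents, links -/

section Adjoint

variable {n : ℕ} {K : Type*} [CommRing K]

theorem rho_transpose : (rho n K).transpose = rho n K := by
  ext i j
  simp only [rho, Matrix.transpose_apply, Matrix.of_apply]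
  by_cases h : i.val + j.val = 2 * n
  · rw [if_pos h, if_pos (by omega)]
    have h2 : n + i.val + (n + j.val) = 2 * (2 * n) := by omega
    have : ((-1 : K) ^ (n + i.val)) * (-1) ^ (n + j.val) = 1 := by
      rw [← pow_add, h2, pow_mul]; simp
    have h3 : ((-1 : K) ^ (n + i.val)) * (-1) ^ (n + i.val) = 1 := by
      rw [← pow_add, ← two_mul, pow_mul]; simp
    calc (-1 : K) ^ (n + j.val)
        = ((-1 : K) ^ (n + i.val) * (-1) ^ (n + i.val)) * (-1) ^ (n + j.val) := by
          rw [h3, one_mul]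
      _ = _ := by rw [mul_assoc, this, mul_one]
  · rw [if_neg h, if_neg (by omega)]

theorem rho_apply_mul (i : Fin (2 * n + 1)) (A : Mat n K) (j : Fin (2 * n + 1)) :
    (rho n K * A) i j = (-1) ^ (n + i.val) * A (Fin.rev i) j := by
  rw [Matrix.mul_apply, Finset.sum_eq_single (Fin.rev i)]
  · simp only [rho, Matrix.of_apply, Fin.val_rev]
    rw [if_pos (by omega)]
  · intro k _ hk
    simp only [rho, Matrix.of_apply]
    rw [if_neg, zero_mul]
    intro h
    apply hk
    ext
    rw [Fin.val_rev]
    omega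
  · simp

theorem rho_mul_rho : rho n K * rho n K = 1 := by
  ext i j
  rw [rho_apply_mul]
  simp only [rho, Matrix.of_apply, Matrix.one_apply, Fin.val_rev]
  by_cases h : i = j
  · subst h
    rw [if_pos (by omega), if_pos rfl, ← pow_add]
    have : n + i.val + (n + (2 * n + 1 - (i.val + 1))) = 2 * (2 * n) := by omega
    rw [this, pow_mul]
    simp
  · rw [if_neg, if_neg h, mul_zero]
    intro h2
    apply h
    ext
    omega

/-- The adjoint with respect to the bilinear form, over any commutative ring. -/
def adj (A : Mat n K) : Mat n K := rho n K * A.transpose * rho n K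

theorem sharp_eq_adj (A : Mat n ℝ) : sharp n A = adj A := rfl

theorem adj_mul (A B : Mat n K) : adj (A * B) = adj B * adj A := by
  simp only [adj, Matrix.transpose_mul]
  calc _ = rho n K * B.transpose * 1 * A.transpose * rho n K := by simp only [mul_assoc, one_mul]
    _ = _ := by rw [← rho_mul_rho]; simp only [mul_assoc]

theorem adj_adj (A : Mat n K) : adj (adj A) = A := by
  simp only [adj, Matrix.transpose_mul, Matrix.transpose_transpose, rho_transpose]
  calc _ = (rho n K * rho n K) * A * (rho n K * rho n K) := by simp only [mul_assoc]
    _ = _ := by rw [rho_mul_rho, one_mul, mul_one]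

@[simp] theorem adj_one : adj (1 : Mat n K) = 1 := by simp [adj, rho_mul_rho]

@[simp] theorem adj_zero : adj (0 : Mat n K) = 0 := by simp [adj]

theorem adj_add (A B : Mat n K) : adj (A + B) = adj A + adj B := by
  simp [adj, mul_add, add_mul]

theorem adj_sub (A B : Mat n K) : adj (A - B) = adj A - adj B := by
  simp [adj, mul_sub, sub_mul]

theorem adj_neg (A : Mat n K) : adj (-A) = -adj A := by simp [adj]

theorem adj_smul {S : Type*} [CommRing S] [Algebra S K] (c : S) (A : Mat n K) :
    adj (c • A) = c • adj A := by
  simp [adj, Matrix.transpose_smul]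

theorem map_rho {L : Type*} [CommRing L] (f : K →+* L) : (rho n K).map f = rho n L := by
  ext i j
  simp only [rho, Matrix.map_apply, Matrix.of_apply]
  split_ifs <;> simp

theorem mapMatrix_adj {L : Type*} [CommRing L] (f : K →+* L) (A : Mat n K) :
    f.mapMatrix (adj A) = adj (f.mapMatrix A) := by
  simp only [adj, map_mul]
  have : f.mapMatrix (rho n K) = rho n L := map_rho f
  rw [this]
  rfl

theorem det_adj (A : Mat n K) : (adj A).det = A.det := by
  have h : (rho n K).det * (rho n K).det = 1 := by
    rw [← Matrix.det_mul, rho_mul_rho, Matrix.det_one]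
  rw [adj, Matrix.det_mul, Matrix.det_mul, Matrix.det_transpose]
  linear_combination A.det * h

theorem orth_iff {A : Mat n K} :
    A.transpose * rho n K * A = rho n K ↔ adj A * A = 1 := by
  constructor
  · intro h
    rw [adj, mul_assoc, mul_assoc, ← mul_assoc A.transpose, h, rho_mul_rho]
  · intro h
    have := congrArg (fun X => rho n K * X) h
    simp only [adj, mul_one] at this
    rw [← mul_assoc, ← mul_assoc, ← mul_assoc, rho_mul_rho, one_mul] at this
    exact this

theorem isSkew_iff {A : Mat n ℝ} : IsSkew n A ↔ adj A = -A := by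
  constructor
  · intro h
    have := congrArg (fun X => rho n ℝ * X) (eq_neg_of_add_eq_zero_left h)
    simp only [mul_neg, ← mul_assoc, rho_mul_rho, one_mul] at this
    exact this
  · intro h
    have := congrArg (fun X => rho n ℝ * X) h
    simp only [adj, mul_neg, ← mul_assoc, rho_mul_rho, one_mul] at this
    rw [IsSkew, this, neg_add_cancel]

/-- `P` is a rank one idempotent. -/
def RankOne (P : Mat n K) : Prop := ∃ v w, w ⬝ᵥ v = 1 ∧ P = Matrix.vecMulVec v w

theorem vecMulVec_mul_mul_vecMulVec {m : Type*} [Fintype m] (v w v' w' : m → K)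
    (A : Matrix m m K) :
    Matrix.vecMulVec v w * A * Matrix.vecMulVec v' w' =
      (w ⬝ᵥ A.mulVec v') • Matrix.vecMulVec v w' := by
  rw [mul_assoc, Matrix.mul_vecMulVec, Matrix.vecMulVec_mul_vecMulVec, Matrix.vecMulVec_smul]

theorem RankOne.idem {P : Mat n K} (h : RankOne P) : P * P = P := by
  obtain ⟨v, w, hw, rfl⟩ := h
  rw [Matrix.vecMulVec_mul_vecMulVec, hw, one_smul]

theorem RankOne.mul_mul {P : Mat n K} (h : RankOne P) (A : Mat n K) :
    P * A * P = (P * A).trace • P := by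
  obtain ⟨v, w, hw, rfl⟩ := h
  rw [vecMulVec_mul_mul_vecMulVec, Matrix.vecMulVec_mul, Matrix.trace_vecMulVec,
    dotProduct_comm v, Matrix.dotProduct_mulVec]

theorem dotProduct_mulVec_self_of_transpose_eq_neg [NoZeroDivisors K] [CharZero K] {m : Type*}
    [Fintype m] {A : Matrix m m K} (h : A.transpose = -A) (v : m → K) : v ⬝ᵥ A.mulVec v = 0 := by
  have : v ⬝ᵥ A.mulVec v = -(v ⬝ᵥ A.mulVec v) := by
    conv_lhs => rw [Matrix.dotProduct_mulVec, dotProduct_comm, ← Matrix.mulVec_transpose, h,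
      Matrix.neg_mulVec, dotProduct_neg]
  exact self_eq_neg.mp this

theorem RankOne.adj {P : Mat n K} (h : RankOne P) : RankOne (adj P) := by
  obtain ⟨v, w, hw, rfl⟩ := h
  refine ⟨(rho n K).mulVec w, (rho n K).mulVec v, ?_, ?_⟩
  · rw [Matrix.dotProduct_mulVec, ← Matrix.mulVec_transpose, rho_transpose, Matrix.mulVec_mulVec,
      rho_mul_rho, Matrix.one_mulVec, dotProduct_comm, hw]
  · rw [BnFlow.adj, Matrix.transpose_vecMulVec, Matrix.mul_vecMulVec, Matrix.vecMulVec_mul,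
      ← Matrix.mulVec_transpose, rho_transpose]

/-- For `P = v wᵀ` the middle scalar is `vᵀ (ρ A) v`, which is zero because `ρ A` is antisymmetric.
This is the use of rank one that removes the derivative part of the double poles. -/
theorem RankOne.adj_mul_mul_self [NoZeroDivisors K] [CharZero K] {P A : Mat n K} (h : RankOne P)
    (hA : BnFlow.adj A = -A) : BnFlow.adj P * A * P = 0 := by
  obtain ⟨v, w, hw, rfl⟩ := h
  have h1 : (rho n K * A).transpose = -(rho n K * A) := by
    have := congrArg (fun X => X * rho n K) hA
    simp only [BnFlow.adj, mul_assoc, rho_mul_rho, mul_one] at this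
    have := congrArg (fun X => rho n K * X * rho n K) this
    simp only [← mul_assoc, rho_mul_rho, one_mul] at this
    rw [Matrix.transpose_mul, rho_transpose, this]
    simp [mul_assoc, rho_mul_rho]
  have h2 : BnFlow.adj (Matrix.vecMulVec v w) * A * Matrix.vecMulVec v w =
      rho n K * (Matrix.vecMulVec w v * (rho n K * A) * Matrix.vecMulVec v w) := by
    rw [BnFlow.adj, Matrix.transpose_vecMulVec]
    simp only [mul_assoc]
  rw [h2, vecMulVec_mul_mul_vecMulVec, dotProduct_mulVec_self_of_transpose_eq_neg h1, zero_smul,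
    mul_zero]

theorem RankOne.mul_mul_adj [NoZeroDivisors K] [CharZero K] {P A : Mat n K} (h : RankOne P)
    (hA : BnFlow.adj A = -A) : P * A * BnFlow.adj P = 0 := by
  have := h.adj.adj_mul_mul_self hA
  rwa [adj_adj] at this

theorem RankOne.mapMatrix {L : Type*} [CommRing L] (f : K →+* L) {P : Mat n K} (h : RankOne P) :
    RankOne (f.mapMatrix P) := by
  obtain ⟨v, w, hw, rfl⟩ := h
  refine ⟨f ∘ v, f ∘ w, ?_, ?_⟩
  · rw [← map_one f, ← hw, RingHom.map_dotProduct]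
  · ext i j
    simp [Matrix.vecMulVec_apply]

/-- A vector `v` spanning the image is the column factor, and `w` lists the coefficients of the
columns of `P` along `v`. Applying the idempotent to `v` forces `wᵀ v = 1`. -/
theorem rankOne_of_rank_eq_one {P : Mat n ℝ} (hP : P * P = P) (hr : P.rank = 1) : RankOne P := by
  have h1 : Module.finrank ℝ (LinearMap.range P.mulVecLin) = 1 := hr
  obtain ⟨⟨v, hv⟩, hv1, hspan⟩ := finrank_eq_one_iff'.mp h1
  have hv0 : v ≠ 0 := fun h => hv1 (Subtype.ext h)
  have hcol : ∀ x, ∃ c : ℝ, c • v = P.mulVec x := fun x => by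
    obtain ⟨c, hc⟩ := hspan ⟨P.mulVec x, x, rfl⟩
    exact ⟨c, congrArg Subtype.val hc⟩
  choose w hw using fun j => hcol (Pi.single j 1)
  have hPe : P = Matrix.vecMulVec v w := by
    ext i j
    have := congrFun (hw j) i
    simp only [Pi.smul_apply, smul_eq_mul, Matrix.mulVec_single_one, Matrix.col_apply] at this
    rw [Matrix.vecMulVec_apply, ← this, mul_comm]
  refine ⟨v, w, ?_, hPe⟩
  obtain ⟨y, rfl⟩ := hv
  have h2 : P.mulVec (P.mulVec y) = P.mulVec y := by rw [Matrix.mulVec_mulVec, hP]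
  simp only [Matrix.mulVecLin_apply] at *
  have h3 : P.mulVec (P.mulVec y) = (w ⬝ᵥ P.mulVec y) • P.mulVec y := by
    conv_lhs => rw [hPe]
    rw [Matrix.vecMulVec_mulVec, ← hPe]
    ext i
    simp [mul_comm]
  rw [h2] at h3
  by_contra hne
  apply hv0
  have : (1 - w ⬝ᵥ P.mulVec y) • P.mulVec y = 0 := by rw [sub_smul, one_smul, ← h3, sub_self]
  exact (smul_eq_zero.mp this).resolve_left (sub_ne_zero.mpr (Ne.symm hne))

/-- `Q` is the idempotent whose image and kernel are the preimages of those of `P` under the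
orthogonal matrices `A` and `C`, expressed by equations. -/
structure Link (P Q A C : Mat n K) : Prop where
  idem : Q * Q = Q
  im_le : P * A * Q = A * Q
  le_im : Q * adj A * P = adj A * P
  ke_le : P * C * Q = P * C
  le_ke : Q * adj C * P = Q * adj C

theorem Link.symm {P Q A C : Mat n K} (hP : P * P = P) (h : Link P Q A C) :
    Link Q P (adj A) (adj C) :=
  ⟨hP, h.le_im, by rw [adj_adj]; exact h.im_le, h.le_ke, by rw [adj_adj]; exact h.ke_le⟩

/-- A gain from replacing subspaces by equations: ring homomorphisms preserve them, so real links
can be used for complex `λ`. -/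
theorem Link.mapMatrix {L : Type*} [CommRing L] (f : K →+* L) {P Q A C : Mat n K}
    (h : Link P Q A C) :
    Link (f.mapMatrix P) (f.mapMatrix Q) (f.mapMatrix A) (f.mapMatrix C) := by
  constructor <;> simp only [← map_mul, ← mapMatrix_adj]
  · rw [h.idem]
  · rw [h.im_le]
  · rw [h.le_im]
  · rw [h.ke_le]
  · rw [h.le_ke]

/-- `P` is an idempotent with `P P♯ = P♯ P = 0`. -/
def IsoIdem (P : Mat n K) : Prop := OrthIdem P (adj P)

theorem isoIdem_iff {P : Mat n ℝ} : IsoIdem P ↔ P * P = P ∧ IsIsotropic n P :=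
  ⟨fun h => ⟨h.idem, h.mul_zero', h.zero_mul'⟩,
    fun h => ⟨h.1, by rw [← adj_mul, h.1], h.2.1, h.2.2⟩⟩

theorem IsoIdem.mapMatrix {L : Type*} [CommRing L] (f : K →+* L) {P : Mat n K} (h : IsoIdem P) :
    IsoIdem (f.mapMatrix P) := by
  constructor <;> simp only [← map_mul, ← mapMatrix_adj]
  · rw [h.idem]
  · rw [h.idem']
  · rw [h.mul_zero', map_zero]
  · rw [h.zero_mul', map_zero]

/-- Since `Q = Q C⁻¹ P C` and `A Q = P A Q`, the product `Q Q♯` contains the factor `P P♯`, and `Q♯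
Q` contains `P♯ P`. -/
theorem Link.isoIdem {P Q A C : Mat n K} (hP : IsoIdem P) (h : Link P Q A C)
    (hA : adj A * A = 1) (hC : C * adj C = 1) : IsoIdem Q := by
  refine ⟨h.idem, by rw [← adj_mul, h.idem], ?_, ?_⟩
  · have h1 : Q = Q * adj C * P * C := by
      rw [h.le_ke, mul_assoc, mul_eq_one_comm.mp hC, mul_one]
    calc Q * adj Q = (Q * adj C * P * C) * adj (Q * adj C * P * C) := by rw [← h1]
      _ = Q * adj C * (P * (C * adj C) * adj P) * adj (Q * adj C) := by
          simp only [adj_mul, mul_assoc]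
      _ = 0 := by rw [hC, mul_one, hP.mul_zero', mul_zero, zero_mul]
  · calc adj Q * Q = adj Q * (adj A * A) * Q := by rw [hA, mul_one]
      _ = adj (A * Q) * (A * Q) := by simp only [adj_mul, mul_assoc]
      _ = adj (P * A * Q) * (P * A * Q) := by rw [h.im_le]
      _ = adj (A * Q) * (adj P * P) * (A * Q) := by simp only [adj_mul, mul_assoc]
      _ = 0 := by rw [hP.zero_mul', mul_zero, zero_mul]

end Adjoint

/-! ### Explicit formula for a linked rank one projection -/

section Field

variable {n : ℕ} {K : Type*} [Field K]

/-- For `P = v wᵀ` the trace is `wᵀ C A⁻¹ v`: it is nonzero exactly when the line `A⁻¹ Im P` is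
transversal to the hyperplane `C⁻¹ Ker P`. In that case `A⁻¹ P C`, normalized, is the projection. -/
theorem Link.of_trace_ne_zero {P A C : Mat n K} (hP : RankOne P)
    (hs : (P * (C * adj A)).trace ≠ 0) (hA : A * adj A = 1) (hC : C * adj C = 1) :
    Link P ((P * (C * adj A)).trace⁻¹ • (adj A * P * C)) A C := by
  set s := (P * (C * adj A)).trace
  have hPP := hP.mul_mul (C * adj A)
  change P * (C * adj A) * P = s • P at hPP
  have e1 : adj A * P * C * (adj A * P * C) = s • (adj A * P * C) := by
    calc _ = adj A * (P * (C * adj A) * P) * C := by simp only [mul_assoc]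
      _ = _ := by rw [hPP]; simp
  constructor
  · rw [smul_mul_assoc, mul_smul_comm, e1, smul_smul s⁻¹ s, inv_mul_cancel₀ hs, one_smul]
  · simp only [mul_smul_comm]
    refine congrArg (s⁻¹ • ·) ?_
    calc P * A * (adj A * P * C) = P * (A * adj A) * P * C := by simp only [mul_assoc]
      _ = A * adj A * P * C := by rw [hA]; simp [hP.idem]
      _ = _ := by simp only [mul_assoc]
  · simp only [smul_mul_assoc]
    calc s⁻¹ • (adj A * P * C * adj A * P) = s⁻¹ • (adj A * (P * (C * adj A) * P)) := by
          simp only [mul_assoc]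
      _ = _ := by rw [hPP, mul_smul_comm, smul_smul, inv_mul_cancel₀ hs, one_smul]
  · simp only [mul_smul_comm]
    calc s⁻¹ • (P * C * (adj A * P * C)) = s⁻¹ • ((P * (C * adj A) * P) * C) := by
          simp only [mul_assoc]
      _ = _ := by rw [hPP, smul_mul_assoc, smul_smul, inv_mul_cancel₀ hs, one_smul]
  · simp only [smul_mul_assoc]
    refine congrArg (s⁻¹ • ·) ?_
    calc adj A * P * C * adj C * P = adj A * P * (C * adj C) * P := by simp only [mul_assoc]
      _ = adj A * (P * P) := by rw [hC, mul_one, mul_assoc]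
      _ = adj A * P * (C * adj C) := by rw [hP.idem, hC, mul_one]
      _ = _ := by simp only [mul_assoc]

theorem RankOne.ne_zero {P : Mat n K} (h : RankOne P) : P ≠ 0 := by
  intro h0
  obtain ⟨v, w, hw, rfl⟩ := h
  have := Matrix.trace_vecMulVec v w
  rw [h0, Matrix.trace_zero, dotProduct_comm, hw] at this
  exact zero_ne_one this

/-- The link gives `Q = A⁻¹ P (A Q C⁻¹) P C`, which is a multiple `t M` of `M = A⁻¹ P C` because `P`
has rank one. From `M² = s M` and `Q² = Q ≠ 0` follows `t s = 1`. -/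
theorem Link.eq_smul {P Q A C : Mat n K} (hP : RankOne P) (h : Link P Q A C)
    (hA : adj A * A = 1) (hC : adj C * C = 1) :
    (P * (C * adj A)).trace ≠ 0 ∧ Q = (P * (C * adj A)).trace⁻¹ • (adj A * P * C) := by
  set s := (P * (C * adj A)).trace with hs
  have hPP := hP.mul_mul (C * adj A)
  rw [← hs] at hPP
  set M := adj A * P * C with hM
  have hQ : Q = (P * (A * Q * adj C)).trace • M := by
    have h1 : Q = adj A * P * A * Q := by
      rw [mul_assoc, mul_assoc, ← mul_assoc P, h.im_le, ← mul_assoc, hA, one_mul]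
    have h2 : Q = Q * adj C * P * C := by rw [h.le_ke, mul_assoc, hC, mul_one]
    calc Q = (adj A * P * A * Q) * (Q * adj C * P * C) := by rw [← h1, ← h2, h.idem]
      _ = adj A * (P * (A * (Q * Q) * adj C) * P) * C := by simp only [mul_assoc]
      _ = _ := by rw [h.idem, hP.mul_mul]; simp [hM]
  set t := (P * (A * Q * adj C)).trace
  have hQ0 : Q ≠ 0 := by
    intro h0
    have h1 := h.le_im
    rw [h0, zero_mul, zero_mul] at h1
    have : A * (adj A * P) = P := by rw [← mul_assoc, mul_eq_one_comm.mp hA, one_mul]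
    rw [← h1, mul_zero] at this
    exact hP.ne_zero this.symm
  have hMM : M * M = s • M := by
    calc _ = adj A * (P * (C * adj A) * P) * C := by simp only [hM, mul_assoc]
      _ = _ := by rw [hPP]; simp [hM]
  have h1 : (t * s) • Q = Q := by
    have := h.idem
    nth_rewrite 1 2 [hQ] at this
    rw [smul_mul_assoc, mul_smul_comm, hMM, smul_smul t s, smul_comm, ← hQ] at this
    exact this
  have hts : t * s = 1 := by
    have : (t * s - 1) • Q = 0 := by rw [sub_smul, h1, one_smul, sub_self]
    exact sub_eq_zero.mp ((smul_eq_zero.mp this).resolve_right hQ0)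
  have hs0 : s ≠ 0 := right_ne_zero_of_mul_eq_one hts
  refine ⟨hs0, ?_⟩
  rw [← eq_inv_of_mul_eq_one_left hts]
  exact hQ

theorem Link.rankOne {P Q A C : Mat n K} (hP : RankOne P) (h : Link P Q A C)
    (hA : adj A * A = 1) (hC : adj C * C = 1) : RankOne Q := by
  obtain ⟨hs, hQ⟩ := h.eq_smul hP hA hC
  obtain ⟨v, w, hw, rfl⟩ := hP
  set s := (Matrix.vecMulVec v w * (C * BnFlow.adj A)).trace with hsd
  refine ⟨s⁻¹ • (BnFlow.adj A).mulVec v, Matrix.vecMul w C, ?_, ?_⟩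
  · rw [dotProduct_smul, Matrix.dotProduct_mulVec, Matrix.vecMul_vecMul, ← dotProduct_comm v,
      ← Matrix.trace_vecMulVec, ← Matrix.vecMulVec_mul, ← hsd, smul_eq_mul, inv_mul_cancel₀ hs]
  · rw [hQ, Matrix.mul_vecMulVec, Matrix.vecMulVec_mul, Matrix.smul_vecMulVec]

end Field

/-! ### Images and kernels expressed by links -/

section Projections

variable {n : ℕ}

theorem mem_im {A : Mat n ℝ} (hA : A * A = A) {x} : x ∈ im A ↔ A.mulVec x = x := by
  constructor
  · rintro ⟨y, rfl⟩
    simp [Matrix.mulVec_mulVec, hA]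
  · intro h
    exact ⟨x, h⟩

theorem mem_ke {A : Mat n ℝ} {x} : x ∈ ke A ↔ A.mulVec x = 0 := by
  simp [ke]

theorem mulVec_ext {m : Type*} [Fintype m] {A B : Matrix m m ℝ}
    (h : ∀ x, A.mulVec x = B.mulVec x) : A = B := by
  classical
  exact Matrix.mulVec_injective (funext h)

/-- The four equations come from testing the two subspaces on the vectors `Q x`, `A⁻¹ P x`, `(1 - Q)
x` and `C⁻¹ (1 - P) x`. -/
theorem isProj_comap_iff {P Q A C : Mat n ℝ} (hP : P * P = P) (hA : A * adj A = 1)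
    (hC : C * adj C = 1) :
    IsProj Q ((im P).comap A.mulVecLin) ((ke P).comap C.mulVecLin) ↔ Link P Q A C := by
  have hA' := mul_eq_one_comm.mp hA
  have hC' := mul_eq_one_comm.mp hC
  constructor
  · rintro ⟨hQ, hi, hk⟩
    have hi' : ∀ x, Q.mulVec x = x ↔ P.mulVec (A.mulVec x) = A.mulVec x := fun x => by
      rw [← mem_im hQ, hi, Submodule.mem_comap, mem_im hP]; rfl
    have hk' : ∀ x, Q.mulVec x = 0 ↔ P.mulVec (C.mulVec x) = 0 := fun x => by
      rw [← mem_ke, hk, Submodule.mem_comap, mem_ke]; rfl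
    refine ⟨hQ, mulVec_ext fun x => ?_, mulVec_ext fun x => ?_, mulVec_ext fun x => ?_,
      mulVec_ext fun x => ?_⟩
    · have := (hi' (Q.mulVec x)).1 (by rw [Matrix.mulVec_mulVec, hQ])
      simpa only [Matrix.mulVec_mulVec, ← mul_assoc] using this
    · have := (hi' ((adj A * P).mulVec x)).2 (by
        simp only [Matrix.mulVec_mulVec, ← mul_assoc]
        rw [mul_assoc P, hA, mul_one, hP, one_mul])
      simpa only [Matrix.mulVec_mulVec, mul_assoc] using this
    · have := (hk' ((1 - Q).mulVec x)).1 (by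
        rw [Matrix.mulVec_mulVec, mul_sub, hQ, mul_one, sub_self, Matrix.zero_mulVec])
      rw [Matrix.mulVec_mulVec, Matrix.mulVec_mulVec, mul_sub, mul_one, Matrix.sub_mulVec,
        sub_eq_zero] at this
      exact this.symm
    · have := (hk' ((adj C * (1 - P)).mulVec x)).2 (by
        simp only [Matrix.mulVec_mulVec, ← mul_assoc]
        rw [mul_assoc P, hC, mul_one, mul_sub, hP, mul_one, sub_self, Matrix.zero_mulVec])
      rw [Matrix.mulVec_mulVec, ← mul_assoc, mul_sub, mul_one, Matrix.sub_mulVec,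
        sub_eq_zero] at this
      exact this.symm
  · intro h
    refine ⟨h.idem, ?_, ?_⟩
    · ext x
      rw [mem_im h.idem, Submodule.mem_comap, mem_im hP, Matrix.mulVecLin_apply]
      constructor
      · intro hx
        rw [← hx]
        simp only [Matrix.mulVec_mulVec, ← mul_assoc, h.im_le]
      · intro hx
        have h1 : x = (adj A * P * A).mulVec x := by
          rw [mul_assoc, ← Matrix.mulVec_mulVec, ← Matrix.mulVec_mulVec, hx, Matrix.mulVec_mulVec,
            hA', Matrix.one_mulVec]
        rw [h1, Matrix.mulVec_mulVec, ← mul_assoc, ← mul_assoc, h.le_im]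
    · ext x
      rw [mem_ke, Submodule.mem_comap, mem_ke, Matrix.mulVecLin_apply, Matrix.mulVec_mulVec]
      constructor
      · intro hx
        rw [← h.ke_le, ← Matrix.mulVec_mulVec, hx, Matrix.mulVec_zero]
      · intro hx
        have h1 : Q = Q * adj C * (P * C) := by
          rw [← mul_assoc, h.le_ke, mul_assoc, hC', mul_one]
        rw [h1, ← Matrix.mulVec_mulVec, hx, Matrix.mulVec_zero]

theorem map_mulVecLin_eq_comap_adj {A : Mat n ℝ} (hA : A * adj A = 1)
    (V : Submodule ℝ (Fin (2 * n + 1) → ℝ)) :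
    V.map A.mulVecLin = V.comap (adj A).mulVecLin := by
  ext x
  rw [Submodule.mem_map, Submodule.mem_comap, Matrix.mulVecLin_apply]
  constructor
  · rintro ⟨y, hy, rfl⟩
    rwa [Matrix.mulVecLin_apply, Matrix.mulVec_mulVec, mul_eq_one_comm.mp hA, Matrix.one_mulVec]
  · intro hx
    exact ⟨_, hx, by rw [Matrix.mulVecLin_apply, Matrix.mulVec_mulVec, hA, Matrix.one_mulVec]⟩

theorem isProj_map_iff {P Q A C : Mat n ℝ} (hP : P * P = P) (hA : A * adj A = 1)
    (hC : C * adj C = 1) :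
    IsProj Q ((im P).map A.mulVecLin) ((ke P).map C.mulVecLin) ↔ Link P Q (adj A) (adj C) := by
  rw [map_mulVecLin_eq_comap_adj hA, map_mulVecLin_eq_comap_adj hC]
  exact isProj_comap_iff hP (by rw [adj_adj]; exact mul_eq_one_comm.mp hA)
    (by rw [adj_adj]; exact mul_eq_one_comm.mp hC)

end Projections

/-! ### Entrywise differentiation of matrix functions -/

section Derivatives

variable {n : ℕ} {𝕜 K : Type*} [NontriviallyNormedField 𝕜] [NormedField K] [NormedAlgebra 𝕜 K]

/-- Entrywise derivative of a matrix function of one variable. -/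
def HasMDerivAt (𝕜 : Type*) {K : Type*} [NontriviallyNormedField 𝕜] [NormedField K]
    [NormedAlgebra 𝕜 K] (f : 𝕜 → Mat n K) (f' : Mat n K) (x : 𝕜) : Prop :=
  ∀ i j, HasDerivAt (fun y => f y i j) (f' i j) x

variable {f g : 𝕜 → Mat n K} {f' g' : Mat n K} {x : 𝕜}

theorem HasMDerivAt.const (A : Mat n K) : HasMDerivAt 𝕜 (fun _ => A) 0 x :=
  fun i j => hasDerivAt_const x (A i j)

theorem HasMDerivAt.add (hf : HasMDerivAt 𝕜 f f' x) (hg : HasMDerivAt 𝕜 g g' x) :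
    HasMDerivAt 𝕜 (fun y => f y + g y) (f' + g') x :=
  fun i j => (hf i j).fun_add (hg i j)

theorem HasMDerivAt.sub (hf : HasMDerivAt 𝕜 f f' x) (hg : HasMDerivAt 𝕜 g g' x) :
    HasMDerivAt 𝕜 (fun y => f y - g y) (f' - g') x :=
  fun i j => (hf i j).fun_sub (hg i j)

theorem HasMDerivAt.mul (hf : HasMDerivAt 𝕜 f f' x) (hg : HasMDerivAt 𝕜 g g' x) :
    HasMDerivAt 𝕜 (fun y => f y * g y) (f' * g x + f x * g') x := by
  intro i j
  have : HasDerivAt (fun y => ∑ k, f y i k * g y k j)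
      (∑ k, (f' i k * g x k j + f x i k * g' k j)) x :=
    HasDerivAt.fun_sum fun k _ => (hf i k).fun_mul (hg k j)
  simpa only [Matrix.mul_apply, Matrix.add_apply, Finset.sum_add_distrib] using this

theorem HasMDerivAt.smul {c : 𝕜 → K} {c' : K} (hc : HasDerivAt c c' x)
    (hf : HasMDerivAt 𝕜 f f' x) :
    HasMDerivAt 𝕜 (fun y => c y • f y) (c' • f x + c x • f') x := by
  intro i j
  have := hc.fun_mul (hf i j)
  simpa only [Matrix.smul_apply, Matrix.add_apply, smul_eq_mul] using this

theorem HasMDerivAt.const_smul (c : K) (hf : HasMDerivAt 𝕜 f f' x) :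
    HasMDerivAt 𝕜 (fun y => c • f y) (c • f') x := fun i j => by
  have := (hf i j).const_mul c
  simpa only [Matrix.smul_apply, smul_eq_mul] using this

theorem HasMDerivAt.const_mul (A : Mat n K) (hf : HasMDerivAt 𝕜 f f' x) :
    HasMDerivAt 𝕜 (fun y => A * f y) (A * f') x := by
  simpa using (HasMDerivAt.const A).mul hf

theorem HasMDerivAt.mul_const (hf : HasMDerivAt 𝕜 f f' x) (A : Mat n K) :
    HasMDerivAt 𝕜 (fun y => f y * A) (f' * A) x := by
  simpa using hf.mul (HasMDerivAt.const A)

theorem HasMDerivAt.transpose (hf : HasMDerivAt 𝕜 f f' x) :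
    HasMDerivAt 𝕜 (fun y => (f y).transpose) f'.transpose x :=
  fun i j => hf j i

theorem HasMDerivAt.adj (hf : HasMDerivAt 𝕜 f f' x) :
    HasMDerivAt 𝕜 (fun y => adj (f y)) (adj f') x :=
  (hf.transpose.const_mul _).mul_const _

theorem HasMDerivAt.unique (hf : HasMDerivAt 𝕜 f f' x) (hg : HasMDerivAt 𝕜 f g' x) : f' = g' :=
  Matrix.ext fun i j => (hf i j).unique (hg i j)

theorem HasMDerivAt.congr_of_eventuallyEq (hf : HasMDerivAt 𝕜 f f' x) (h : g =ᶠ[𝓝 x] f) :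
    HasMDerivAt 𝕜 g f' x :=
  fun i j => (hf i j).congr_of_eventuallyEq (h.mono fun _ hy => congrFun (congrFun hy i) j)

theorem HasMDerivAt.trace (hf : HasMDerivAt 𝕜 f f' x) :
    HasDerivAt (fun y => (f y).trace) f'.trace x :=
  HasDerivAt.fun_sum fun i _ => hf i i

end Derivatives

/-! ### Complexification -/

section OfReal

variable {n : ℕ}

/-- Complexification of real matrices. -/
def cx (A : Mat n ℝ) : Mat n ℂ := A.map Complex.ofReal

theorem cx_eq (A : Mat n ℝ) : cx A = Complex.ofRealHom.mapMatrix A := rfl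

@[simp] theorem cx_apply (A : Mat n ℝ) (i j) : cx A i j = (A i j : ℂ) := rfl

theorem cx_mul (A B : Mat n ℝ) : cx (A * B) = cx A * cx B :=
  map_mul Complex.ofRealHom.mapMatrix A B
theorem cx_add (A B : Mat n ℝ) : cx (A + B) = cx A + cx B :=
  map_add Complex.ofRealHom.mapMatrix A B
theorem cx_sub (A B : Mat n ℝ) : cx (A - B) = cx A - cx B :=
  map_sub Complex.ofRealHom.mapMatrix A B
theorem cx_neg (A : Mat n ℝ) : cx (-A) = -cx A := map_neg Complex.ofRealHom.mapMatrix A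
@[simp] theorem cx_one : cx (1 : Mat n ℝ) = 1 := map_one Complex.ofRealHom.mapMatrix
@[simp] theorem cx_zero : cx (0 : Mat n ℝ) = 0 := map_zero Complex.ofRealHom.mapMatrix
theorem cx_adj (A : Mat n ℝ) : cx (adj A) = adj (cx A) := mapMatrix_adj Complex.ofRealHom A
theorem cx_smul (c : ℝ) (A : Mat n ℝ) : cx (c • A) = (c : ℂ) • cx A := by
  ext i j; simp [cx]

theorem cx_lie (A B : Mat n ℝ) : cx ⁅A, B⁆ = ⁅cx A, cx B⁆ := by
  simp only [Ring.lie_def, cx_sub, cx_mul]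

theorem cx_injective : Function.Injective (cx : Mat n ℝ → Mat n ℂ) := fun _ _ h =>
  Matrix.ext fun i j => Complex.ofReal_injective (congrFun (congrFun h i) j)

theorem HasMDerivAt.cx {f : ℝ → Mat n ℝ} {f' : Mat n ℝ} {x : ℝ} (hf : HasMDerivAt ℝ f f' x) :
    HasMDerivAt ℝ (fun y => cx (f y)) (cx f') x :=
  fun i j => (hf i j).ofReal_comp

theorem hasMDerivAt_of_cx {f : ℝ → Mat n ℝ} {f' : Mat n ℝ} {x : ℝ}
    (hf : HasMDerivAt ℝ (fun y => BnFlow.cx (f y)) (BnFlow.cx f') x) : HasMDerivAt ℝ f f' x := by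
  intro i j
  have := (Complex.reCLM.hasFDerivAt.comp_hasDerivAt x (hf i j))
  simpa [Function.comp_def] using this

end OfReal

/-! ### Simple elements as instances of the abstract factor -/

section Simple

variable {n : ℕ} {K : Type*} [Field K]

theorem inv_sub_inv_relation {a b z : K} (ha : z ≠ a) (hb : z ≠ b) :
    (b - a) * (z - a)⁻¹ * (z - b)⁻¹ = (z - b)⁻¹ - (z - a)⁻¹ := by
  have h1 := sub_ne_zero.mpr ha
  have h2 := sub_ne_zero.mpr hb
  field_simp
  ring

variable [Algebra ℝ K]

theorem simpleElt_eq_dress (a b : ℝ) (A : Mat n ℝ) (z : K) :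
    simpleElt a b A z = dress (algebraMap ℝ K (b - a)) (z - algebraMap ℝ K a)⁻¹
      (z - algebraMap ℝ K b)⁻¹ ((algebraMap ℝ K).mapMatrix A)
      (adj ((algebraMap ℝ K).mapMatrix A)) := by
  rw [← mapMatrix_adj, simpleElt, dress, div_eq_mul_inv, div_eq_mul_inv, sharp_eq_adj,
    ← neg_sub b a, map_neg, neg_mul, neg_smul, ← sub_eq_add_neg]
  rfl

theorem adj_dress {L : Type*} [CommRing L] (d u v : L) (P P' : Mat n L) :
    adj (dress d u v P P') = dress d u v (adj P) (adj P') := by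
  simp [dress, adj_add, adj_sub, adj_smul]

theorem simpleElt_mul_adj {a b : ℝ} {A : Mat n ℝ} (hA : IsoIdem A) {z : K}
    (ha : z ≠ algebraMap ℝ K a) (hb : z ≠ algebraMap ℝ K b) :
    simpleElt a b A z * adj (simpleElt a b A z) = 1 := by
  rw [simpleElt_eq_dress, adj_dress, adj_adj, map_sub]
  exact dress_mul_dress_swap (inv_sub_inv_relation ha hb) (hA.mapMatrix _)

theorem simpleElt_real {a b : ℝ} {A : Mat n ℝ} (x : ℝ) :
    cx (simpleElt a b A x) = simpleElt a b A (x : ℂ) := by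
  ext i j
  simp [simpleElt, Matrix.one_apply, apply_ite]

/-- The factor splits as `(1 + d v P) (1 - d u P)♯`. Taking adjoints keeps the determinant, and `1 -
d u P` is the inverse of `1 + d v P`. -/
theorem det_dress {L : Type*} [CommRing L] {d u v : L} {P : Mat n L} (hP : IsoIdem P)
    (huv : d * u * v = v - u) : (dress d u v P (adj P)).det = 1 := by
  have h1 : dress d u v P (adj P) = (1 + (d * v) • P) * adj (1 - (d * u) • P) := by
    rw [adj_sub, adj_smul, adj_one]
    simp only [dress, add_mul, mul_sub, one_mul, mul_one, smul_mul_assoc, mul_smul_comm,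
      hP.mul_zero', smul_zero]
    abel_nf
  have h2 : (1 + (d * v) • P) * (1 - (d * u) • P) = 1 := by
    simp only [add_mul, mul_sub, one_mul, mul_one, smul_mul_assoc, mul_smul_comm, hP.idem]
    match_scalars
    · ring
    · linear_combination (-d) * huv
  rw [h1, Matrix.det_mul, det_adj, ← Matrix.det_mul, h2, Matrix.det_one]

theorem det_simpleElt {a b : ℝ} {A : Mat n ℝ} (hA : IsoIdem A) {z : K}
    (ha : z ≠ algebraMap ℝ K a) (hb : z ≠ algebraMap ℝ K b) :
    (simpleElt a b A z).det = 1 := by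
  rw [simpleElt_eq_dress, map_sub]
  exact det_dress (hA.mapMatrix _) (inv_sub_inv_relation ha hb)

theorem simpleElt_cx (a b : ℝ) (A : Mat n ℝ) (z : ℂ) :
    simpleElt a b A z = dress ((b : ℂ) - a) (z - a)⁻¹ (z - b)⁻¹ (cx A) (adj (cx A)) := by
  have := simpleElt_eq_dress a b A z
  simp only [map_sub, Complex.coe_algebraMap] at this
  exact this

theorem simpleElt_conj (a b : ℝ) (A : Mat n ℝ) (z : ℂ) :
    (simpleElt a b A (starRingEnd ℂ z)).map (starRingEnd ℂ) = simpleElt a b A z := by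
  ext i j
  simp [simpleElt, Matrix.one_apply, apply_ite]

end Simple

/-! ### Removable singularities and Liouville's theorem for matrices -/

section Holomorphic

variable {n : ℕ}

/-- Entrywise holomorphy. -/
def HoloOn (f : ℂ → Mat n ℂ) (U : Set ℂ) : Prop :=
  ∀ i j, DifferentiableOn ℂ (fun z => f z i j) U

variable {U : Set ℂ} {f g : ℂ → Mat n ℂ}

theorem HoloOn.const (A : Mat n ℂ) : HoloOn (fun _ => A) U :=
  fun i j => differentiableOn_const (A i j)

theorem HoloOn.add (hf : HoloOn f U) (hg : HoloOn g U) : HoloOn (fun z => f z + g z) U :=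
  fun i j => (hf i j).fun_add (hg i j)

theorem HoloOn.sub (hf : HoloOn f U) (hg : HoloOn g U) : HoloOn (fun z => f z - g z) U :=
  fun i j => (hf i j).fun_sub (hg i j)

theorem HoloOn.smul {c : ℂ → ℂ} (hc : DifferentiableOn ℂ c U) (hf : HoloOn f U) :
    HoloOn (fun z => c z • f z) U :=
  fun i j => hc.fun_mul (hf i j)

theorem HoloOn.mul (hf : HoloOn f U) (hg : HoloOn g U) : HoloOn (fun z => f z * g z) U := by
  intro i j
  have : DifferentiableOn ℂ (fun z => ∑ k, f z i k * g z k j) U :=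
    DifferentiableOn.fun_sum fun k _ => (hf i k).fun_mul (hg k j)
  simpa only [Matrix.mul_apply] using this

theorem HoloOn.const_mul (hf : HoloOn f U) (A : Mat n ℂ) : HoloOn (fun z => A * f z) U :=
  (HoloOn.const A).mul hf

theorem HoloOn.mul_const (hf : HoloOn f U) (A : Mat n ℂ) : HoloOn (fun z => f z * A) U :=
  hf.mul (HoloOn.const A)

theorem HoloOn.adj (hf : HoloOn f U) : HoloOn (fun z => adj (f z)) U :=
  HoloOn.mul_const (HoloOn.const_mul (f := fun z => (f z).transpose) (fun i j => hf j i) _) _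

theorem HoloOn.congr (hf : HoloOn f U) (h : ∀ z ∈ U, g z = f z) : HoloOn g U :=
  fun i j => (hf i j).congr fun z hz => by rw [h z hz]

theorem HoloOn.hasMDerivAt (hf : HoloOn f U) (hU : IsOpen U) {z : ℂ} (hz : z ∈ U) :
    ∃ f', HasMDerivAt ℂ f f' z :=
  ⟨Matrix.of fun i j => deriv (fun z => f z i j) z,
    fun i j => ((hf i j).differentiableAt (hU.mem_nhds hz)).hasDerivAt⟩

theorem HoloOn.continuousOn (hf : HoloOn f U) : ContinuousOn f U :=
  continuousOn_pi.mpr fun i => continuousOn_pi.mpr fun j => (hf i j).continuousOn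

theorem holoOn_univ : HoloOn f univ ↔ ∀ i j, Differentiable ℂ fun z => f z i j := by
  simp [HoloOn, differentiableOn_univ]

/-- Removal of a simple pole. -/
theorem HoloOn.exists_div (hU : IsOpen U) {a : ℂ} (ha : a ∈ U) (hf : HoloOn f U) (h0 : f a = 0) :
    ∃ h : ℂ → Mat n ℂ, HoloOn h U ∧ (∀ z, z ≠ a → h z = (z - a)⁻¹ • f z) ∧
      HasMDerivAt ℂ f (h a) a := by
  refine ⟨fun z => Matrix.of fun i j => dslope (fun z => f z i j) a z, fun i j => ?_,
    fun z hz => ?_, fun i j => ?_⟩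
  · exact (Complex.differentiableOn_dslope (hU.mem_nhds ha)).mpr (hf i j)
  · ext i j
    simp [dslope_of_ne _ hz, slope_def_field, h0, div_eq_inv_mul]
  · simpa using ((hf i j).differentiableAt (hU.mem_nhds ha)).hasDerivAt

/-- Removal of a double pole. -/
theorem HoloOn.exists_div_sq (hU : IsOpen U) {a : ℂ} (ha : a ∈ U) (hf : HoloOn f U)
    (h0 : f a = 0) (h1 : HasMDerivAt ℂ f 0 a) :
    ∃ h : ℂ → Mat n ℂ, HoloOn h U ∧ (∀ z, z ≠ a → h z = ((z - a)⁻¹ * (z - a)⁻¹) • f z) := by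
  obtain ⟨k, hk, hk', hd⟩ := hf.exists_div hU ha h0
  obtain ⟨h, hh, hh', -⟩ := hk.exists_div hU ha (hd.unique h1)
  exact ⟨h, hh, fun z hz => by rw [hh' z hz, hk' z hz, smul_smul]⟩

/-- Partial fractions: `d u v = v - u` eliminates all mixed terms and leaves simple and double poles
at either point. Their coefficients are the expressions that `HoloOn.exists_dress_extension`
requires to vanish. -/
theorem dress_mul_dress_expand {K R : Type*} [CommRing K] [Ring R] [Algebra K R] {d u v : K}
    (huv : d * u * v = v - u) {M P P' Q Q' D D' : R} :
    dress d u v P P' * (M * dress d u v Q' Q - (d * u) • D + (d * v) • D') =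
      M + (d * v) • (P * (M * (1 - Q) - D) + (1 - P') * (M * Q' + D'))
      - (d * u) • (P' * (M * (1 - Q') - D') + (1 - P) * (M * Q + D))
      + (d * d * (v * v)) • (P * (M * Q' + D')) + (d * d * (u * u)) • (P' * (M * Q + D)) := by
  simp only [dress, add_mul, mul_add, sub_mul, mul_sub, smul_mul_assoc, mul_smul_comm, one_mul,
    mul_one, smul_add, smul_sub]
  match_scalars <;> first | ring1 | linear_combination (-d) * huv

/-- A product of simple factors with a holomorphic function has removable singularities at the
poles of the factors if the residues vanish. -/
theorem HoloOn.exists_dress_extension (hU : IsOpen U) {a b : ℂ} (ha : a ∈ U) (hb : b ∈ U)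
    {M : ℂ → Mat n ℂ} (hM : HoloOn M U) {P P' Q Q' D D' Ma Mb : Mat n ℂ}
    (hMa : HasMDerivAt ℂ M Ma a) (hMb : HasMDerivAt ℂ M Mb b)
    (a1 : (1 - P) * (M a * Q + D) = 0) (a2 : P' * (M a * (1 - Q') - D') = 0)
    (a3 : P' * (M a * Q + D) = 0) (a4 : P' * Ma * Q = 0)
    (b1 : (1 - P') * (M b * Q' + D') = 0) (b2 : P * (M b * (1 - Q) - D) = 0)
    (b3 : P * (M b * Q' + D') = 0) (b4 : P * Mb * Q' = 0) :
    ∃ W, HoloOn W U ∧ ∀ z, z ≠ a → z ≠ b →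
      W z = dress (b - a) (z - a)⁻¹ (z - b)⁻¹ P P' *
        (M z * dress (b - a) (z - a)⁻¹ (z - b)⁻¹ Q' Q - ((b - a) * (z - a)⁻¹) • D
          + ((b - a) * (z - b)⁻¹) • D') := by
  have c : ∀ A : Mat n ℂ, HoloOn (fun _ => A) U := fun A => HoloOn.const A
  -- `X` and `Z` are the simple-pole terms at `a` and `b`, `Y` and `T` the double-pole terms. The
  -- latter need a zero of second order, hence the conditions `a4` and `b4` on derivatives.
  obtain ⟨X, hX, hX', -⟩ := HoloOn.exists_div hU ha
    ((((hM.mul_const (1 - Q')).sub (c D')).const_mul P').add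
      (((hM.mul_const Q).add (c D)).const_mul (1 - P))) (by simp only [a1, a2, add_zero])
  obtain ⟨Y, hY, hY'⟩ := HoloOn.exists_div_sq hU ha
    (((hM.mul_const Q).add (c D)).const_mul P') a3 (by
      have := ((hMa.mul_const Q).add (HasMDerivAt.const D)).const_mul P'
      rwa [add_zero, ← mul_assoc, a4] at this)
  obtain ⟨Z, hZ, hZ', -⟩ := HoloOn.exists_div hU hb
    ((((hM.mul_const (1 - Q)).sub (c D)).const_mul P).add
      (((hM.mul_const Q').add (c D')).const_mul (1 - P'))) (by simp only [b1, b2, add_zero])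
  obtain ⟨T, hT, hT'⟩ := HoloOn.exists_div_sq hU hb
    (((hM.mul_const Q').add (c D')).const_mul P) b3 (by
      have := ((hMb.mul_const Q').add (HasMDerivAt.const D')).const_mul P
      rwa [add_zero, ← mul_assoc, b4] at this)
  have cs : ∀ (k : ℂ) {f : ℂ → Mat n ℂ}, HoloOn f U → HoloOn (fun z => k • f z) U :=
    fun k f hf => HoloOn.smul (differentiableOn_const k) hf
  refine ⟨fun z => M z + (b - a) • Z z - (b - a) • X z + ((b - a) * (b - a)) • T z
    + ((b - a) * (b - a)) • Y z, (((hM.add (cs _ hZ)).sub (cs _ hX)).add (cs _ hT)).add (cs _ hY),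
    fun z hza hzb => ?_⟩
  rw [dress_mul_dress_expand (inv_sub_inv_relation hza hzb)]
  simp only [hX' z hza, hY' z hza, hZ' z hzb, hT' z hzb, smul_smul]

/-- Liouville's theorem for matrix functions. -/
theorem eq_of_holo_of_tendsto (hf : HoloOn f univ) {A : Mat n ℂ}
    (h : Tendsto f (Bornology.cobounded ℂ) (𝓝 A)) (z : ℂ) : f z = A := by
  ext i j
  refine Differentiable.apply_eq_of_tendsto_cocompact (holoOn_univ.mp hf i j) z ?_
  rw [← Metric.cobounded_eq_cocompact]
  exact (tendsto_pi_nhds.mp (tendsto_pi_nhds.mp h i) j)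

theorem tendsto_inv_sub_cobounded (a : ℂ) :
    Tendsto (fun z : ℂ => (z - a)⁻¹) (Bornology.cobounded ℂ) (𝓝 0) := by
  refine tendsto_inv₀_cobounded.comp ?_
  exact tendsto_sub_const_cobounded a

theorem tendsto_dress_cobounded (d a b : ℂ) (P P' : Mat n ℂ) :
    Tendsto (fun z : ℂ => dress d (z - a)⁻¹ (z - b)⁻¹ P P') (Bornology.cobounded ℂ) (𝓝 1) := by
  have h1 := ((tendsto_inv_sub_cobounded b).const_mul d).smul_const P
  have h2 := ((tendsto_inv_sub_cobounded a).const_mul d).smul_const P'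
  have := (h1.const_add 1).sub h2
  simpa [dress] using this

/-- Continuous functions that agree at all but finitely many points are equal. -/
theorem eq_of_eventually_cofinite_eq {X : Type*} [TopologicalSpace X] [T2Space X] {f g : ℂ → X}
    (hf : Continuous f) (hg : Continuous g) (h : ∀ᶠ z in cofinite, f z = g z) : f = g := by
  have : {z | f z = g z} = univ := by
    have hd : Dense {z | f z = g z} := by
      have := (Set.Finite.countable h).dense_compl ℂ
      simpa [Set.compl_def] using this
    rw [← hd.closure_eq]
    exact (isClosed_eq hf hg).closure_eq.symm
  funext z
  exact this.symm.subset (mem_univ z)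

end Holomorphic

/-! ### Relations among simple elements and their converse -/

section Permutability

variable {n : ℕ}

/-- Differentiate `F F♯ = 1`. -/
theorem adj_deriv_mul_adj {F : ℂ → Mat n ℂ} {F' : Mat n ℂ} {a : ℂ} (hF : HasMDerivAt ℂ F F' a)
    (ho : ∀ᶠ z in 𝓝 a, F z * adj (F z) = 1) : adj (F' * adj (F a)) = -(F' * adj (F a)) := by
  have h1 := hF.mul hF.adj
  have h2 : HasMDerivAt ℂ (fun z => F z * adj (F z)) 0 a :=
    (HasMDerivAt.const (1 : Mat n ℂ)).congr_of_eventuallyEq ho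
  have h3 := h1.unique h2
  rw [adj_mul, adj_adj]
  exact eq_neg_of_add_eq_zero_right h3

/-- If `Q` is linked to the rank one isotropic idempotent `P` by an orthogonal holomorphic map `F`,
then `g_P F g_Q⁻¹` extends holomorphically to the poles. -/
theorem Link.exists_extension {U : Set ℂ} (hU : IsOpen U) {a b : ℂ} (ha : a ∈ U) (hb : b ∈ U)
    {F : ℂ → Mat n ℂ} (hF : HoloOn F U) (ho : ∀ z ∈ U, F z * adj (F z) = 1)
    {P Q : Mat n ℂ} (hP : IsoIdem P) (hr : RankOne P) (h : Link P Q (F a) (F b)) :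
    ∃ W, HoloOn W U ∧ ∀ z, z ≠ a → z ≠ b →
      W z = dress (b - a) (z - a)⁻¹ (z - b)⁻¹ P (adj P) *
        (F z * dress (b - a) (z - a)⁻¹ (z - b)⁻¹ (adj Q) Q) := by
  obtain ⟨Fa, hFa⟩ := hF.hasMDerivAt hU ha
  obtain ⟨Fb, hFb⟩ := hF.hasMDerivAt hU hb
  have ka := adj_deriv_mul_adj hFa (eventually_of_mem (hU.mem_nhds ha) ho)
  have kb := adj_deriv_mul_adj hFb (eventually_of_mem (hU.mem_nhds hb) ho)
  have oa := mul_eq_one_comm.mp (ho a ha)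
  have ob := mul_eq_one_comm.mp (ho b hb)
  have e1 : adj P * F a * adj Q = adj P * F a := by
    have := congrArg adj h.le_im
    simpa only [adj_mul, adj_adj, mul_assoc] using this
  have e2 : adj P * F b * adj Q = F b * adj Q := by
    have := congrArg adj h.le_ke
    simpa only [adj_mul, adj_adj, mul_assoc] using this
  -- This form of `Q` puts `F(a)⁻¹` next to the derivative `Fa`, so that the skew matrix `Fa F(a)⁻¹`
  -- appears between `P♯` and `P`. The identity `e4` does the same at `b`.
  have e3 : Q = adj (F a) * P * (F a * Q) := by
    rw [mul_assoc, ← mul_assoc P, h.im_le, ← mul_assoc, oa, one_mul]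
  have e4 : adj Q = adj (F b) * adj P * (F b * adj Q) := by
    rw [mul_assoc, ← mul_assoc (adj P), e2, ← mul_assoc, ob, one_mul]
  obtain ⟨W, hW, hW'⟩ := HoloOn.exists_dress_extension hU ha hb hF hFa hFb (P := P) (P' := adj P)
    (Q := Q) (Q' := adj Q) (D := 0) (D' := 0)
    (by rw [add_zero, sub_mul, one_mul, ← mul_assoc, h.im_le, sub_self])
    (by rw [sub_zero, mul_sub, mul_sub, mul_one, ← mul_assoc, e1, sub_self])
    (by rw [add_zero, ← h.im_le, mul_assoc P, ← mul_assoc, hP.zero_mul', zero_mul])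
    (by
      rw [e3]
      calc adj P * Fa * (adj (F a) * P * (F a * Q))
          = (adj P * (Fa * adj (F a)) * P) * (F a * Q) := by simp only [mul_assoc]
        _ = 0 := by rw [hr.adj_mul_mul_self ka, zero_mul])
    (by rw [add_zero, sub_mul, one_mul, ← mul_assoc, e2, sub_self])
    (by rw [sub_zero, mul_sub, mul_sub, mul_one, ← mul_assoc, h.ke_le, sub_self])
    (by rw [add_zero, ← e2, mul_assoc (adj P), ← mul_assoc, hP.mul_zero', zero_mul])
    (by
      rw [e4]
      calc P * Fb * (adj (F b) * adj P * (F b * adj Q))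
          = (P * (Fb * adj (F b)) * adj P) * (F b * adj Q) := by simp only [mul_assoc]
        _ = 0 := by rw [hr.mul_mul_adj kb, zero_mul])
  refine ⟨W, hW, fun z hza hzb => ?_⟩
  rw [hW' z hza hzb, smul_zero, smul_zero, sub_zero, add_zero]

theorem HoloOn.glue {U V : Set ℂ} (hU : IsOpen U) (hV : IsOpen V) (hUV : ∀ z, z ∈ U ∨ z ∈ V)
    {f g : ℂ → Mat n ℂ} (hf : HoloOn f U) (hg : HoloOn g V) (h : ∀ z ∈ U, z ∈ V → f z = g z) :
    ∃ e, HoloOn e univ ∧ (∀ z ∈ U, e z = f z) ∧ ∀ z ∈ V, e z = g z := by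
  classical
  have h1 : ∀ z ∈ U, (if z ∈ U then f z else g z) = f z := fun z hz => if_pos hz
  have h2 : ∀ z ∈ V, (if z ∈ U then f z else g z) = g z := fun z hz => by
    by_cases hzU : z ∈ U
    · rw [if_pos hzU, h z hzU hz]
    · rw [if_neg hzU]
  refine ⟨fun z => if z ∈ U then f z else g z, fun i j z _ => ?_, h1, h2⟩
  apply DifferentiableAt.differentiableWithinAt
  rcases hUV z with hz | hz
  · exact ((hf i j).differentiableAt (hU.mem_nhds hz)).congr_of_eventuallyEq
      (eventually_of_mem (hU.mem_nhds hz) fun w hw => congrFun (congrFun (h1 w hw) i) j)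
  · exact ((hg i j).differentiableAt (hV.mem_nhds hz)).congr_of_eventuallyEq
      (eventually_of_mem (hV.mem_nhds hz) fun w hw => congrFun (congrFun (h2 w hw) i) j)

/-- The complement of two points. -/
def compl₂ (a b : ℂ) : Set ℂ := {a}ᶜ ∩ {b}ᶜ

theorem mem_compl₂ {a b z : ℂ} : z ∈ compl₂ a b ↔ z ≠ a ∧ z ≠ b := Iff.rfl

theorem isOpen_compl₂ (a b : ℂ) : IsOpen (compl₂ a b) :=
  isOpen_compl_singleton.inter isOpen_compl_singleton

theorem holoOn_dress (d a b : ℂ) (P P' : Mat n ℂ) :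
    HoloOn (fun z => dress d (z - a)⁻¹ (z - b)⁻¹ P P') (compl₂ a b) := by
  have h : ∀ c : ℂ, compl₂ a b ⊆ {c}ᶜ →
      DifferentiableOn ℂ (fun z => d * (z - c)⁻¹) (compl₂ a b) := fun c hc =>
    (differentiableOn_const d).fun_mul
      ((differentiableOn_id.sub_const c).inv fun z hz => sub_ne_zero.mpr (hc hz))
  exact ((HoloOn.const 1).add (HoloOn.smul (h b inter_subset_right) (HoloOn.const P))).sub
    (HoloOn.smul (h a inter_subset_left) (HoloOn.const P'))

theorem holoOn_simpleElt (a b : ℝ) (A : Mat n ℝ) :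
    HoloOn (fun z : ℂ => simpleElt a b A z) (compl₂ a b) :=
  (holoOn_dress _ _ _ _ _).congr fun z _ => simpleElt_cx a b A z

theorem tendsto_simpleElt (a b : ℝ) (A : Mat n ℝ) :
    Tendsto (fun z : ℂ => simpleElt a b A z) (Bornology.cobounded ℂ) (𝓝 1) := by
  simp only [simpleElt_cx]
  exact tendsto_dress_cobounded _ _ _ _ _

theorem continuous_adj {K : Type*} [CommRing K] [TopologicalSpace K] [IsTopologicalRing K] :
    Continuous (adj : Mat n K → Mat n K) := by
  unfold adj
  fun_prop

theorem adj_simpleElt (a b : ℝ) (A : Mat n ℝ) (z : ℂ) :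
    adj (simpleElt a b A z) =
      dress ((b : ℂ) - a) (z - a)⁻¹ (z - b)⁻¹ (adj (cx A)) (cx A) := by
  rw [simpleElt_cx, adj_dress, adj_adj]

theorem IsoIdem.cx {A : Mat n ℝ} (h : IsoIdem A) : IsoIdem (BnFlow.cx A) :=
  h.mapMatrix Complex.ofRealHom

theorem RankOne.cx {A : Mat n ℝ} (h : RankOne A) : RankOne (BnFlow.cx A) :=
  h.mapMatrix Complex.ofRealHom

theorem simpleElt_mul_adj_cx {a b : ℝ} {A : Mat n ℝ} (hA : IsoIdem A) {z : ℂ}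
    (h : z ∈ compl₂ a b) : simpleElt a b A z * adj (simpleElt a b A z) = 1 :=
  simpleElt_mul_adj hA h.1 h.2

theorem ofReal_mem_compl₂ {a b x : ℝ} (ha : x ≠ a) (hb : x ≠ b) : (x : ℂ) ∈ compl₂ a b :=
  ⟨Complex.ofReal_injective.ne ha, Complex.ofReal_injective.ne hb⟩

/-- The quotient `e = g_{τ₁} g_{P₂} g_{P₁}⁻¹ g_{τ₂}⁻¹` is entire. At `a₁`, `c₁` the first link makes
`W₁ = g_{τ₁} g_{P₂} g_{P₁}⁻¹` regular; at `a₂`, `c₂` the second does so for `W₂ = g_{τ₂} g_{P₁}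
g_{P₂}⁻¹`, whose inverse is the rest of `e`. Its limit at infinity is `1`. -/
theorem gRelation_of_link {a₁ c₁ a₂ c₂ : ℝ} (h12 : a₁ ≠ a₂) (h13 : a₁ ≠ c₂) (h14 : c₁ ≠ a₂)
    (h15 : c₁ ≠ c₂) {P₁ P₂ τ₁ τ₂ : Mat n ℝ}
    (i₁ : IsoIdem P₁) (i₂ : IsoIdem P₂) (j₁ : IsoIdem τ₁) (j₂ : IsoIdem τ₂)
    (r₁ : RankOne τ₁) (r₂ : RankOne τ₂)
    (l₁ : Link τ₁ P₁ (simpleElt a₂ c₂ P₂ a₁) (simpleElt a₂ c₂ P₂ c₁))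
    (l₂ : Link τ₂ P₂ (simpleElt a₁ c₁ P₁ a₂) (simpleElt a₁ c₁ P₁ c₂)) :
    GRelation a₁ c₁ a₂ c₂ P₁ P₂ τ₁ τ₂ := by
  have l₁' := l₁.mapMatrix Complex.ofRealHom
  have l₂' := l₂.mapMatrix Complex.ofRealHom
  simp only [← cx_eq, simpleElt_real] at l₁' l₂'
  obtain ⟨W₁, hW₁, e₁⟩ := Link.exists_extension (isOpen_compl₂ a₂ c₂) (ofReal_mem_compl₂ h12 h13)
    (ofReal_mem_compl₂ h14 h15) (holoOn_simpleElt a₂ c₂ P₂)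
    (fun z hz => simpleElt_mul_adj_cx i₂ hz) j₁.cx r₁.cx l₁'
  obtain ⟨W₂, hW₂, e₂⟩ := Link.exists_extension (isOpen_compl₂ a₁ c₁)
    (ofReal_mem_compl₂ h12.symm h14.symm)
    (ofReal_mem_compl₂ h13.symm h15.symm) (holoOn_simpleElt a₁ c₁ P₁)
    (fun z hz => simpleElt_mul_adj_cx i₁ hz) j₂.cx r₂.cx l₂'
  simp only [← adj_simpleElt, ← simpleElt_cx] at e₁ e₂
  -- The two pairs of poles are disjoint, so the domains of `W₁ g_{τ₂}⁻¹` and `g_{τ₁} W₂⁻¹` cover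
  -- the plane.
  obtain ⟨e, he, he₁, -⟩ := HoloOn.glue (isOpen_compl₂ a₂ c₂) (isOpen_compl₂ a₁ c₁)
    (fun z => by
      by_contra hz
      rw [not_or, mem_compl₂, mem_compl₂, not_and_or, not_and_or, not_not, not_not, not_not,
        not_not] at hz
      rcases hz with ⟨rfl | rfl, h | h⟩
      · exact h12 (Complex.ofReal_injective h.symm)
      · exact h14 (Complex.ofReal_injective h.symm)
      · exact h13 (Complex.ofReal_injective h.symm)
      · exact h15 (Complex.ofReal_injective h.symm))
    (hW₁.mul (holoOn_simpleElt a₂ c₂ τ₂).adj) ((holoOn_simpleElt a₁ c₁ τ₁).mul hW₂.adj)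
    (fun z hz hz' => by
      rw [e₁ z hz'.1 hz'.2, e₂ z hz.1 hz.2]
      simp only [adj_mul, adj_adj, mul_assoc])
  have key : ∀ z, z ∈ compl₂ a₁ c₁ → z ∈ compl₂ a₂ c₂ → e z =
      simpleElt a₁ c₁ τ₁ z * (simpleElt a₂ c₂ P₂ z * adj (simpleElt a₁ c₁ P₁ z)) *
        adj (simpleElt a₂ c₂ τ₂ z) := fun z hz hz' => by
    rw [he₁ z hz', e₁ z hz.1 hz.2]
  have hlim : Tendsto e (Bornology.cobounded ℂ) (𝓝 1) := by
    have ta : ∀ (a b : ℝ) (A : Mat n ℝ), Tendsto (fun z : ℂ => adj (simpleElt a b A z))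
        (Bornology.cobounded ℂ) (𝓝 1) := fun a b A => by
      have := (continuous_adj.tendsto _).comp (tendsto_simpleElt a b A)
      rwa [adj_one] at this
    have := ((tendsto_simpleElt a₁ c₁ τ₁).mul ((tendsto_simpleElt a₂ c₂ P₂).mul (ta a₁ c₁ P₁))).mul
      (ta a₂ c₂ τ₂)
    simp only [mul_one] at this
    refine this.congr' ?_
    have ev := ((eventually_cofinite_ne (a₁ : ℂ)).and (eventually_cofinite_ne (c₁ : ℂ))).and
      ((eventually_cofinite_ne (a₂ : ℂ)).and (eventually_cofinite_ne (c₂ : ℂ)))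
    exact (ev.filter_mono (Bornology.le_cofinite ℂ)).mono fun z hz => (key z hz.1 hz.2).symm
  intro z ha₁ hc₁ ha₂ hc₂
  have h1 := eq_of_holo_of_tendsto he hlim z
  rw [key z ⟨ha₁, hc₁⟩ ⟨ha₂, hc₂⟩] at h1
  have o₁ := mul_eq_one_comm.mp (simpleElt_mul_adj_cx i₁ (⟨ha₁, hc₁⟩ : z ∈ compl₂ a₁ c₁))
  have o₂ := mul_eq_one_comm.mp (simpleElt_mul_adj_cx j₂ (⟨ha₂, hc₂⟩ : z ∈ compl₂ a₂ c₂))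
  have h2 := congrArg (fun X => X * simpleElt a₂ c₂ τ₂ z * simpleElt a₁ c₁ P₁ z) h1
  simp only [one_mul] at h2
  rw [← h2]
  calc _ = simpleElt a₁ c₁ τ₁ z * (simpleElt a₂ c₂ P₂ z * (adj (simpleElt a₁ c₁ P₁ z) *
        ((adj (simpleElt a₂ c₂ τ₂ z) * simpleElt a₂ c₂ τ₂ z) * simpleElt a₁ c₁ P₁ z))) := by
        simp only [mul_assoc]
    _ = _ := by rw [o₂, one_mul, o₁, mul_one]

theorem tendsto_sub_smul_dress {d a b : ℂ} (hab : a ≠ b) (P P' : Mat n ℂ) :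
    Tendsto (fun z : ℂ => (z - b) • dress d (z - a)⁻¹ (z - b)⁻¹ P P') (𝓝[≠] b) (𝓝 (d • P)) := by
  have h0 : Tendsto (fun z : ℂ => z - b) (𝓝[≠] b) (𝓝 0) := by
    have : Tendsto (fun z : ℂ => z - b) (𝓝 b) (𝓝 (b - b)) :=
      (continuous_id.sub continuous_const).tendsto b
    rw [sub_self] at this
    exact this.mono_left nhdsWithin_le_nhds
  have ha : Tendsto (fun z : ℂ => (z - a)⁻¹) (𝓝[≠] b) (𝓝 (b - a)⁻¹) :=
    (((continuous_id.sub continuous_const).tendsto b).inv₀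
      (sub_ne_zero.mpr hab.symm)).mono_left nhdsWithin_le_nhds
  have h1 := ((h0.smul_const (1 : Mat n ℂ)).add_const (d • P)).sub
    ((h0.mul (ha.const_mul d)).smul_const P')
  simp only [zero_smul, zero_add, zero_mul, sub_zero] at h1
  refine h1.congr' ?_
  filter_upwards [self_mem_nhdsWithin] with z hz
  have hz' : z - b ≠ 0 := sub_ne_zero.mpr hz
  rw [dress, smul_sub, smul_add, smul_smul, smul_smul, mul_left_comm (z - b) d (z - b)⁻¹,
    mul_inv_cancel₀ hz', mul_one, mul_left_comm (z - b) d]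

theorem tendsto_simpleElt_ofReal {a b : ℝ} (A : Mat n ℝ) {x : ℝ} (ha : x ≠ a) (hb : x ≠ b) :
    Tendsto (fun z : ℂ => simpleElt a b A z) (𝓝[≠] (x : ℂ)) (𝓝 (simpleElt a b A (x : ℂ))) :=
  (((holoOn_simpleElt a b A).continuousOn).continuousAt
    ((isOpen_compl₂ a b).mem_nhds (ofReal_mem_compl₂ ha hb))).mono_left nhdsWithin_le_nhds

/-- The residue at `c₁` of `g_{a₂,c₂,τ₂} g_{a₁,c₁,P₁} = g_{a₁,c₁,τ₁} g_{a₂,c₂,P₂}`. -/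
theorem GRelation.residue {a₁ c₁ a₂ c₂ : ℝ} (h11 : a₁ ≠ c₁) (h14 : c₁ ≠ a₂)
    (h15 : c₁ ≠ c₂) {P₁ P₂ τ₁ τ₂ : Mat n ℝ} (h : GRelation a₁ c₁ a₂ c₂ P₁ P₂ τ₁ τ₂) :
    simpleElt a₂ c₂ τ₂ c₁ * P₁ = τ₁ * simpleElt a₂ c₂ P₂ c₁ := by
  have hac : (a₁ : ℂ) ≠ c₁ := Complex.ofReal_injective.ne h11
  have t : ∀ A : Mat n ℝ, Tendsto (fun z : ℂ => (z - c₁) • simpleElt a₁ c₁ A z) (𝓝[≠] (c₁ : ℂ))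
      (𝓝 (((c₁ : ℂ) - a₁) • cx A)) := fun A => by
    simp only [simpleElt_cx]
    exact tendsto_sub_smul_dress hac _ _
  have h1 := (tendsto_simpleElt_ofReal τ₂ h14 h15).mul (t P₁)
  have h2 := (t τ₁).mul (tendsto_simpleElt_ofReal P₂ h14 h15)
  have h3 : (fun z : ℂ => simpleElt a₂ c₂ τ₂ z * (z - c₁) • simpleElt a₁ c₁ P₁ z)
      =ᶠ[𝓝[≠] (c₁ : ℂ)] fun z => (z - c₁) • simpleElt a₁ c₁ τ₁ z * simpleElt a₂ c₂ P₂ z := by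
    have n1 : ∀ᶠ z : ℂ in 𝓝[≠] (c₁ : ℂ), z ≠ a₁ :=
      (isOpen_ne.mem_nhds hac.symm : {z : ℂ | z ≠ a₁} ∈ 𝓝 (c₁ : ℂ)) |> fun h =>
        mem_nhdsWithin_of_mem_nhds h
    have n2 : ∀ᶠ z : ℂ in 𝓝[≠] (c₁ : ℂ), z ∈ compl₂ a₂ c₂ :=
      mem_nhdsWithin_of_mem_nhds ((isOpen_compl₂ _ _).mem_nhds (ofReal_mem_compl₂ h14 h15))
    filter_upwards [n1, n2, self_mem_nhdsWithin] with z z1 z2 z3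
    rw [mul_smul_comm, smul_mul_assoc, h z z1 z3 z2.1 z2.2]
  have h4 := tendsto_nhds_unique (h1.congr' h3) h2
  rw [mul_smul_comm, smul_mul_assoc] at h4
  have h5 := smul_right_injective _ (sub_ne_zero.mpr hac.symm) h4
  apply cx_injective
  rw [cx_mul, cx_mul, simpleElt_real, simpleElt_real]
  exact h5

/-- Exchanging the poles inverts the simple element; through `GRelation.swap`, residues at `c₁` then
also give those at `a₁`. -/
theorem simpleElt_swap (a c : ℝ) (A : Mat n ℝ) (z : ℂ) :
    simpleElt c a A z = adj (simpleElt a c A z) := by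
  rw [adj_simpleElt, simpleElt_cx]
  simp only [dress]
  match_scalars <;> ring

/-- The relation with the roles of `a₁` and `c₁` exchanged. -/
theorem GRelation.swap {a₁ c₁ a₂ c₂ : ℝ} {P₁ P₂ τ₁ τ₂ : Mat n ℝ} (i₁ : IsoIdem P₁)
    (j₁ : IsoIdem τ₁) (h : GRelation a₁ c₁ a₂ c₂ P₁ P₂ τ₁ τ₂) :
    GRelation c₁ a₁ a₂ c₂ P₁ τ₂ τ₁ P₂ := by
  intro z hc₁ ha₁ ha₂ hc₂
  have o₁ := simpleElt_mul_adj_cx i₁ (⟨ha₁, hc₁⟩ : z ∈ compl₂ a₁ c₁)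
  have o₂ := mul_eq_one_comm.mp (simpleElt_mul_adj_cx j₁ (⟨ha₁, hc₁⟩ : z ∈ compl₂ a₁ c₁))
  rw [simpleElt_swap a₁, simpleElt_swap a₁]
  have h2 := congrArg (fun X => adj (simpleElt a₁ c₁ τ₁ z) * X * adj (simpleElt a₁ c₁ P₁ z))
    (h z ha₁ hc₁ ha₂ hc₂)
  rw [← mul_assoc _ (simpleElt a₁ c₁ τ₁ z), o₂, one_mul] at h2
  rw [← h2, mul_assoc, mul_assoc, o₁, mul_one]

theorem simpleElt_mul_adj_real {a b x : ℝ} {A : Mat n ℝ} (hA : IsoIdem A) (ha : x ≠ a)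
    (hb : x ≠ b) : simpleElt a b A x * adj (simpleElt a b A x) = 1 :=
  simpleElt_mul_adj hA (by simpa using ha) (by simpa using hb)

/-- Let `A`, `C` be the values of `g_{P₂}` and `A'`, `C'` those of `g_{τ₂}` at `a₁`, `c₁`. The
residues say `τ₁ = A P₁ A'⁻¹` and `τ₁ = C' P₁ C⁻¹`: the first fixes the image `A Im P₁`, the second
the kernel `C Ker P₁`. -/
theorem GRelation.link {a₁ c₁ a₂ c₂ : ℝ} (h11 : a₁ ≠ c₁) (h12 : a₁ ≠ a₂) (h13 : a₁ ≠ c₂)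
    (h14 : c₁ ≠ a₂) (h15 : c₁ ≠ c₂) {P₁ P₂ τ₁ τ₂ : Mat n ℝ} (i₁ : IsoIdem P₁) (i₂ : IsoIdem P₂)
    (j₁ : IsoIdem τ₁) (j₂ : IsoIdem τ₂) (h : GRelation a₁ c₁ a₂ c₂ P₁ P₂ τ₁ τ₂) :
    Link P₁ τ₁ (adj (simpleElt a₂ c₂ P₂ a₁)) (adj (simpleElt a₂ c₂ P₂ c₁)) := by
  have e1 := h.residue h11 h14 h15
  have e2 := (h.swap i₁ j₁).residue h11.symm h12 h13
  have oa := simpleElt_mul_adj_real i₂ h12 h13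
  have oc := simpleElt_mul_adj_real i₂ h14 h15
  have pa := simpleElt_mul_adj_real j₂ h12 h13
  have pc := simpleElt_mul_adj_real j₂ h14 h15
  have oa' := mul_eq_one_comm.mp oa
  have oc' := mul_eq_one_comm.mp oc
  have pa' := mul_eq_one_comm.mp pa
  have pc' := mul_eq_one_comm.mp pc
  set A := simpleElt a₂ c₂ P₂ a₁
  set C := simpleElt a₂ c₂ P₂ c₁
  set A' := simpleElt a₂ c₂ τ₂ a₁
  set C' := simpleElt a₂ c₂ τ₂ c₁
  have t1 : τ₁ = A * P₁ * adj A' := by rw [e2, mul_assoc, pa, mul_one]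
  have t2 : τ₁ = C' * P₁ * adj C := by rw [e1, mul_assoc, oc, mul_one]
  refine ⟨j₁.idem, ?_, ?_, ?_, ?_⟩
  · rw [t1]
    calc P₁ * adj A * (A * P₁ * adj A') = P₁ * (adj A * A) * P₁ * adj A' := by
          simp only [mul_assoc]
      _ = adj A * A * P₁ * adj A' := by rw [oa', mul_one, one_mul, i₁.idem]
      _ = _ := by simp only [mul_assoc]
  · rw [adj_adj]
    rw [mul_assoc, e2, ← mul_assoc, j₁.idem]
  · have : adj C * τ₁ = adj C * (C' * P₁ * adj C) := by rw [← t2]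
    have h3 : P₁ * adj C = adj C' * τ₁ := by
      rw [t2, ← mul_assoc, ← mul_assoc, pc', one_mul]
    rw [h3, mul_assoc, j₁.idem]
  · rw [adj_adj]
    have : τ₁ * C = C' * P₁ := e1.symm
    rw [this, mul_assoc, i₁.idem]

theorem GRelation.symm {a₁ c₁ a₂ c₂ : ℝ} {P₁ P₂ τ₁ τ₂ : Mat n ℝ}
    (h : GRelation a₁ c₁ a₂ c₂ P₁ P₂ τ₁ τ₂) : GRelation a₂ c₂ a₁ c₁ P₂ P₁ τ₂ τ₁ :=
  fun z h1 h2 h3 h4 => (h z h3 h4 h1 h2).symm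

end Permutability

/-! ### Smooth matrix functions of `(x,t)` -/

section Smooth

variable {n : ℕ} {K : Type*} [NormedField K] [NormedAlgebra ℝ K] {U : Set (ℝ × ℝ)}
  {A B : ℝ × ℝ → Mat n K}

theorem SmoothOn.mono {V : Set (ℝ × ℝ)} (h : SmoothOn A U) (hV : V ⊆ U) : SmoothOn A V :=
  fun i j => (h i j).mono hV

theorem SmoothOn.congr (h : SmoothOn A U) (hB : ∀ p ∈ U, B p = A p) : SmoothOn B U :=
  fun i j => (h i j).congr fun p hp => by rw [hB p hp]

theorem SmoothOn.const (A : Mat n K) : SmoothOn (fun _ => A) U := fun _ _ => contDiffOn_const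

theorem SmoothOn.add (hA : SmoothOn A U) (hB : SmoothOn B U) :
    SmoothOn (fun p => A p + B p) U := fun i j => (hA i j).add (hB i j)

theorem SmoothOn.sub (hA : SmoothOn A U) (hB : SmoothOn B U) :
    SmoothOn (fun p => A p - B p) U := fun i j => (hA i j).sub (hB i j)

theorem SmoothOn.mul (hA : SmoothOn A U) (hB : SmoothOn B U) :
    SmoothOn (fun p => A p * B p) U := by
  intro i j
  have : ContDiffOn ℝ ∞ (fun p => ∑ k, A p i k * B p k j) U :=
    ContDiffOn.sum fun k _ => (hA i k).mul (hB k j)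
  simpa only [Matrix.mul_apply] using this

theorem SmoothOn.sum {ι : Type*} {s : Finset ι} {A : ι → ℝ × ℝ → Mat n K}
    (h : ∀ k ∈ s, SmoothOn (A k) U) : SmoothOn (fun p => ∑ k ∈ s, A k p) U := by
  intro i j
  simp only [Matrix.sum_apply]
  exact ContDiffOn.sum fun k hk => h k hk i j

theorem SmoothOn.smul {c : ℝ × ℝ → K} (hc : ContDiffOn ℝ ∞ c U) (hA : SmoothOn A U) :
    SmoothOn (fun p => c p • A p) U := fun i j => hc.mul (hA i j)

theorem SmoothOn.const_smul (c : K) (hA : SmoothOn A U) : SmoothOn (fun p => c • A p) U :=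
  SmoothOn.smul contDiffOn_const hA

theorem SmoothOn.adj (hA : SmoothOn A U) : SmoothOn (fun p => adj (A p)) U :=
  SmoothOn.mul (SmoothOn.mul (SmoothOn.const _) (A := fun _ => rho n K)
    (B := fun p => (A p).transpose) fun i j => hA j i) (SmoothOn.const _)

theorem SmoothOn.trace (hA : SmoothOn A U) : ContDiffOn ℝ ∞ (fun p => (A p).trace) U :=
  ContDiffOn.sum fun i _ => hA i i

theorem SmoothOn.continuousOn (hA : SmoothOn A U) : ContinuousOn A U :=
  continuousOn_pi.mpr fun i => continuousOn_pi.mpr fun j => (hA i j).continuousOn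

theorem SmoothOn.cx {A : ℝ × ℝ → Mat n ℝ} (hA : SmoothOn A U) : SmoothOn (fun p => cx (A p)) U :=
  fun i j => Complex.ofRealCLM.contDiff.comp_contDiffOn (hA i j)

theorem SmoothOn.re {A : ℝ × ℝ → Mat n ℂ} (hA : SmoothOn A U) :
    SmoothOn (fun p => (A p).map Complex.re) U :=
  fun i j => Complex.reCLM.contDiff.comp_contDiffOn (hA i j)

theorem SmoothOn.hasMDerivAt_x (hU : IsOpen U) (hA : SmoothOn A U) {p : ℝ × ℝ} (hp : p ∈ U) :
    HasMDerivAt ℝ (fun x => A (x, p.2)) (pdx A p) p.1 := by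
  intro i j
  have h1 : DifferentiableAt ℝ (fun p => A p i j) p :=
    ((hA i j).contDiffAt (hU.mem_nhds hp)).differentiableAt (by simp)
  have h2 : DifferentiableAt ℝ (fun x : ℝ => (x, p.2)) p.1 :=
    differentiableAt_id.prodMk (differentiableAt_const _)
  exact (DifferentiableAt.comp (g := fun p => A p i j) p.1 h1 h2).hasDerivAt

theorem SmoothOn.hasMDerivAt_t (hU : IsOpen U) (hA : SmoothOn A U) {p : ℝ × ℝ} (hp : p ∈ U) :
    HasMDerivAt ℝ (fun t => A (p.1, t)) (pdt A p) p.2 := by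
  intro i j
  have h1 : DifferentiableAt ℝ (fun p => A p i j) p :=
    ((hA i j).contDiffAt (hU.mem_nhds hp)).differentiableAt (by simp)
  have h2 : DifferentiableAt ℝ (fun t : ℝ => (p.1, t)) p.2 :=
    (differentiableAt_const _).prodMk differentiableAt_id
  exact (DifferentiableAt.comp (g := fun p => A p i j) p.2 h1 h2).hasDerivAt

theorem HasMDerivAt.pdx_eq {A' : Mat n K} {p : ℝ × ℝ}
    (h : HasMDerivAt ℝ (fun x => A (x, p.2)) A' p.1) : pdx A p = A' :=
  Matrix.ext fun i j => (h i j).deriv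

theorem HasMDerivAt.pdt_eq {A' : Mat n K} {p : ℝ × ℝ}
    (h : HasMDerivAt ℝ (fun t => A (p.1, t)) A' p.2) : pdt A p = A' :=
  Matrix.ext fun i j => (h i j).deriv

end Smooth

/-! ### Regularity of solutions of linear systems -/

section Bootstrap

variable {n : ℕ} {U : Set (ℝ × ℝ)}

theorem hasFDerivAt_of_partials {g g₁ g₂ : ℝ × ℝ → ℂ} (hU : IsOpen U)
    (h₁ : ∀ p ∈ U, HasDerivAt (fun x => g (x, p.2)) (g₁ p) p.1)
    (h₂ : ∀ p ∈ U, HasDerivAt (fun t => g (p.1, t)) (g₂ p) p.2)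
    (c₁ : ContinuousOn g₁ U) (c₂ : ContinuousOn g₂ U) {p : ℝ × ℝ} (hp : p ∈ U) :
    HasFDerivAt g ((ContinuousLinearMap.toSpanSingleton ℝ (g₁ p)).coprod
      (ContinuousLinearMap.toSpanSingleton ℝ (g₂ p))) p := by
  have cs : Continuous (fun c : ℂ => ContinuousLinearMap.toSpanSingleton ℝ c) :=
    (ContinuousLinearMap.toSpanSingletonCLE (𝕜 := ℝ) (E := ℂ)).continuous
  have := hasStrictFDerivAt_uncurry_coprod (𝕜 := ℝ) (u := p) (f := fun x t => g (x, t))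
    (f₁ := fun x t => ContinuousLinearMap.toSpanSingleton ℝ (g₁ (x, t)))
    (f₂ := fun x t => ContinuousLinearMap.toSpanSingleton ℝ (g₂ (x, t)))
    (eventually_of_mem (hU.mem_nhds hp) fun v hv => (h₁ v hv).hasFDerivAt)
    (eventually_of_mem (hU.mem_nhds hp) fun v hv => (h₂ v hv).hasFDerivAt)
    (cs.continuousAt.comp (c₁.continuousAt (hU.mem_nhds hp)))
    (cs.continuousAt.comp (c₂.continuousAt (hU.mem_nhds hp)))
  exact this.hasFDerivAt

theorem contDiffOn_succ_of_partials {g g₁ g₂ : ℝ × ℝ → ℂ} (hU : IsOpen U) {k : ℕ}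
    (h₁ : ∀ p ∈ U, HasDerivAt (fun x => g (x, p.2)) (g₁ p) p.1)
    (h₂ : ∀ p ∈ U, HasDerivAt (fun t => g (p.1, t)) (g₂ p) p.2)
    (c₁ : ContDiffOn ℝ k g₁ U) (c₂ : ContDiffOn ℝ k g₂ U) : ContDiffOn ℝ (k + 1 : ℕ) g U := by
  have hd := fun p hp => hasFDerivAt_of_partials hU h₁ h₂ c₁.continuousOn
    c₂.continuousOn (p := p) hp
  rw [Nat.cast_add, Nat.cast_one, contDiffOn_succ_iff_fderiv_of_isOpen hU]
  refine ⟨fun p hp => (hd p hp).differentiableAt.differentiableWithinAt,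
    fun h => absurd h (by simp), ?_⟩
  have e : ∀ p, (ContinuousLinearMap.toSpanSingleton ℝ (g₁ p)).coprod
      (ContinuousLinearMap.toSpanSingleton ℝ (g₂ p)) =
      (ContinuousLinearMap.fst ℝ ℝ ℝ).smulRight (g₁ p) +
        (ContinuousLinearMap.snd ℝ ℝ ℝ).smulRight (g₂ p) := fun p => by
    ext <;> simp
  refine ContDiffOn.congr (f := fun p => (ContinuousLinearMap.fst ℝ ℝ ℝ).smulRight (g₁ p) +
        (ContinuousLinearMap.snd ℝ ℝ ℝ).smulRight (g₂ p)) ?_ fun p hp => ?_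
  · exact (contDiffOn_const.smulRight c₁).add (contDiffOn_const.smulRight c₂)
  · rw [(hd p hp).fderiv, e]

/-- Continuous solutions of a linear system with smooth coefficients are smooth. -/
theorem smoothOn_of_linear_system (hU : IsOpen U) {G A B : ℝ × ℝ → Mat n ℂ}
    (hG : ContinuousOn G U) (hA : SmoothOn A U) (hB : SmoothOn B U)
    (hx : ∀ p ∈ U, HasMDerivAt ℝ (fun x => G (x, p.2)) (G p * A p) p.1)
    (ht : ∀ p ∈ U, HasMDerivAt ℝ (fun t => G (p.1, t)) (G p * B p) p.2) : SmoothOn G U := by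
  -- Bootstrap: if `G` is `C^k`, then so are its partial derivatives `G A` and `G B`, hence `G` is
  -- `C^{k+1}`.
  have key : ∀ k : ℕ, ∀ i j, ContDiffOn ℝ k (fun p => G p i j) U := by
    intro k
    induction k with
    | zero =>
      intro i j
      simpa using continuousOn_pi.mp (continuousOn_pi.mp hG i) j
    | succ k ih =>
      have hm : ∀ {C : ℝ × ℝ → Mat n ℂ}, SmoothOn C U → ∀ i j,
          ContDiffOn ℝ k (fun p => (G p * C p) i j) U := fun hC i j => by
        simp only [Matrix.mul_apply]
        exact ContDiffOn.sum fun l _ =>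
          (ih i l).mul ((hC l j).of_le (by exact_mod_cast le_top))
      exact fun i j => contDiffOn_succ_of_partials hU (fun p hp => hx p hp i j)
        (fun p hp => ht p hp i j) (hm hA i j) (hm hB i j)
  exact fun i j => contDiffOn_infty.mpr fun k => key k i j

end Bootstrap

/-! ### Passing to the exceptional values of `λ` -/

section JointContinuity

/-- A function that is jointly continuous away from finitely many values of the complex variable and
entire in that variable is jointly continuous. -/
theorem continuousOn_of_entire {X : Type*} [TopologicalSpace X] {O : Set X} {S : Set ℂ}
    (hS : S.Finite) {E : X → ℂ → ℂ} (hd : ∀ p ∈ O, Differentiable ℂ (E p))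
    (hc : ContinuousOn (Function.uncurry E) (O ×ˢ Sᶜ)) :
    ContinuousOn (Function.uncurry E) (O ×ˢ univ) := by
  rintro ⟨p₀, z₀⟩ ⟨hp₀, -⟩
  have hS' : (S \ {z₀})ᶜ ∈ 𝓝 z₀ := (hS.subset sdiff_subset).isClosed.isOpen_compl.mem_nhds (by simp)
  -- The circle of radius `r` about `z₀` avoids `S` even if `z₀ ∈ S`. On it `E p` is uniformly close
  -- to `E p₀`, and the maximum principle carries the bound into the disc.
  obtain ⟨r, hr, hrS⟩ := Metric.nhds_basis_closedBall.mem_iff.mp hS'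
  have hsph : Metric.sphere z₀ r ⊆ Sᶜ := fun z hz hzS =>
    hrS (Metric.sphere_subset_closedBall hz) ⟨hzS, fun h => by
      rw [mem_singleton_iff.mp h, Metric.mem_sphere, dist_self] at hz
      exact hr.ne hz⟩
  rw [ContinuousWithinAt, Metric.tendsto_nhds]
  intro ε hε
  obtain ⟨v, hv, hv'⟩ := (isCompact_sphere z₀ r).mem_uniformity_of_prod
    (hc.mono (prod_mono_right hsph)) hp₀ (Metric.dist_mem_uniformity (half_pos hε))
  have hz : ∀ᶠ z in 𝓝 z₀, z ∈ Metric.ball z₀ r ∧ dist (E p₀ z) (E p₀ z₀) < ε / 2 :=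
    (Metric.ball_mem_nhds z₀ hr |> fun h => Filter.Eventually.and h
      ((hd p₀ hp₀).continuous.continuousAt.eventually (Metric.ball_mem_nhds _ (half_pos hε))))
  rw [nhdsWithin_prod_eq, nhdsWithin_univ]
  have hv2 : ∀ᶠ p in 𝓝[O] p₀, p ∈ v ∧ p ∈ O := Filter.Eventually.and hv self_mem_nhdsWithin
  filter_upwards [hv2.prod_mk hz]
  rintro ⟨p, z⟩ ⟨⟨hpv, hpO⟩, hzr, hz2⟩
  have h1 : ‖E p z - E p₀ z‖ ≤ ε / 2 := by
    refine Complex.norm_le_of_forall_mem_frontier_norm_le (f := fun z => E p z - E p₀ z)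
      Metric.isBounded_ball (((hd p hpO).sub (hd p₀ hp₀)).diffContOnCl) (fun w hw => ?_)
      (subset_closure hzr)
    rw [frontier_ball z₀ hr.ne'] at hw
    have := hv' p hpv w hw
    rw [mem_ofPred_eq, dist_eq_norm] at this
    exact this.le
  calc dist (E p z) (E p₀ z₀) ≤ dist (E p z) (E p₀ z) + dist (E p₀ z) (E p₀ z₀) :=
        dist_triangle _ _ _
    _ < ε / 2 + ε / 2 := by
        rw [dist_eq_norm (E p z)]
        exact add_lt_add_of_le_of_lt h1 hz2
    _ = ε := add_halves ε

/-- A differential equation with a parameter extends to finitely many exceptional values of the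
parameter by continuity. -/
theorem hasDerivAt_of_finite_exception {I : Set ℝ} (hI : IsOpen I) {S : Set ℂ} (hS : S.Finite)
    {e m : ℝ → ℂ → ℂ} (he : ContinuousOn (Function.uncurry e) (I ×ˢ univ))
    (hm : ContinuousOn (Function.uncurry m) (I ×ˢ univ))
    (h : ∀ x ∈ I, ∀ z ∉ S, HasDerivAt (fun x => e x z) (m x z) x) {x₀ : ℝ} (hx₀ : x₀ ∈ I)
    (z₀ : ℂ) : HasDerivAt (fun x => e x z₀) (m x₀ z₀) x₀ := by
  obtain ⟨r, hr, hrI⟩ := Metric.nhds_basis_closedBall.mem_iff.mp (hI.mem_nhds hx₀)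
  have hne : (𝓝[Sᶜ] z₀).NeBot := by
    have := (hS.countable.dense_compl ℂ) z₀
    exact mem_closure_iff_nhdsWithin_neBot.mp this
  -- The derivatives converge uniformly near `x₀` as `z → z₀` outside `S`, so limit and derivative
  -- may be exchanged.
  have hu : TendstoUniformlyOn (fun z x => m x z) (fun x => m x z₀) (𝓝[Sᶜ] z₀)
      (Metric.ball x₀ r) := by
    rw [Metric.tendstoUniformlyOn_iff]
    intro ε hε
    have hm' : ContinuousOn (Function.uncurry fun z x => m x z)
        (univ ×ˢ Metric.closedBall x₀ r) :=
      hm.comp continuous_swap.continuousOn fun q hq => ⟨hrI hq.2, mem_univ _⟩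
    obtain ⟨v, hv, hv'⟩ := (isCompact_closedBall x₀ r).mem_uniformity_of_prod hm' (mem_univ z₀)
      (Metric.dist_mem_uniformity hε)
    rw [nhdsWithin_univ] at hv
    filter_upwards [mem_nhdsWithin_of_mem_nhds hv] with z hz x hx
    rw [dist_comm]
    exact hv' z hz x (Metric.ball_subset_closedBall hx)
  refine hasDerivAt_of_tendstoUniformlyOn Metric.isOpen_ball hu (f := fun z x => e x z)
    (g := fun x => e x z₀) ?_ (fun x hx => ?_) (Metric.mem_ball_self hr)
  · filter_upwards [self_mem_nhdsWithin] with z hz x hx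
    exact h x (hrI (Metric.ball_subset_closedBall hx)) z hz
  · have h1 : ContinuousAt (fun z => e x z) z₀ := by
      have := he (x, z₀) ⟨hrI (Metric.ball_subset_closedBall hx), mem_univ _⟩
      have h2 : ContinuousOn (fun z => e x z) univ :=
        he.comp (f := fun z : ℂ => (x, z)) (by fun_prop)
          fun z _ => ⟨hrI (Metric.ball_subset_closedBall hx), mem_univ _⟩
      exact h2.continuousAt univ_mem
    exact h1.mono_left nhdsWithin_le_nhds

end JointContinuity

/-! ### Expansions at infinity and the gauge action on the `T`-series -/

section Series

open PowerSeries

variable {n : ℕ}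

/-- Scalar power series as matrix power series. -/
def scalarSeries (n : ℕ) : PowerSeries ℝ →+* PowerSeries (Mat n ℝ) :=
  PowerSeries.map (algebraMap ℝ (Mat n ℝ))

theorem coeff_scalarSeries (c : PowerSeries ℝ) (k : ℕ) :
    coeff k (scalarSeries n c) = algebraMap ℝ (Mat n ℝ) (coeff k c) := by
  simp [scalarSeries]

theorem scalarSeries_comm (c : PowerSeries ℝ) (A : PowerSeries (Mat n ℝ)) :
    scalarSeries n c * A = A * scalarSeries n c := by
  ext1 k
  rw [coeff_mul, coeff_mul, ← Finset.Nat.sum_antidiagonal_swap]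
  refine Finset.sum_congr rfl fun i _ => ?_
  simp only [coeff_scalarSeries, Prod.fst_swap, Prod.snd_swap]
  exact Algebra.commutes _ _

/-- Makes scalar series in `λ⁻¹` admissible as `u`, `v` in `dress`, so that the identities for
simple factors hold verbatim at infinity. -/
instance seriesAlgebra : Algebra (PowerSeries ℝ) (PowerSeries (Mat n ℝ)) :=
  RingHom.toAlgebra' (scalarSeries n) scalarSeries_comm

theorem series_smul_def (c : PowerSeries ℝ) (A : PowerSeries (Mat n ℝ)) :
    c • A = scalarSeries n c * A := rfl

theorem X_smul (A : PowerSeries (Mat n ℝ)) : (X : PowerSeries ℝ) • A = X * A := by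
  rw [series_smul_def, scalarSeries, PowerSeries.map_X]

theorem C_smul (r : ℝ) (A : PowerSeries (Mat n ℝ)) (k : ℕ) :
    coeff k ((C r : PowerSeries ℝ) • A) = r • coeff k A := by
  rw [series_smul_def, scalarSeries, PowerSeries.map_C, coeff_C_mul, Algebra.smul_def]

/-- The expansion of `(λ - a)⁻¹` in powers of `λ⁻¹`. -/
def geomSeries (a : ℝ) : PowerSeries ℝ := X * (1 - C a * X)⁻¹

theorem geomSeries_rel (a : ℝ) : (1 - C a * X) * geomSeries a = X := by
  rw [geomSeries, mul_left_comm, PowerSeries.mul_inv_cancel _ (by simp), mul_one]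

theorem geomSeries_eq (a : ℝ) : geomSeries a = X + X * (C a * geomSeries a) := by
  linear_combination geomSeries_rel a

/-- The series form of `inv_sub_inv_relation`, checked after clearing the denominators `1 - a X` and
`1 - b X`. -/
theorem geomSeries_relation (a b : ℝ) :
    C (b - a) * geomSeries a * geomSeries b = geomSeries b - geomSeries a := by
  have hne : ∀ c : ℝ, (1 - C c * X : PowerSeries ℝ) ≠ 0 := fun c h => by
    have := congrArg constantCoeff h
    simp at this
  apply mul_left_cancel₀ (mul_ne_zero (hne a) (hne b))
  have ha := geomSeries_rel a
  have hb := geomSeries_rel b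
  rw [map_sub]
  linear_combination ((C b - C a) * geomSeries b * (1 - C b * X) + (1 - C b * X)) * ha +
    ((C b - C a) * X - (1 - C a * X)) * hb

/-- Coefficientwise adjoint. -/
def sadj (S : PowerSeries (Mat n ℝ)) : PowerSeries (Mat n ℝ) :=
  PowerSeries.mk fun k => adj (coeff k S)

theorem adj_sum {K : Type*} [CommRing K] {ι : Type*} (s : Finset ι) (f : ι → Mat n K) :
    adj (∑ i ∈ s, f i) = ∑ i ∈ s, adj (f i) := by
  classical
  induction s using Finset.induction_on with
  | empty => simp
  | insert i s hi ih => rw [Finset.sum_insert hi, Finset.sum_insert hi, adj_add, ih]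

theorem sadj_mul (S T : PowerSeries (Mat n ℝ)) : sadj (S * T) = sadj T * sadj S := by
  ext1 k
  rw [coeff_mul, sadj, coeff_mk, coeff_mul, adj_sum, ← Finset.Nat.sum_antidiagonal_swap]
  simp [sadj, adj_mul]

theorem sadj_add (S T : PowerSeries (Mat n ℝ)) : sadj (S + T) = sadj S + sadj T := by
  ext1 k; simp [sadj, adj_add]

theorem sadj_sub (S T : PowerSeries (Mat n ℝ)) : sadj (S - T) = sadj S - sadj T := by
  ext1 k; simp [sadj, adj_sub]

theorem sadj_C (A : Mat n ℝ) : sadj (C A) = C (adj A) := by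
  ext1 k
  rw [sadj, coeff_mk, coeff_C, coeff_C]
  split_ifs <;> simp

theorem sadj_smul (c : PowerSeries ℝ) (S : PowerSeries (Mat n ℝ)) : sadj (c • S) = c • sadj S := by
  have : sadj (scalarSeries n c) = scalarSeries n c := by
    ext1 k
    rw [sadj, coeff_mk, coeff_scalarSeries, Algebra.algebraMap_eq_smul_one, adj_smul, adj_one]
  rw [series_smul_def, series_smul_def, sadj_mul, this, scalarSeries_comm]

/-- The expansion of the simple element at infinity. -/
def simpleSeries (a b : ℝ) (P P' : Mat n ℝ) : PowerSeries (Mat n ℝ) :=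
  dress (C (b - a)) (geomSeries a) (geomSeries b) (C P) (C P')

theorem orthIdem_C {P P' : Mat n ℝ} (h : OrthIdem P P') :
    OrthIdem (C P : PowerSeries (Mat n ℝ)) (C P') := by
  constructor <;> rw [← map_mul]
  · rw [h.idem]
  · rw [h.idem']
  · rw [h.mul_zero', map_zero]
  · rw [h.zero_mul', map_zero]

theorem simpleSeries_mul_swap {a b : ℝ} {P P' : Mat n ℝ} (h : OrthIdem P P') :
    simpleSeries a b P P' * simpleSeries a b P' P = 1 :=
  dress_mul_dress_swap (geomSeries_relation a b) (orthIdem_C h)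

theorem sadj_simpleSeries (a b : ℝ) (P P' : Mat n ℝ) :
    sadj (simpleSeries a b P P') = simpleSeries a b (adj P) (adj P') := by
  have h1 : sadj (1 : PowerSeries (Mat n ℝ)) = 1 := by
    rw [← map_one (C : Mat n ℝ →+* PowerSeries (Mat n ℝ)), sadj_C, adj_one]
  simp only [simpleSeries, dress, sadj_add, sadj_sub, sadj_smul, sadj_C, h1]

theorem coeff_zero_geomSeries_smul (a : ℝ) (A : PowerSeries (Mat n ℝ)) :
    coeff 0 (geomSeries a • A) = 0 := by
  rw [geomSeries, mul_smul, X_smul, coeff_zero_X_mul]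

theorem coeff_succ_geomSeries_smul (a : ℝ) (A : PowerSeries (Mat n ℝ)) (k : ℕ) :
    coeff (k + 1) (geomSeries a • A) = coeff k A + a • coeff k (geomSeries a • A) := by
  conv_lhs => rw [geomSeries_eq]
  rw [add_smul, mul_smul, mul_smul, X_smul, X_smul, map_add, coeff_succ_X_mul, coeff_succ_X_mul,
    C_smul]

theorem coeff_zero_simpleSeries (a b : ℝ) (P P' : Mat n ℝ) :
    coeff 0 (simpleSeries a b P P') = 1 := by
  rw [simpleSeries, dress, mul_smul, mul_smul, map_sub (coeff 0), map_add (coeff 0), C_smul, C_smul,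
    coeff_zero_geomSeries_smul, coeff_zero_geomSeries_smul]
  simp

/-! ### Coefficientwise derivatives of series -/

section Derivative

/-- Coefficientwise derivative of a power series depending on a real variable. -/
def HasSDerivAt (S : ℝ → PowerSeries (Mat n ℝ)) (S' : PowerSeries (Mat n ℝ)) (x : ℝ) : Prop :=
  ∀ k, HasMDerivAt ℝ (fun y => coeff k (S y)) (coeff k S') x

variable {S T : ℝ → PowerSeries (Mat n ℝ)} {S' T' : PowerSeries (Mat n ℝ)} {x : ℝ}

theorem HasMDerivAt.sum {ι : Type*} {s : Finset ι} {f : ι → ℝ → Mat n ℝ} {f' : ι → Mat n ℝ}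
    (h : ∀ i ∈ s, HasMDerivAt ℝ (f i) (f' i) x) :
    HasMDerivAt ℝ (fun y => ∑ i ∈ s, f i y) (∑ i ∈ s, f' i) x := by
  intro i j
  simp only [Matrix.sum_apply]
  exact HasDerivAt.fun_sum fun k hk => h k hk i j

theorem HasSDerivAt.mul (hS : HasSDerivAt S S' x) (hT : HasSDerivAt T T' x) :
    HasSDerivAt (fun y => S y * T y) (S' * T x + S x * T') x := by
  intro k
  simp only [coeff_mul, map_add, ← Finset.sum_add_distrib]
  exact HasMDerivAt.sum fun i _ => (hS i.1).mul (hT i.2)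

theorem HasSDerivAt.const (A : PowerSeries (Mat n ℝ)) : HasSDerivAt (fun _ => A) 0 x := fun k => by
  rw [map_zero]
  exact HasMDerivAt.const _

theorem HasSDerivAt.add (hS : HasSDerivAt S S' x) (hT : HasSDerivAt T T' x) :
    HasSDerivAt (fun y => S y + T y) (S' + T') x := fun k => by
  simp only [map_add]
  exact (hS k).add (hT k)

theorem HasSDerivAt.sub (hS : HasSDerivAt S S' x) (hT : HasSDerivAt T T' x) :
    HasSDerivAt (fun y => S y - T y) (S' - T') x := fun k => by
  simp only [map_sub]
  exact (hS k).sub (hT k)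

theorem HasSDerivAt.smul (c : PowerSeries ℝ) (hS : HasSDerivAt S S' x) :
    HasSDerivAt (fun y => c • S y) (c • S') x := by
  simpa [series_smul_def] using (HasSDerivAt.const (scalarSeries n c)).mul hS

theorem HasMDerivAt.hasSDerivAt_C {P : ℝ → Mat n ℝ} {P' : Mat n ℝ} (h : HasMDerivAt ℝ P P' x) :
    HasSDerivAt (fun y => C (P y)) (C P') x := by
  intro k
  simp only [coeff_C]
  split_ifs
  · exact h
  · exact HasMDerivAt.const 0

theorem hasSDerivAt_simpleSeries (a b : ℝ) {P P' : ℝ → Mat n ℝ} {D D' : Mat n ℝ}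
    (h : HasMDerivAt ℝ P D x) (h' : HasMDerivAt ℝ P' D' x) :
    HasSDerivAt (fun y => simpleSeries a b (P y) (P' y))
      ((C (b - a) * geomSeries b) • C D - (C (b - a) * geomSeries a) • C D') x := by
  have := ((HasSDerivAt.const 1).add (h.hasSDerivAt_C.smul (C (b - a) * geomSeries b))).sub
    (h'.hasSDerivAt_C.smul (C (b - a) * geomSeries a))
  rwa [zero_add] at this

end Derivative

section Smooth

variable {U : Set (ℝ × ℝ)}

/-- Coefficientwise smoothness. -/
def SmoothSeriesOn (S : ℝ × ℝ → PowerSeries (Mat n ℝ)) (U : Set (ℝ × ℝ)) : Prop :=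
  ∀ k, SmoothOn (fun p => coeff k (S p)) U

theorem SmoothSeriesOn.mul {S T : ℝ × ℝ → PowerSeries (Mat n ℝ)} (hS : SmoothSeriesOn S U)
    (hT : SmoothSeriesOn T U) : SmoothSeriesOn (fun p => S p * T p) U := by
  intro k
  simp only [coeff_mul]
  exact SmoothOn.sum fun i _ => (hS i.1).mul (hT i.2)

theorem SmoothSeriesOn.const (A : PowerSeries (Mat n ℝ)) : SmoothSeriesOn (fun _ => A) U :=
  fun _ => SmoothOn.const _

theorem SmoothSeriesOn.pow {S : ℝ × ℝ → PowerSeries (Mat n ℝ)} (hS : SmoothSeriesOn S U) (m : ℕ) :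
    SmoothSeriesOn (fun p => S p ^ m) U := by
  induction m with
  | zero => simpa using SmoothSeriesOn.const 1
  | succ m ih => simpa only [pow_succ] using ih.mul hS

theorem smoothSeriesOn_simpleSeries (a b : ℝ) {P P' : ℝ × ℝ → Mat n ℝ} (h : SmoothOn P U)
    (h' : SmoothOn P' U) : SmoothSeriesOn (fun p => simpleSeries a b (P p) (P' p)) U := by
  have hC : ∀ {P : ℝ × ℝ → Mat n ℝ}, SmoothOn P U → SmoothSeriesOn (fun p => C (P p)) U := by
    intro P h k
    simp only [coeff_C]
    split_ifs
    · exact h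
    · exact SmoothOn.const 0
  have hs : ∀ (c : PowerSeries ℝ) {S : ℝ × ℝ → PowerSeries (Mat n ℝ)}, SmoothSeriesOn S U →
      SmoothSeriesOn (fun p => c • S p) U := fun c S hS =>
    (SmoothSeriesOn.const (scalarSeries n c)).mul hS
  intro k
  simp only [simpleSeries, dress, map_add, map_sub]
  exact ((SmoothOn.const _).add (hs _ (hC h) k)).sub (hs _ (hC h') k)

end Smooth

/-! ### The commutation relation as an identity of power series -/

section Commute

variable {S D : PowerSeries (Mat n ℝ)} {A B : Mat n ℝ}

/-- With `T = λ S`, the relation `T_x + [β λ + b + q, T] = 0` multiplied by `λ⁻²` is an equation in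
`X = λ⁻¹`. Its constant term `[β, S₀] = 0` is not listed in `IsT.commute`; it follows from `S₀ = β`.
-/
theorem commute_iff (A B : Mat n ℝ) :
    X * D + ⁅C A + X * C B, S⁆ = 0 ↔ ⁅A, coeff 0 S⁆ = 0 ∧
      ∀ k, coeff k D + ⁅B, coeff k S⁆ + ⁅A, coeff (k + 1) S⁆ = 0 := by
  have e : X * D + ⁅C A + X * C B, S⁆ = X * (D + (C B * S - S * C B)) + (C A * S - S * C A) := by
    have : S * (X * C B) = X * (S * C B) := by
      rw [← mul_assoc, (commute_X S).eq, mul_assoc]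
    rw [Ring.lie_def, add_mul, mul_add S, this, mul_assoc X, mul_add X, mul_sub X]
    abel
  rw [e, PowerSeries.ext_iff]
  constructor
  · intro h
    refine ⟨?_, fun k => ?_⟩
    · have := h 0
      rwa [map_add, coeff_zero_X_mul, zero_add, map_sub, coeff_C_mul, coeff_mul_C, map_zero] at this
    · have := h (k + 1)
      rwa [map_add, coeff_succ_X_mul, map_add, map_sub, map_sub, coeff_C_mul, coeff_mul_C,
        coeff_C_mul, coeff_mul_C, map_zero] at this
  · rintro ⟨h0, h⟩ (_ | k)
    · rw [map_add, coeff_zero_X_mul, zero_add, map_sub, coeff_C_mul, coeff_mul_C, map_zero]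
      exact h0
    · rw [map_add, coeff_succ_X_mul, map_add, map_sub, map_sub, coeff_C_mul, coeff_mul_C,
        coeff_C_mul, coeff_mul_C, map_zero]
      exact h k

/-- Gauge transformations preserve the commutation relation. -/
theorem commute_gauge {R : Type*} [Ring R] {x S D E E₁ G G' H H' : R} (hx : ∀ A : R, x * A = A * x)
    (hG : G * G' = 1) (hG' : G' * G = 1) (h : x * D + ⁅E, S⁆ = 0)
    (hE : E₁ * G = G * E - x * H) (hH : H * G' + G * H' = 0) :
    x * (H * S * G' + G * D * G' + G * S * H') + ⁅E₁, G * S * G'⁆ = 0 := by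
  have e1 : x * H = G * E - E₁ * G := by rw [hE]; abel
  have e2 : x * D = S * E - E * S := by
    rw [Ring.lie_def] at h
    rw [eq_sub_iff_add_eq, ← sub_eq_zero, ← h]; abel
  have e3 : x * H' = G' * E₁ - E * G' := by
    have h3 : G * H' = -(H * G') := eq_neg_of_add_eq_zero_right hH
    calc x * H' = G' * G * (x * H') := by rw [hG', one_mul]
      _ = G' * (x * (G * H')) := by rw [hx, hx, mul_assoc, mul_assoc]
      _ = -(G' * (x * H) * G') := by rw [h3, mul_neg, mul_neg, ← mul_assoc x, ← mul_assoc G']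
      _ = -(G' * G * E * G' - G' * E₁ * (G * G')) := by
          rw [e1, mul_sub, sub_mul]; simp only [mul_assoc]
      _ = _ := by rw [hG, hG', one_mul, mul_one]; abel
  have e4 : x * (G * S * H') = G * S * (x * H') := by
    rw [← mul_assoc, hx, mul_assoc (G * S) x]
  have e5 : x * (G * D * G') = G * (x * D) * G' := by
    rw [← mul_assoc, ← mul_assoc, hx G, mul_assoc G]
  have e6 : x * (H * S * G') = (x * H) * S * G' := by simp only [mul_assoc]
  rw [mul_add, mul_add, e4, e5, e6, e1, e2, e3, Ring.lie_def]
  noncomm_ring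

end Commute

theorem isSkew_adj {A : Mat n ℝ} (h : IsSkew n A) : adj A = -A := isSkew_iff.mp h

theorem isSkew_beta : IsSkew n (beta n) := by
  rw [IsSkew]
  have h : rho n ℝ * beta n = -(rho n ℝ * beta n).transpose := by
    ext i j
    rw [Matrix.neg_apply, Matrix.transpose_apply, rho_apply_mul, rho_apply_mul]
    simp only [beta, Matrix.of_apply, Fin.val_rev]
    by_cases h : (i.val = 2 * n ∧ j.val + 1 = 2 * n) ∨ (i.val + 1 = 2 * n ∧ j.val = 2 * n)
    · rw [if_pos (by omega), if_pos (by omega)]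
      rcases h with ⟨h1, h2⟩ | ⟨h1, h2⟩
      · have : n + i.val = n + j.val + 1 := by omega
        rw [this, pow_succ]; ring
      · have : n + j.val = n + i.val + 1 := by omega
        rw [this, pow_succ]; ring
    · rw [if_neg (by omega), if_neg (by omega)]
      simp
  rw [Matrix.transpose_mul, rho_transpose] at h
  rw [h, add_neg_cancel]

theorem isSkew_bMat : IsSkew n (bMat n) := by
  rw [IsSkew]
  have h : rho n ℝ * bMat n = -(rho n ℝ * bMat n).transpose := by
    ext i j
    rw [Matrix.neg_apply, Matrix.transpose_apply, rho_apply_mul, rho_apply_mul]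
    simp only [bMat, Matrix.of_apply, Fin.val_rev]
    by_cases h : i.val + j.val + 1 = 2 * n
    · rw [if_pos (by omega), if_pos (by omega), mul_one, mul_one]
      have h2 : n + i.val + (n + j.val) + 1 = 2 * (2 * n) := by omega
      have h3 : ((-1 : ℝ) ^ (n + i.val)) * (-1) ^ (n + j.val) = -1 := by
        have : ((-1 : ℝ) ^ (n + i.val + (n + j.val) + 1)) = 1 := by rw [h2, pow_mul]; simp
        rw [pow_succ, pow_add] at this
        linarith
      have h4 : ((-1 : ℝ) ^ (n + j.val)) * (-1) ^ (n + j.val) = 1 := by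
        rw [← pow_add, ← two_mul, pow_mul]; simp
      calc (-1 : ℝ) ^ (n + i.val)
          = (-1) ^ (n + i.val) * ((-1) ^ (n + j.val) * (-1) ^ (n + j.val)) := by
            rw [h4, mul_one]
        _ = _ := by rw [← mul_assoc, h3, neg_one_mul]
    · rw [if_neg (by omega), if_neg (by omega)]
      simp
  rw [Matrix.transpose_mul, rho_transpose] at h
  rw [h, add_neg_cancel]

/-- The connection matrix `β z + b + q` at a real point. -/
def conn (n : ℕ) (q : Mat n ℝ) (z : ℝ) : Mat n ℝ := z • beta n + (bMat n + q)

theorem adj_conn {q : Mat n ℝ} (hq : IsSkew n q) (z : ℝ) : adj (conn n q z) = -conn n q z := by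
  rw [conn, adj_add, adj_add, adj_smul, isSkew_adj isSkew_beta, isSkew_adj isSkew_bMat,
    isSkew_adj hq]
  module

/-- The Riccati equation of a transported projection implies that of its adjoint. -/
theorem adj_riccati {A B D P : Mat n ℝ} (hA : adj A = -A) (hB : adj B = -B)
    (h : D = -(A * P) + P * B - P * (B - A) * P) :
    adj D = adj P * A - B * adj P + adj P * (B - A) * adj P := by
  rw [h]
  simp only [adj_add, adj_sub, adj_neg, adj_mul, hA, hB]
  noncomm_ring

/-- The sign convention that matches `q + [h_{-1}, β]` and `dress_gauge`. -/
theorem darboux_apply (a b : ℝ) (q P : ℝ × ℝ → Mat n ℝ) (p : ℝ × ℝ) :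
    darboux a b q P p = q p + (b - a) • ⁅P p - adj (P p), beta n⁆ := by
  rw [darboux, sharp_eq_adj, Ring.lie_def, Ring.lie_def]
  module

/-- The gauge transformation of the `T`-series by a simple element. -/
def gaugeSeries (a b : ℝ) (P : Mat n ℝ) (S : PowerSeries (Mat n ℝ)) : PowerSeries (Mat n ℝ) :=
  simpleSeries a b P (adj P) * S * simpleSeries a b (adj P) P

theorem gaugeSeries_pow {a b : ℝ} {P : Mat n ℝ} (hP : IsoIdem P) (S : PowerSeries (Mat n ℝ))
    (m : ℕ) : gaugeSeries a b P S ^ m = gaugeSeries a b P (S ^ m) := by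
  have h1 := simpleSeries_mul_swap (a := a) (b := b) hP
  have h2 := simpleSeries_mul_swap (a := a) (b := b) hP.symm
  induction m with
  | zero => simp [gaugeSeries, h1]
  | succ m ih =>
    rw [pow_succ, ih, gaugeSeries, gaugeSeries, gaugeSeries, pow_succ]
    calc _ = simpleSeries a b P (adj P) * S ^ m *
          (simpleSeries a b (adj P) P * simpleSeries a b P (adj P)) * S *
            simpleSeries a b (adj P) P := by simp only [mul_assoc]
      _ = _ := by rw [h2, mul_one]; simp only [mul_assoc]

/-- Conjugation by an orthogonal series with constant term `1` keeps skewness, the leading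
coefficient and the power relation. The Riccati equation makes this series a gauge transformation
from the connection of `q` to that of the Darboux transform, whence the commutation relation. -/
theorem IsT.gauge {U : Set (ℝ × ℝ)} (hU : IsOpen U) {q : ℝ × ℝ → Mat n ℝ}
    {S : ℝ × ℝ → PowerSeries (Mat n ℝ)} (hS : IsT n U q S) (hq : ∀ p ∈ U, IsSkew n (q p))
    {a b : ℝ} {P : ℝ × ℝ → Mat n ℝ} (hP : SmoothOn P U) (hi : ∀ p ∈ U, IsoIdem (P p))
    (hr : ∀ p ∈ U, RankOne (P p))
    (hd : ∀ p ∈ U, pdx P p = -(conn n (q p) a * P p) + P p * conn n (q p) b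
      - P p * (conn n (q p) b - conn n (q p) a) * P p) :
    IsT n U (darboux a b q P) (fun p => gaugeSeries a b (P p) (S p)) := by
  have hP' := hP.adj
  have hsm : SmoothSeriesOn (fun p => gaugeSeries a b (P p) (S p)) U :=
    ((smoothSeriesOn_simpleSeries a b hP hP').mul hS.smooth).mul
      (smoothSeriesOn_simpleSeries a b hP' hP)
  refine ⟨hsm, fun p hp k => ?_, fun p hp => ?_, fun p hp => ?_, fun p hp => ?_⟩
  · have h1 : sadj (S p) = -S p := by
      ext1 k
      rw [sadj, coeff_mk, map_neg, isSkew_adj (hS.skew p hp k)]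
    have h2 : sadj (gaugeSeries a b (P p) (S p)) = -gaugeSeries a b (P p) (S p) := by
      rw [gaugeSeries, sadj_mul, sadj_mul, h1, sadj_simpleSeries, sadj_simpleSeries, adj_adj]
      simp only [mul_neg, neg_mul, mul_assoc]
    have h3 := congrArg (coeff k) h2
    rw [sadj, coeff_mk, map_neg] at h3
    exact isSkew_iff.mpr h3
  · have h0 : ∀ A B : PowerSeries (Mat n ℝ), coeff 0 (A * B) = coeff 0 A * coeff 0 B :=
      fun A B => by simp
    rw [gaugeSeries, h0, h0, coeff_zero_simpleSeries,
      coeff_zero_simpleSeries, one_mul, mul_one, hS.leading p hp]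
  · have hDP := hP.hasMDerivAt_x hU hp
    have hDP' := hDP.adj
    have hD' := adj_riccati (adj_conn (hq p hp) a) (adj_conn (hq p hp) b) (hd p hp)
    have hd' := hd p hp
    set D := pdx P p
    have hDS : HasSDerivAt (fun x => S (x, p.2))
        (PowerSeries.mk fun k => pdx (fun p' => coeff k (S p')) p) p.1 := fun k => by
      rw [coeff_mk]
      exact (hS.smooth k).hasMDerivAt_x hU hp
    set DS := PowerSeries.mk fun k => pdx (fun p' => coeff k (S p')) p
    have hG := hasSDerivAt_simpleSeries a b hDP hDP'
    have hG' := hasSDerivAt_simpleSeries a b hDP' hDP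
    have m1 := simpleSeries_mul_swap (a := a) (b := b) (hi p hp)
    have m2 := simpleSeries_mul_swap (a := a) (b := b) (hi p hp).symm
    set H := (C (b - a) * geomSeries b) • C D - (C (b - a) * geomSeries a) • C (adj D) with hH
    set H' := (C (b - a) * geomSeries b) • C (adj D) - (C (b - a) * geomSeries a) • C D
    -- The derivative of `G G⁻¹ = 1`.
    have hHH : H * simpleSeries a b (adj (P p)) (P p) +
        simpleSeries a b (P p) (adj (P p)) * H' = 0 := by
      have h1 := hG.mul hG'
      ext1 k
      rw [map_zero]
      refine (h1 k).unique
          ((HasMDerivAt.const (coeff k (1 : PowerSeries (Mat n ℝ)))).congr_of_eventuallyEq ?_)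
      have hnear : ∀ᶠ x in 𝓝 p.1, (x, p.2) ∈ U :=
        (show Continuous fun x : ℝ => (x, p.2) by fun_prop).continuousAt.eventually
          (hU.mem_nhds hp)
      filter_upwards [hnear] with x hx
      rw [simpleSeries_mul_swap (hi _ hx)]
    have hcomm : X * DS + ⁅C (beta n) + X * C (bMat n + q p), S p⁆ = 0 := by
      refine (commute_iff _ _).mpr ⟨?_, fun k => ?_⟩
      · rw [hS.leading p hp, Ring.lie_def, sub_self]
      · rw [coeff_mk]
        exact hS.commute p hp k
    have hE : (C (beta n) + X * C (bMat n + darboux a b q P p)) *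
        simpleSeries a b (P p) (adj (P p)) =
        simpleSeries a b (P p) (adj (P p)) * (C (beta n) + X * C (bMat n + q p)) - X * H := by
      -- This is `(λ - c)⁻¹ (β λ + b + q) = β + (λ - c)⁻¹ (β c + b + q)`, multiplied by `λ⁻¹`; hence
      -- `x = X` in `dress_gauge`.
      have hu : ∀ c : ℝ, geomSeries c • (C (beta n) + X * C (bMat n + q p)) =
          (X : PowerSeries ℝ) • C (beta n) +
            (X * geomSeries c) • (C (conn n (q p) c) : PowerSeries (Mat n ℝ)) := by
        intro c
        have hc : (C (c • beta n) : PowerSeries (Mat n ℝ)) =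
            (C c : PowerSeries ℝ) • C (beta n) := by
          ext1 k
          rw [C_smul, coeff_C, coeff_C]
          split_ifs <;> simp
        rw [conn, map_add C (c • beta n), hc, ← X_smul]
        have h1 : geomSeries c • (C (beta n) : PowerSeries (Mat n ℝ)) =
            (X : PowerSeries ℝ) • C (beta n) +
            (X * geomSeries c) • ((C c : PowerSeries ℝ) • C (beta n)) := by
          conv_lhs => rw [geomSeries_eq, add_smul]
          rw [smul_smul, mul_assoc, mul_comm (geomSeries c)]
        rw [smul_add, h1, smul_smul (geomSeries c) X, mul_comm (geomSeries c), smul_add, add_assoc]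
      have hdd : (C (b - a) : PowerSeries ℝ) • (C (beta n) : PowerSeries (Mat n ℝ)) =
          C (conn n (q p) b) - C (conn n (q p) a) := by
        rw [← map_sub, conn, conn, add_sub_add_right_eq_sub, ← sub_smul]
        ext1 k
        rw [C_smul, coeff_C, coeff_C]
        split_ifs <;> simp
      have hb := isSkew_adj (isSkew_beta (n := n))
      have key := dress_gauge (orthIdem_C (hi p hp)) (hu a) (hu b) hdd
        (D := C D) (D' := C (adj D))
        (by rw [← map_mul, ← map_neg, ← map_mul, ← map_add, ← map_sub C (conn n (q p) b), ← map_mul,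
          ← map_mul, ← map_sub]; rw [← hd'])
        (by rw [← map_mul, ← map_mul, ← map_sub, ← map_sub, ← map_mul, ← map_mul, ← map_add,
          ← hD'])
        (by rw [← map_mul, ← map_mul, (hr p hp).mul_mul_adj hb, map_zero])
        (by rw [← map_mul, ← map_mul, (hr p hp).adj_mul_mul_self hb, map_zero])
      rw [← hH, X_smul] at key
      rw [simpleSeries, ← key]
      congr 1
      rw [darboux_apply, ← add_assoc (bMat n), map_add C (bMat n + q p), mul_add X, ← add_assoc,
        mul_smul, X_smul]
      congr 2
      ext1 k
      rw [C_smul, Ring.lie_def, Ring.lie_def, ← map_sub C, ← map_mul, ← map_mul, ← map_sub, coeff_C,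
        coeff_C]
      split_ifs <;> simp
    have h1 := commute_gauge (fun A => (commute_X A).symm.eq) m1 m2 hcomm hE hHH
    have h2 := ((commute_iff _ _).mp h1).2
    intro k
    have h3 := ((hG.mul hDS).mul hG') k
    rw [← add_mul] at h1
    have h4 : pdx (fun p' => coeff k (gaugeSeries a b (P p') (S p'))) p = _ := h3.pdx_eq
    rw [h4, add_mul]
    exact h2 k
  · rw [gaugeSeries_pow (hi p hp), gaugeSeries, gaugeSeries]
    set G := simpleSeries a b (P p) (adj (P p))
    set G' := simpleSeries a b (adj (P p)) (P p)
    have hX : ∀ A : PowerSeries (Mat n ℝ), X * (G * A * G') = G * (X * A) * G' := fun A => by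
      rw [← mul_assoc, ← mul_assoc, (commute_X G).symm.eq, mul_assoc G]
    have hXX : ∀ (m : ℕ) (A : PowerSeries (Mat n ℝ)),
        X ^ m * (G * A * G') = G * (X ^ m * A) * G' := by
      intro m A
      have := ((commute_X G).symm.pow_left m).eq
      rw [← mul_assoc, ← mul_assoc, this, mul_assoc G]
    rw [hX, hXX, hS.power p hp]

end Series

/-! ### Nonnegative parts and their behaviour at infinity -/

section Asymptotics

open PowerSeries

variable {n : ℕ}

/-- The part with nonnegative exponents of `λ ^ m A(λ⁻¹)`. -/
def plusPart (m : ℕ) (A : PowerSeries (Mat n ℝ)) (z : ℂ) : Mat n ℂ :=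
  ∑ k ∈ Finset.range (m + 1), z ^ (m - k) • cx (coeff k A)

theorem TPlus_eq (m : ℕ) (S : PowerSeries (Mat n ℝ)) (z : ℂ) :
    TPlus m S z = plusPart m (S ^ m) z := rfl

theorem plusPart_zero (A : PowerSeries (Mat n ℝ)) (z : ℂ) : plusPart 0 A z = cx (coeff 0 A) := by
  simp [plusPart]

theorem plusPart_succ (m : ℕ) (A : PowerSeries (Mat n ℝ)) (z : ℂ) :
    plusPart (m + 1) A z = z • plusPart m A z + cx (coeff (m + 1) A) := by
  rw [plusPart, Finset.sum_range_succ, plusPart, Finset.smul_sum, Nat.sub_self, pow_zero, one_smul]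
  congr 1
  refine Finset.sum_congr rfl fun k hk => ?_
  rw [smul_smul, ← pow_succ', Nat.succ_sub (Nat.lt_succ_iff.mp (Finset.mem_range.mp hk))]

theorem plusPart_at_zero (m : ℕ) (A : PowerSeries (Mat n ℝ)) :
    plusPart m A 0 = cx (coeff m A) := by
  cases m with
  | zero => rw [plusPart_zero]
  | succ m => rw [plusPart_succ, zero_smul, zero_add]

theorem plusPart_add (m : ℕ) (A B : PowerSeries (Mat n ℝ)) (z : ℂ) :
    plusPart m (A + B) z = plusPart m A z + plusPart m B z := by
  simp only [plusPart, map_add, cx_add, smul_add, Finset.sum_add_distrib]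

theorem plusPart_sub (m : ℕ) (A B : PowerSeries (Mat n ℝ)) (z : ℂ) :
    plusPart m (A - B) z = plusPart m A z - plusPart m B z := by
  simp only [plusPart, map_sub, cx_sub, smul_sub, Finset.sum_sub_distrib]

theorem plusPart_C_mul (m : ℕ) (P : Mat n ℝ) (A : PowerSeries (Mat n ℝ)) (z : ℂ) :
    plusPart m (C P * A) z = cx P * plusPart m A z := by
  simp only [plusPart, coeff_C_mul, cx_mul, Finset.mul_sum, mul_smul_comm]

theorem plusPart_mul_C (m : ℕ) (P : Mat n ℝ) (A : PowerSeries (Mat n ℝ)) (z : ℂ) :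
    plusPart m (A * C P) z = plusPart m A z * cx P := by
  simp only [plusPart, coeff_mul_C, cx_mul, Finset.sum_mul, smul_mul_assoc]

theorem plusPart_C_smul (m : ℕ) (r : ℝ) (A : PowerSeries (Mat n ℝ)) (z : ℂ) :
    plusPart m ((C r : PowerSeries ℝ) • A) z = (r : ℂ) • plusPart m A z := by
  simp only [plusPart, C_smul, cx_smul, Finset.smul_sum]
  exact Finset.sum_congr rfl fun k _ => smul_comm _ _ _

/-- Division of a polynomial by `z - a`: multiplication by `(λ - a)⁻¹` commutes with taking the
nonnegative part up to a remainder constant in `z`. -/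
theorem plusPart_geomSeries_smul (m : ℕ) (a : ℝ) (A : PowerSeries (Mat n ℝ)) (z : ℂ) :
    (z - a) • plusPart m (geomSeries a • A) z =
      plusPart m A z - cx (coeff m A + a • coeff m (geomSeries a • A)) := by
  induction m with
  | zero =>
    rw [plusPart_zero, plusPart_zero, coeff_zero_geomSeries_smul, smul_zero, add_zero, sub_self,
      cx_zero, smul_zero]
  | succ m ih =>
    rw [plusPart_succ, plusPart_succ, smul_add, smul_comm, ih, cx_add, cx_add, cx_smul, cx_smul,
      coeff_succ_geomSeries_smul, cx_add, cx_smul]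
    module

/-- The nonnegative part of `λ ^ m A(λ⁻¹)` is asymptotic to `f` at infinity. -/
def IsPlusAsymptotic (m : ℕ) (A : PowerSeries (Mat n ℝ)) (f : ℂ → Mat n ℂ) : Prop :=
  Tendsto (fun z => plusPart m A z - f z) (Bornology.cobounded ℂ) (𝓝 0)

variable {m : ℕ} {A B : PowerSeries (Mat n ℝ)} {f g : ℂ → Mat n ℂ}

theorem IsPlusAsymptotic.add (hA : IsPlusAsymptotic m A f) (hB : IsPlusAsymptotic m B g) :
    IsPlusAsymptotic m (A + B) (fun z => f z + g z) := by
  have := Tendsto.add hA hB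
  rw [add_zero] at this
  refine this.congr fun z => ?_
  simp only [plusPart_add]; abel

theorem IsPlusAsymptotic.sub (hA : IsPlusAsymptotic m A f) (hB : IsPlusAsymptotic m B g) :
    IsPlusAsymptotic m (A - B) (fun z => f z - g z) := by
  have := Tendsto.sub hA hB
  rw [sub_zero] at this
  refine this.congr fun z => ?_
  simp only [plusPart_sub]; abel

theorem IsPlusAsymptotic.C_mul (P : Mat n ℝ) (hA : IsPlusAsymptotic m A f) :
    IsPlusAsymptotic m (C P * A) (fun z => cx P * f z) := by
  have := Tendsto.const_mul (cx P) hA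
  rw [mul_zero] at this
  refine this.congr fun z => ?_
  rw [plusPart_C_mul, mul_sub]

theorem IsPlusAsymptotic.mul_C (P : Mat n ℝ) (hA : IsPlusAsymptotic m A f) :
    IsPlusAsymptotic m (A * C P) (fun z => f z * cx P) := by
  have := Tendsto.mul_const (cx P) hA
  rw [zero_mul] at this
  refine this.congr fun z => ?_
  rw [plusPart_mul_C, sub_mul]

theorem IsPlusAsymptotic.C_smul (r : ℝ) (hA : IsPlusAsymptotic m A f) :
    IsPlusAsymptotic m ((C r : PowerSeries ℝ) • A) (fun z => (r : ℂ) • f z) := by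
  have := Tendsto.const_smul hA (r : ℂ)
  rw [smul_zero] at this
  refine this.congr fun z => ?_
  rw [plusPart_C_smul, smul_sub]

/-- The constant remainder of the division is multiplied by `(z - a)⁻¹` and so disappears at
infinity. -/
theorem IsPlusAsymptotic.geomSeries_smul (a : ℝ) (hA : IsPlusAsymptotic m A f) :
    IsPlusAsymptotic m (geomSeries a • A) (fun z => (z - a)⁻¹ • f z) := by
  have h1 := (tendsto_inv_sub_cobounded (a : ℂ)).smul hA
  have h2 := (tendsto_inv_sub_cobounded (a : ℂ)).smul_const
    (cx (coeff m A + a • coeff m (geomSeries a • A)))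
  have h3 := h1.sub h2
  rw [smul_zero, zero_smul, sub_zero] at h3
  refine h3.congr' ?_
  filter_upwards [(eventually_cofinite_ne (a : ℂ)).filter_mono (Bornology.le_cofinite ℂ)] with z hz
  have hz' := sub_ne_zero.mpr hz
  have h4 := plusPart_geomSeries_smul m a A z
  have h5 : plusPart m (geomSeries a • A) z =
      (z - a)⁻¹ • (plusPart m A z - cx (coeff m A + a • coeff m (geomSeries a • A))) := by
    rw [← h4, smul_smul, inv_mul_cancel₀ hz', one_smul]
  rw [h5]
  module

theorem IsPlusAsymptotic.simpleSeries_mul (a b : ℝ) (P P' : Mat n ℝ)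
    (hA : IsPlusAsymptotic m A f) : IsPlusAsymptotic m (simpleSeries a b P P' * A)
      (fun z => dress ((b : ℂ) - a) (z - a)⁻¹ (z - b)⁻¹ (cx P) (cx P') * f z) := by
  have h := (hA.add (((hA.C_mul P).geomSeries_smul b).C_smul (b - a))).sub
    (((hA.C_mul P').geomSeries_smul a).C_smul (b - a))
  convert h using 1
  · rw [simpleSeries, dress, sub_mul, add_mul, one_mul, smul_mul_assoc, smul_mul_assoc, mul_smul,
      mul_smul]
  · funext z
    rw [dress, sub_mul, add_mul, one_mul, smul_mul_assoc, smul_mul_assoc, mul_smul, mul_smul,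
      Complex.ofReal_sub]

theorem IsPlusAsymptotic.mul_simpleSeries (a b : ℝ) (P P' : Mat n ℝ)
    (hA : IsPlusAsymptotic m A f) : IsPlusAsymptotic m (A * simpleSeries a b P P')
      (fun z => f z * dress ((b : ℂ) - a) (z - a)⁻¹ (z - b)⁻¹ (cx P) (cx P')) := by
  have h := (hA.add (((hA.mul_C P).geomSeries_smul b).C_smul (b - a))).sub
    (((hA.mul_C P').geomSeries_smul a).C_smul (b - a))
  convert h using 1
  · rw [simpleSeries, dress, mul_sub, mul_add, mul_one, mul_smul_comm, mul_smul_comm, mul_smul,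
      mul_smul]
  · funext z
    rw [dress, mul_sub, mul_add, mul_one, mul_smul_comm, mul_smul_comm, mul_smul, mul_smul,
      Complex.ofReal_sub]

theorem holoOn_plusPart (m : ℕ) (A : PowerSeries (Mat n ℝ)) (U : Set ℂ) :
    HoloOn (plusPart m A) U := by
  induction m with
  | zero => exact (HoloOn.const _).congr fun z _ => plusPart_zero A z
  | succ m ih =>
    exact ((HoloOn.smul differentiableOn_id ih).add (HoloOn.const (cx (coeff (m + 1) A)))).congr
      fun z _ => plusPart_succ m A z

/-- An entire function that is the gauge transform of `(T ^ m)_+` is the nonnegative part of the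
`m`-th power of the transformed series. -/
theorem eq_TPlus_gaugeSeries {a b : ℝ} {P : Mat n ℝ} (hP : IsoIdem P) {S : PowerSeries (Mat n ℝ)}
    {D D' : Mat n ℂ} {W : ℂ → Mat n ℂ} (hW : HoloOn W univ)
    (h : ∀ z : ℂ, z ≠ a → z ≠ b → W z =
      dress ((b : ℂ) - a) (z - a)⁻¹ (z - b)⁻¹ (cx P) (adj (cx P)) *
        (TPlus m S z * dress ((b : ℂ) - a) (z - a)⁻¹ (z - b)⁻¹ (adj (cx P)) (cx P)
          - (((b : ℂ) - a) * (z - a)⁻¹) • D + (((b : ℂ) - a) * (z - b)⁻¹) • D')) (z : ℂ) :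
    W z = TPlus m (gaugeSeries a b P S) z := by
  have h0 : IsPlusAsymptotic m (S ^ m) (TPlus m S) := by
    refine tendsto_const_nhds.congr fun z => ?_
    rw [TPlus_eq, sub_self]
  have h1 := (h0.simpleSeries_mul a b P (adj P)).mul_simpleSeries a b (adj P) P
  rw [← gaugeSeries, ← gaugeSeries_pow hP] at h1
  -- The derivative terms with `D`, `D'` vanish at infinity, so the conjugation alone determines the
  -- polynomial part of `W`.
  have h2 : ∀ (c : ℂ) (E : Mat n ℂ), Tendsto (fun z : ℂ => (((b : ℂ) - a) * (z - c)⁻¹) • E)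
      (Bornology.cobounded ℂ) (𝓝 0) := fun c E => by
    have := ((tendsto_inv_sub_cobounded c).const_mul ((b : ℂ) - a)).smul_const E
    rwa [mul_zero, zero_smul] at this
  have h3 := (tendsto_dress_cobounded ((b : ℂ) - a) a b (cx P) (adj (cx P))).mul
    ((h2 b D').sub (h2 a D))
  have h4 := Tendsto.sub h1 h3
  rw [sub_zero, mul_zero, sub_zero] at h4
  have h5 : Tendsto (fun z => TPlus m (gaugeSeries a b P S) z - W z) (Bornology.cobounded ℂ)
      (𝓝 0) := by
    refine h4.congr' ?_
    filter_upwards [(eventually_cofinite_ne (a : ℂ)).filter_mono (Bornology.le_cofinite ℂ),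
      (eventually_cofinite_ne (b : ℂ)).filter_mono (Bornology.le_cofinite ℂ)] with z hza hzb
    rw [h z hza hzb]
    simp only [TPlus_eq, cx_adj, mul_add, mul_sub, mul_assoc]
    abel
  exact (sub_eq_zero.mp (eq_of_holo_of_tendsto ((holoOn_plusPart _ _ _).sub hW) h5 z)).symm

end Asymptotics

/-! ### Transported projections and their Riccati equation -/

section Transport

variable {n j : ℕ} {O : Set (ℝ × ℝ)} {q : ℝ × ℝ → Mat n ℝ} {F : ℝ × ℝ → ℂ → Mat n ℂ}

theorem IsPosLoop.adj_mul {f : ℂ → Mat n ℂ} (h : IsPosLoop n f) (z : ℂ) : adj (f z) * f z = 1 :=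
  orth_iff.mp (h.orth z)

theorem IsPosLoop.mul_adj {f : ℂ → Mat n ℂ} (h : IsPosLoop n f) (z : ℂ) : f z * adj (f z) = 1 :=
  mul_eq_one_comm.mp (h.adj_mul z)

theorem IsPosLoop.holoOn {f : ℂ → Mat n ℂ} (h : IsPosLoop n f) : HoloOn f univ :=
  holoOn_univ.mpr h.holo

theorem cx_frameAt {p : ℝ × ℝ} (h : IsPosLoop n (F p)) (a : ℝ) : cx (frameAt F p a) = F p a := by
  ext i k
  have := congrFun (congrFun (h.real a) i) k
  rw [Complex.conj_ofReal, Matrix.map_apply] at this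
  exact Complex.conj_eq_iff_re.mp this

theorem frameAt_mul_adj {p : ℝ × ℝ} (h : IsPosLoop n (F p)) (a : ℝ) :
    frameAt F p a * adj (frameAt F p a) = 1 := by
  apply cx_injective
  rw [cx_mul, cx_adj, cx_frameAt h, cx_one, h.mul_adj]

theorem isTransported_iff {a c : ℝ} {P : Mat n ℝ} {Pt : ℝ × ℝ → Mat n ℝ} (hP : P * P = P)
    (hF : ∀ p ∈ O, IsPosLoop n (F p)) : IsTransported O F a c P Pt ↔
      ∀ p ∈ O, Link P (Pt p) (frameAt F p a) (frameAt F p c) :=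
  forall₂_congr fun p hp =>
    isProj_comap_iff hP (frameAt_mul_adj (hF p hp) a) (frameAt_mul_adj (hF p hp) c)

/-- A transported rank one projection satisfies a Riccati equation. -/
theorem hasMDerivAt_link {A C Q : ℝ → Mat n ℝ} {P Ba Bc : Mat n ℝ} {x : ℝ} (hP : RankOne P)
    (hA : HasMDerivAt ℝ A (A x * Ba) x) (hC : HasMDerivAt ℝ C (C x * Bc) x)
    (hB : adj Ba = -Ba)
    (hQ : ∀ᶠ y in 𝓝 x, Link P (Q y) (A y) (C y) ∧ A y * adj (A y) = 1 ∧ C y * adj (C y) = 1) :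
    HasMDerivAt ℝ Q (-(Ba * Q x) + Q x * Bc - Q x * (Bc - Ba) * Q x) x := by
  have hf : ∀ᶠ y in 𝓝 x, (P * (C y * adj (A y))).trace ≠ 0 ∧
      Q y = (P * (C y * adj (A y))).trace⁻¹ • (adj (A y) * P * C y) :=
    hQ.mono fun y hy => hy.1.eq_smul hP (mul_eq_one_comm.mp hy.2.1) (mul_eq_one_comm.mp hy.2.2)
  have hs := ((hC.mul hA.adj).const_mul P).trace
  obtain ⟨hs0, hQx⟩ := hf.self_of_nhds
  have hM := (hA.adj.mul_const P).mul hC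
  have h1 := (HasMDerivAt.smul (hs.inv hs0) hM).congr_of_eventuallyEq (hf.mono fun y hy => hy.2)
  set s := (P * (C x * adj (A x))).trace with hsd
  -- Here `κ = -s'/s` comes from the normalizing factor `s⁻¹`. Its value is recovered from
  -- idempotence: `Q² = Q` gives `Q Q' Q = 0`, that is `κ Q = Q Ba Q - Q Bc Q`.
  obtain ⟨κ, hκ⟩ : ∃ κ : ℝ, HasMDerivAt ℝ Q (κ • Q x + (-(Ba * Q x) + Q x * Bc)) x := by
    refine ⟨-(P * (C x * Bc * adj (A x) + C x * adj (A x * Ba))).trace / s, ?_⟩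
    convert h1 using 1
    rw [hQx, adj_mul, hB]
    simp only [Pi.inv_apply, ← hsd, smul_smul, smul_add, neg_mul, mul_assoc, smul_mul_assoc,
      mul_smul_comm, smul_neg]
    match_scalars <;> field_simp
  have hQQ : HasMDerivAt ℝ Q _ x :=
    (hκ.mul hκ).congr_of_eventuallyEq (hQ.mono fun y hy => hy.1.idem.symm)
  have e := hκ.unique hQQ
  have i := hQ.self_of_nhds.1.idem
  have i' : ∀ X, Q x * (Q x * X) = Q x * X := fun X => by rw [← mul_assoc, i]
  have e2 := congrArg (fun X => Q x * X * Q x) e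
  simp only [mul_add, add_mul, mul_smul_comm, smul_mul_assoc, mul_assoc, i, i', neg_mul,
    mul_neg] at e2
  have e3 : κ • Q x = Q x * (Ba * Q x) - Q x * (Bc * Q x) := by
    rw [← sub_eq_zero] at e2 ⊢
    rw [← neg_eq_zero, ← e2]
    abel
  convert hκ using 1
  rw [e3]
  noncomm_ring

theorem IsFrame.mono {U : Set (ℝ × ℝ)} (h : IsFrame n j U q F) (hO : O ⊆ U) (h0 : (0, 0) ∈ O) :
    IsFrame n j O q F := by
  obtain ⟨S, hS, ht⟩ := h.eq_t
  refine ⟨fun z => (h.smooth z).mono hO, h.cont.mono (prod_mono_left hO),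
    fun p hp => h.loop p (hO hp), fun p hp => h.det_one p (hO hp), fun p hp => h.eq_x p (hO hp),
    ⟨S, ⟨fun k => (hS.smooth k).mono hO, fun p hp => hS.skew p (hO hp),
      fun p hp => hS.leading p (hO hp), fun p hp => hS.commute p (hO hp),
      fun p hp => hS.power p (hO hp)⟩, fun p hp => ht p (hO hp)⟩, h0, h.normalized⟩

theorem IsFrame.frameAt_zero (hF : IsFrame n j O q F) (a : ℝ) : frameAt F (0, 0) a = 1 := by
  apply cx_injective
  rw [cx_frameAt (hF.loop _ hF.base), hF.normalized, cx_one]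

/-- At the origin the frame is `I`, and the image and kernel equations become `P Q = Q` and `P Q =
P`. This normalizes the dressed frame. -/
theorem IsFrame.link_zero {a c : ℝ} {P : Mat n ℝ} {Pt : ℝ × ℝ → Mat n ℝ}
    (hF : IsFrame n j O q F) (h : Link P (Pt (0, 0)) (frameAt F (0, 0) a) (frameAt F (0, 0) c)) :
    Pt (0, 0) = P := by
  rw [hF.frameAt_zero, hF.frameAt_zero] at h
  have h1 := h.im_le
  have h2 := h.ke_le
  rw [mul_one, one_mul] at h1
  rw [mul_one] at h2
  rw [← h1, h2]

end Transport

/-! ### Uniqueness of the dressing action -/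

section Dressing

variable {n j : ℕ} {O : Set (ℝ × ℝ)}

theorem isRatLoop_simpleElt {a c : ℝ} {P : Mat n ℝ} (hP : IsoIdem P) :
    IsRatLoop n (fun z => simpleElt a c P z) := by
  have hfin : ∀ᶠ z : ℂ in cofinite, z ∈ compl₂ a c :=
    (eventually_cofinite_ne (a : ℂ)).and (eventually_cofinite_ne (c : ℂ))
  refine ⟨⟨(Polynomial.X - Polynomial.C (a : ℂ)) * (Polynomial.X - Polynomial.C (c : ℂ)),
    ((Polynomial.X - Polynomial.C (a : ℂ)) * (Polynomial.X - Polynomial.C (c : ℂ))) • 1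
    + (Polynomial.C ((c : ℂ) - a) * (Polynomial.X - Polynomial.C (a : ℂ))) •
        (cx P).map Polynomial.C
    - (Polynomial.C ((c : ℂ) - a) * (Polynomial.X - Polynomial.C (c : ℂ))) •
        (adj (cx P)).map Polynomial.C,
    mul_ne_zero (Polynomial.X_sub_C_ne_zero _) (Polynomial.X_sub_C_ne_zero _), fun z hz => ?_⟩,
    hfin.mono fun z hz => ?_, Eventually.of_forall fun z => simpleElt_conj a c P z,
    tendsto_simpleElt a c P⟩
  · rw [Polynomial.eval_mul, Polynomial.eval_sub, Polynomial.eval_sub, Polynomial.eval_X,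
      Polynomial.eval_C, Polynomial.eval_C] at hz ⊢
    have h1 := left_ne_zero_of_mul hz
    have h2 := right_ne_zero_of_mul hz
    ext i k
    have h3 : Polynomial.eval z ((1 : Mat n (Polynomial ℂ)) i k) = (1 : Mat n ℂ) i k := by
      rw [Matrix.one_apply, Matrix.one_apply]
      split_ifs <;> simp
    simp only [simpleElt_cx, dress, Matrix.smul_apply, Matrix.add_apply, Matrix.sub_apply,
      Matrix.map_apply, smul_eq_mul, Polynomial.eval_add, Polynomial.eval_sub, Polynomial.eval_mul,
      Polynomial.eval_X, Polynomial.eval_C, h3]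
    field_simp
  · rw [orth_iff]
    exact mul_eq_one_comm.mp (simpleElt_mul_adj_cx hP hz)

theorem IsRatLoop.adj_mul {f : ℂ → Mat n ℂ} (h : IsRatLoop n f) :
    ∀ᶠ z in cofinite, adj (f z) * f z = 1 :=
  h.orth.mono fun _ hz => orth_iff.mp hz

/-- Uniqueness of the factorization into an entire and a rational loop. -/
theorem factorization_unique {A G G' h h' : ℂ → Mat n ℂ} (hG : IsPosLoop n G)
    (hG' : IsPosLoop n G') (hh : IsRatLoop n h) (hh' : IsRatLoop n h')
    (e : ∀ᶠ z in cofinite, A z = G z * h z) (e' : ∀ᶠ z in cofinite, A z = G' z * h' z) :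
    G = G' ∧ ∀ᶠ z in cofinite, h z = h' z := by
  -- The right side is entire and the left side tends to `1` at infinity, so Liouville's theorem
  -- applies to `G'⁻¹ G`.
  have key : ∀ᶠ z in cofinite, h' z * adj (h z) = adj (G' z) * G z := by
    filter_upwards [e, e', hh.adj_mul] with z h1 h2 h3
    have h4 := mul_eq_one_comm.mp h3
    have h5 : h' z = adj (G' z) * (G z * h z) := by
      rw [← h1, h2, ← mul_assoc, hG'.adj_mul, one_mul]
    rw [h5, mul_assoc, mul_assoc, h4, mul_one]
  have hlim : Tendsto (fun z => adj (G' z) * G z) (Bornology.cobounded ℂ) (𝓝 1) := by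
    have h1 := (continuous_adj.tendsto (1 : Mat n ℂ)).comp hh.infty
    rw [adj_one] at h1
    have h2 := hh'.infty.mul h1
    rw [mul_one] at h2
    exact h2.congr' (key.filter_mono (Bornology.le_cofinite ℂ))
  have h1 := eq_of_holo_of_tendsto (hG'.holoOn.adj.mul hG.holoOn) hlim
  have hGG : G = G' := by
    funext z
    have := congrArg (fun X => G' z * X) (h1 z)
    simp only [← mul_assoc, hG'.mul_adj, one_mul, mul_one] at this
    exact this
  refine ⟨hGG, ?_⟩
  subst hGG
  filter_upwards [e, e'] with z h2 h3
  rw [h2] at h3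
  have := congrArg (fun X => adj (G z) * X) h3
  simp only [← mul_assoc, hG.adj_mul, one_mul] at this
  exact this

/-- At each point of `O` the factorization is unique up to finitely many values of `h`, and these do
not affect the limit that defines `h_{-1}`. -/
theorem IsDressing.unique {f : ℂ → Mat n ℂ} {q r q' r' : ℝ × ℝ → Mat n ℝ}
    {F G F' G' : ℝ × ℝ → ℂ → Mat n ℂ} (h : IsDressing n j O f q F q' F')
    (h' : IsDressing n j O f r G r' G') (hq : ∀ p ∈ O, r p = q p) (hF : ∀ p ∈ O, G p = F p) :
    (∀ p ∈ O, r' p = q' p) ∧ ∀ p ∈ O, G' p = F' p := by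
  obtain ⟨k, R, hk⟩ := h.factor
  obtain ⟨k', R', hk'⟩ := h'.factor
  have key : ∀ p ∈ O, r' p = q' p ∧ G' p = F' p := by
    intro p hp
    obtain ⟨a1, a2, a3, a4, a5⟩ := hk p hp
    obtain ⟨b1, b2, b3, b4, b5⟩ := hk' p hp
    rw [hF p hp] at b3
    obtain ⟨e1, e2⟩ := factorization_unique b1 a1 b2 a2 b3 a3
    refine ⟨?_, e1⟩
    have h1 : Tendsto (fun z : ℂ => z • (k p z - 1)) (Bornology.cobounded ℂ) (𝓝 (cx (R' p))) := by
      refine b4.congr' ?_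
      filter_upwards [e2.filter_mono (Bornology.le_cofinite ℂ)] with z hz
      rw [hz]
    have h2 : R' p = R p := cx_injective (tendsto_nhds_unique h1 a4)
    rw [b5, a5, h2, hq p hp]
  exact ⟨fun p hp => (key p hp).1, fun p hp => (key p hp).2⟩

/-- Identifies `h_{-1}` when `h` is a simple element, which yields the formula for the new
potential. -/
theorem tendsto_smul_simpleElt_sub_one (a c : ℝ) (P : Mat n ℝ) :
    Tendsto (fun z : ℂ => z • (simpleElt a c P z - 1)) (Bornology.cobounded ℂ)
      (𝓝 (cx ((c - a) • (P - adj P)))) := by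
  have h1 : ∀ b : ℂ, Tendsto (fun z : ℂ => z * (z - b)⁻¹) (Bornology.cobounded ℂ) (𝓝 1) := by
    intro b
    have := ((tendsto_inv_sub_cobounded b).const_mul b).const_add 1
    rw [mul_zero, add_zero] at this
    refine this.congr' ?_
    filter_upwards [(eventually_cofinite_ne b).filter_mono (Bornology.le_cofinite ℂ)] with z hz
    have := sub_ne_zero.mpr hz
    field_simp
    ring
  have h2 := (((h1 c).const_mul ((c : ℂ) - a)).smul_const (cx P)).sub
    (((h1 a).const_mul ((c : ℂ) - a)).smul_const (adj (cx P)))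
  have h3 : cx ((c - a) • (P - adj P)) =
      (((c : ℂ) - a) * 1) • cx P - (((c : ℂ) - a) * 1) • adj (cx P) := by
    rw [cx_smul, cx_sub, cx_adj, mul_one, smul_sub, Complex.ofReal_sub]
  rw [h3]
  refine h2.congr fun z => ?_
  rw [simpleElt_cx, dress]
  module

end Dressing

/-! ### The Darboux transform stays upper triangular -/

section Borel

variable {n : ℕ}

/-- Up to sign, this corner entry is a diagonal entry of the antisymmetric matrix `ρ X`. -/
theorem apply_last_zero_of_adj {X : Mat n ℝ} (hX : adj X = -X) :
    X (Fin.last (2 * n)) 0 = 0 := by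
  have h1 : (rho n ℝ * X).transpose = -(rho n ℝ * X) := by
    have := isSkew_iff.mpr hX
    rw [IsSkew] at this
    rw [Matrix.transpose_mul, rho_transpose]
    exact eq_neg_of_add_eq_zero_left this
  have h2 := congrFun (congrFun h1 0) 0
  rw [Matrix.transpose_apply, Matrix.neg_apply, rho_apply_mul, self_eq_neg, Fin.rev_zero] at h2
  exact (mul_eq_zero.mp h2).resolve_left (pow_ne_zero _ (by norm_num))

/-- The nonzero entries of `β` lie so far to the upper right that below the diagonal `β X` (and, in
`mul_beta_apply`, `X β`) only sees the corner entry of `X`. -/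
theorem beta_mul_apply (X : Mat n ℝ) {i k : Fin (2 * n + 1)} (h : k < i)
    (hX : X (Fin.last (2 * n)) 0 = 0) : (beta n * X) i k = 0 := by
  rw [Matrix.mul_apply]
  refine Finset.sum_eq_zero fun l _ => ?_
  simp only [beta, Matrix.of_apply]
  split_ifs with hc
  · have hl : l = Fin.last (2 * n) := by
      ext; rw [Fin.val_last]; have := Fin.lt_def.mp h; omega
    have hk : k = 0 := by
      ext; rw [Fin.val_zero]; have := Fin.lt_def.mp h; omega
    rw [hl, hk, hX, mul_zero]
  · rw [zero_mul]

theorem mul_beta_apply (X : Mat n ℝ) {i k : Fin (2 * n + 1)} (h : k < i)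
    (hX : X (Fin.last (2 * n)) 0 = 0) : (X * beta n) i k = 0 := by
  rw [Matrix.mul_apply]
  refine Finset.sum_eq_zero fun l _ => ?_
  simp only [beta, Matrix.of_apply]
  have hi := i.isLt
  split_ifs with hc
  · have hl : l = 0 := by
      ext; rw [Fin.val_zero]; have := Fin.lt_def.mp h; omega
    have hk : i = Fin.last (2 * n) := by
      ext; rw [Fin.val_last]; have := Fin.lt_def.mp h; omega
    rw [hl, hk, hX, zero_mul]
  · rw [mul_zero]

theorem adj_lie {A B : Mat n ℝ} (hA : adj A = -A) (hB : adj B = -B) : adj ⁅A, B⁆ = -⁅A, B⁆ := by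
  rw [Ring.lie_def, adj_sub, adj_mul, adj_mul, hA, hB]
  noncomm_ring

theorem isBorel_darboux {a c : ℝ} {q P : ℝ × ℝ → Mat n ℝ} {p : ℝ × ℝ} (hq : IsBorel n (q p)) :
    IsBorel n (darboux a c q P p) := by
  have hX : adj (P p - adj (P p)) = -(P p - adj (P p)) := by
    rw [adj_sub, adj_adj, neg_sub]
  have h0 := apply_last_zero_of_adj hX
  constructor
  · rw [isSkew_iff, darboux, sharp_eq_adj, adj_add, adj_smul, isSkew_adj hq.1,
      adj_lie (isSkew_adj isSkew_beta) hX]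
    module
  · intro i k hik
    rw [darboux, sharp_eq_adj, Matrix.add_apply, hq.2 i k hik, Matrix.smul_apply, Ring.lie_def,
      Matrix.sub_apply, beta_mul_apply _ hik h0, mul_beta_apply _ hik h0]
    simp

end Borel

/-! ### Mixed partial derivatives and zero curvature -/

section Mixed

variable {n : ℕ} {U : Set (ℝ × ℝ)}

theorem mixed_partials {g X Y : ℝ × ℝ → ℂ} (hU : IsOpen U) (hg : ContDiffOn ℝ ∞ g U)
    (hx : ∀ p ∈ U, HasDerivAt (fun x => g (x, p.2)) (X p) p.1)
    (ht : ∀ p ∈ U, HasDerivAt (fun t => g (p.1, t)) (Y p) p.2) {p : ℝ × ℝ} (hp : p ∈ U) {a b : ℂ}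
    (hXt : HasDerivAt (fun t => X (p.1, t)) a p.2)
    (hYx : HasDerivAt (fun x => Y (x, p.2)) b p.1) : a = b := by
  have hga : ∀ r ∈ U, ContDiffAt ℝ ∞ g r := fun r hr => hg.contDiffAt (hU.mem_nhds hr)
  have hd : ∀ r ∈ U, HasFDerivAt g (fderiv ℝ g r) r := fun r hr =>
    ((hga r hr).differentiableAt (by simp)).hasFDerivAt
  have lx : ∀ (s : ℝ) (x : ℝ), HasDerivAt (fun x : ℝ => (x, s)) ((1 : ℝ), (0 : ℝ)) x := fun s x =>
    (hasDerivAt_id x).prodMk (hasDerivAt_const x s)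
  have lt : ∀ (s : ℝ) (t : ℝ), HasDerivAt (fun t : ℝ => (s, t)) ((0 : ℝ), (1 : ℝ)) t := fun s t =>
    (hasDerivAt_const t s).prodMk (hasDerivAt_id t)
  have eX : ∀ r ∈ U, fderiv ℝ g r (1, 0) = X r := fun r hr =>
    ((hd r hr).comp_hasDerivAt r.1 (lx r.2 r.1)).unique (hx r hr)
  have eY : ∀ r ∈ U, fderiv ℝ g r (0, 1) = Y r := fun r hr =>
    ((hd r hr).comp_hasDerivAt r.2 (lt r.1 r.2)).unique (ht r hr)
  have hg2 : ContDiffAt ℝ 2 g p := (contDiffOn_infty.mp hg 2).contDiffAt (hU.mem_nhds hp)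
  have h2 : HasFDerivAt (fderiv ℝ g) (fderiv ℝ (fderiv ℝ g) p) p :=
    ((hg2.fderiv_right (m := 1) (by norm_num)).differentiableAt (by simp)).hasFDerivAt
  have hsymm : IsSymmSndFDerivAt ℝ g p := hg2.isSymmSndFDerivAt (by simp)
  have hev : ∀ v : ℝ × ℝ, HasFDerivAt (fun r => fderiv ℝ g r v)
      ((ContinuousLinearMap.apply ℝ ℂ v).comp (fderiv ℝ (fderiv ℝ g) p)) p := fun v =>
    (ContinuousLinearMap.apply ℝ ℂ v).hasFDerivAt.comp p h2
  have k1 : HasDerivAt (fun t => fderiv ℝ g (p.1, t) (1, 0))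
      (fderiv ℝ (fderiv ℝ g) p (0, 1) (1, 0)) p.2 := by
    have := (hev (1, 0)).comp_hasDerivAt p.2 (lt p.1 p.2)
    exact this
  have k2 : HasDerivAt (fun x => fderiv ℝ g (x, p.2) (0, 1))
      (fderiv ℝ (fderiv ℝ g) p (1, 0) (0, 1)) p.1 := by
    have := (hev (0, 1)).comp_hasDerivAt p.1 (lx p.2 p.1)
    exact this
  have n1 : ∀ᶠ t in 𝓝 p.2, (p.1, t) ∈ U :=
    (show Continuous fun t : ℝ => (p.1, t) by fun_prop).continuousAt.eventually (hU.mem_nhds hp)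
  have n2 : ∀ᶠ x in 𝓝 p.1, (x, p.2) ∈ U :=
    (show Continuous fun x : ℝ => (x, p.2) by fun_prop).continuousAt.eventually (hU.mem_nhds hp)
  have m1 := (k1.congr_of_eventuallyEq (n1.mono fun t h => (eX _ h).symm)).unique hXt
  have m2 := (k2.congr_of_eventuallyEq (n2.mono fun x h => (eY _ h).symm)).unique hYx
  rw [← m1, ← m2, hsymm.eq]

/-- The zero curvature equation for a smooth invertible solution of a linear system. -/
theorem zero_curvature {G : ℝ × ℝ → Mat n ℂ} {A B : ℝ × ℝ → Mat n ℂ} {H : ℝ × ℝ → Mat n ℂ}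
    (hU : IsOpen U) (hG : SmoothOn G U)
    (hx : ∀ p ∈ U, HasMDerivAt ℝ (fun x => G (x, p.2)) (G p * A p) p.1)
    (ht : ∀ p ∈ U, HasMDerivAt ℝ (fun t => G (p.1, t)) (G p * B p) p.2)
    (hH : ∀ p ∈ U, H p * G p = 1) {p : ℝ × ℝ} (hp : p ∈ U) {At Bx : Mat n ℂ}
    (hA : HasMDerivAt ℝ (fun t => A (p.1, t)) At p.2)
    (hB : HasMDerivAt ℝ (fun x => B (x, p.2)) Bx p.1) : At = Bx + ⁅A p, B p⁆ := by
  have h1 := (ht p hp).mul hA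
  have h2 := (hx p hp).mul hB
  have e : G p * B p * A p + G p * At = G p * A p * B p + G p * Bx :=
    Matrix.ext fun i k => mixed_partials hU (hG i k) (fun r hr => hx r hr i k)
      (fun r hr => ht r hr i k) hp (h1 i k) (h2 i k)
  have e2 := congrArg (fun X => H p * X) e
  simp only [mul_add, ← mul_assoc, hH p hp, one_mul] at e2
  rw [Ring.lie_def, ← sub_eq_zero]
  rw [← sub_eq_zero] at e2
  rw [← e2]
  abel

theorem hasMDerivAt_of_finite_exception {I : Set ℝ} (hI : IsOpen I) {S : Set ℂ} (hS : S.Finite)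
    {f m : ℝ → ℂ → Mat n ℂ} (hf : ContinuousOn (Function.uncurry f) (I ×ˢ univ))
    (hm : ContinuousOn (Function.uncurry m) (I ×ˢ univ))
    (h : ∀ x ∈ I, ∀ z ∉ S, HasMDerivAt ℝ (fun x => f x z) (m x z) x) {x₀ : ℝ} (hx₀ : x₀ ∈ I)
    (z₀ : ℂ) : HasMDerivAt ℝ (fun x => f x z₀) (m x₀ z₀) x₀ := by
  intro i k
  have e : ∀ {g : ℝ → ℂ → Mat n ℂ}, ContinuousOn (Function.uncurry g) (I ×ˢ univ) →
      ContinuousOn (Function.uncurry fun x z => g x z i k) (I ×ˢ univ) := fun hg =>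
    continuousOn_pi.mp (continuousOn_pi.mp hg i) k
  exact hasDerivAt_of_finite_exception hI hS (e hf) (e hm) (fun x hx z hz => h x hx z hz i k) hx₀ z₀

end Mixed

/-! ### Skewness and smoothness of `(T^m)_+` -/

section TPlusReal

open PowerSeries

variable {n : ℕ}

/-- `(T ^ m)_+` at a real point. -/
def realTPlus (m : ℕ) (S : PowerSeries (Mat n ℝ)) (a : ℝ) : Mat n ℝ :=
  ∑ k ∈ Finset.range (m + 1), a ^ (m - k) • coeff k (S ^ m)

theorem cx_realTPlus (m : ℕ) (S : PowerSeries (Mat n ℝ)) (a : ℝ) :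
    cx (realTPlus m S a) = TPlus m S a := by
  rw [realTPlus, cx_eq, map_sum]
  refine Finset.sum_congr rfl fun k _ => ?_
  rw [← cx_eq, cx_smul, Complex.ofReal_pow]
  rfl

/-- Here the odd index of the flows matters: odd powers of a skew series have skew coefficients. -/
theorem adj_coeff_pow {m : ℕ} (hm : Odd m) {S : PowerSeries (Mat n ℝ)}
    (hS : ∀ k, IsSkew n (coeff k S)) (k : ℕ) : adj (coeff k (S ^ m)) = -coeff k (S ^ m) := by
  have h1 : sadj S = -S := by
    ext1 k
    rw [sadj, coeff_mk, map_neg, isSkew_adj (hS k)]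
  have h2 : ∀ l, sadj (S ^ l) = sadj S ^ l := fun l => by
    induction l with
    | zero =>
      rw [pow_zero, pow_zero, ← map_one (C : Mat n ℝ →+* PowerSeries (Mat n ℝ)), sadj_C, adj_one]
    | succ l ih => rw [pow_succ, sadj_mul, ih, pow_succ']
  have h3 := congrArg (coeff k) (h2 m)
  rwa [h1, hm.neg_pow, sadj, coeff_mk, map_neg] at h3

theorem adj_TPlus {m : ℕ} (hm : Odd m) {S : PowerSeries (Mat n ℝ)}
    (hS : ∀ k, IsSkew n (coeff k S)) (z : ℂ) : adj (TPlus m S z) = -TPlus m S z := by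
  rw [TPlus, adj_sum, ← Finset.sum_neg_distrib]
  refine Finset.sum_congr rfl fun k _ => ?_
  have h : adj ((coeff k (S ^ m)).map Complex.ofReal) = -(coeff k (S ^ m)).map Complex.ofReal := by
    have := congrArg cx (adj_coeff_pow hm hS k)
    rwa [cx_adj, cx_neg] at this
  rw [adj_smul, h, smul_neg]

theorem adj_realTPlus {m : ℕ} (hm : Odd m) {S : PowerSeries (Mat n ℝ)}
    (hS : ∀ k, IsSkew n (coeff k S)) (a : ℝ) : adj (realTPlus m S a) = -realTPlus m S a := by
  apply cx_injective
  rw [cx_adj, cx_neg, cx_realTPlus, adj_TPlus hm hS]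

theorem TPlus_zero (m : ℕ) (S : PowerSeries (Mat n ℝ)) : TPlus m S 0 = cx (TZero m S) := by
  rw [TPlus_eq, plusPart_at_zero, TZero]

theorem smoothOn_TPlus {U : Set (ℝ × ℝ)} {S : ℝ × ℝ → PowerSeries (Mat n ℝ)}
    (hS : SmoothSeriesOn S U) (m : ℕ) (z : ℂ) : SmoothOn (fun p => TPlus m (S p) z) U :=
  SmoothOn.sum fun k _ => (hS.pow m k).cx.const_smul (z ^ (m - k))

theorem continuousOn_TPlus {U : Set (ℝ × ℝ)} {S : ℝ × ℝ → PowerSeries (Mat n ℝ)}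
    (hS : SmoothSeriesOn S U) (m : ℕ) (V : Set ℂ) :
    ContinuousOn (fun w : (ℝ × ℝ) × ℂ => TPlus m (S w.1) w.2) (U ×ˢ V) := by
  refine continuousOn_finsetSum _ fun k _ => ?_
  exact (continuous_snd.pow _).continuousOn.smul
    ((hS.pow m k).cx.continuousOn.comp continuous_fst.continuousOn fun w hw => hw.1)

end TPlusReal

/-! ### Residue conditions from the Riccati equation -/

section Conditions

variable {R : Type*} [Ring R]

/-- The residue conditions for a projection that satisfies a Riccati equation. -/
theorem riccati_conditions {A B D D' P P' : R} (h : OrthIdem P P')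
    (hD : D = -(A * P) + P * B - P * (B - A) * P)
    (hD' : D' = P' * A - B * P' + P' * (B - A) * P') :
    (1 - P) * (A * P + D) = 0 ∧ P' * (A * (1 - P') - D') = 0 ∧ P' * (A * P + D) = 0 ∧
      (1 - P') * (B * P' + D') = 0 ∧ P * (B * (1 - P) - D) = 0 ∧ P * (B * P' + D') = 0 := by
  have i1 : ∀ X, P * (P * X) = P * X := fun X => by rw [← mul_assoc, h.idem]
  have i2 : ∀ X, P' * (P' * X) = P' * X := fun X => by rw [← mul_assoc, h.idem']
  have i3 : ∀ X, P * (P' * X) = 0 := fun X => by rw [← mul_assoc, h.mul_zero', zero_mul]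
  have i4 : ∀ X, P' * (P * X) = 0 := fun X => by rw [← mul_assoc, h.zero_mul', zero_mul]
  subst hD hD'
  refine ⟨?_, ?_, ?_, ?_, ?_, ?_⟩ <;>
  · simp only [mul_add, sub_mul, mul_sub, mul_neg, mul_assoc, one_mul, mul_one, i1, i2, i3, i4]
    abel

end Conditions

/-! ### Gauge identities for both parts of the connection -/

section Dressed

variable {n : ℕ}

/-- In the logarithmic derivative of `G Φ g⁻¹` the constant left factor drops out, leaving the gauge
transform `g E g⁻¹ + g (g⁻¹)'` of `E`. -/
theorem hasMDerivAt_dressed {Φ g : ℝ → Mat n ℂ} {E E₁ H : Mat n ℂ} {x : ℝ} (G : Mat n ℂ)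
    (hΦ : HasMDerivAt ℝ Φ (Φ x * E) x) (hg : HasMDerivAt ℝ (fun y => adj (g y)) H x)
    (ho : adj (g x) * g x = 1) (hE : E₁ = g x * (E * adj (g x) + H)) :
    HasMDerivAt ℝ (fun y => G * (Φ y * adj (g y))) (G * (Φ x * adj (g x)) * E₁) x := by
  convert (hΦ.mul hg).const_mul G using 1
  rw [hE]
  calc _ = G * (Φ x * ((adj (g x) * g x) * (E * adj (g x) + H))) := by simp only [mul_assoc]
    _ = _ := by rw [ho, one_mul, mul_add]; simp only [mul_assoc]

theorem hasMDerivAt_adj_simpleElt {a c : ℝ} {P : ℝ → Mat n ℝ} {D : Mat n ℝ} {x : ℝ}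
    (h : HasMDerivAt ℝ P D x) (z : ℂ) :
    HasMDerivAt ℝ (fun y => adj (simpleElt a c (P y) z))
      ((((c : ℂ) - a) * (z - c)⁻¹) • adj (cx D) - (((c : ℂ) - a) * (z - a)⁻¹) • cx D) x := by
  simp only [adj_simpleElt, dress]
  have := ((HasMDerivAt.const 1).add (h.cx.adj.const_smul (((c : ℂ) - a) * (z - c)⁻¹))).sub
    (h.cx.const_smul (((c : ℂ) - a) * (z - a)⁻¹))
  rwa [zero_add] at this

/-- The gauge identity for the spatial part of the connection. -/
theorem conn_gauge {a c : ℝ} {q P : ℝ × ℝ → Mat n ℝ} {p : ℝ × ℝ} {D : Mat n ℝ}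
    (hi : ∀ᶠ y in 𝓝 p.1, IsoIdem (P (y, p.2))) (hr : RankOne (P p)) (hq : IsSkew n (q p))
    (hP : HasMDerivAt ℝ (fun y => P (y, p.2)) D p.1)
    (hD : D = -(conn n (q p) a * P p) + P p * conn n (q p) c
      - P p * (conn n (q p) c - conn n (q p) a) * P p) {z : ℂ} (hz : z ∈ compl₂ a c) :
    JB n z + cx (darboux a c q P p) = simpleElt a c (P p) z *
      ((JB n z + cx (q p)) * adj (simpleElt a c (P p) z) +
        ((((c : ℂ) - a) * (z - c)⁻¹) • adj (cx D) - (((c : ℂ) - a) * (z - a)⁻¹) • cx D)) := by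
  have hip : IsoIdem (P p) := hi.self_of_nhds
  have hD' := adj_riccati (adj_conn hq a) (adj_conn hq c) hD
  have hu : ∀ b : ℝ, z ≠ b → (z - b)⁻¹ • (JB n z + cx (q p)) =
      (1 : ℂ) • cx (beta n) + (1 * (z - b)⁻¹) • cx (conn n (q p) b) := by
    intro b hb
    have hb' := sub_ne_zero.mpr hb
    have e : JB n z = z • cx (beta n) + cx (bMat n) := rfl
    rw [e, conn, cx_add, cx_add, cx_smul]
    match_scalars <;> field_simp
    ring
  have hskew : adj (cx (beta n)) = -cx (beta n) := by
    rw [← cx_adj, isSkew_adj isSkew_beta, cx_neg]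
  have hdd : ((c : ℂ) - a) • cx (beta n) = cx (conn n (q p) c) - cx (conn n (q p) a) := by
    rw [conn, conn, ← cx_sub, add_sub_add_right_eq_sub, ← sub_smul, cx_smul, Complex.ofReal_sub]
  have key := dress_gauge (D := cx D) (D' := adj (cx D)) hip.cx (hu a hz.1) (hu c hz.2) hdd
    (by rw [hD]; simp only [cx_mul, cx_add, cx_sub, cx_neg])
    (by rw [← cx_adj, hD']; simp only [cx_mul, cx_add, cx_sub, cx_adj])
    (hr.cx.mul_mul_adj hskew) (hr.cx.adj_mul_mul_self hskew)
  rw [one_smul, one_mul, ← simpleElt_cx] at key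
  have hE : JB n z + cx (darboux a c q P p) =
      JB n z + cx (q p) + ((c : ℂ) - a) • ⁅cx (P p) - adj (cx (P p)), cx (beta n)⁆ := by
    rw [darboux_apply, cx_add, cx_smul, cx_lie, cx_sub, cx_adj, Complex.ofReal_sub, add_assoc]
  rw [← hE] at key
  have ho := simpleElt_mul_adj_cx hip hz
  have hg : HasMDerivAt ℝ (fun y => simpleElt a c (P (y, p.2)) z)
      ((((c : ℂ) - a) * (z - c)⁻¹) • cx D - (((c : ℂ) - a) * (z - a)⁻¹) • adj (cx D)) p.1 := by
    simp only [simpleElt_cx, dress]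
    have := ((HasMDerivAt.const 1).add (hP.cx.const_smul (((c : ℂ) - a) * (z - c)⁻¹))).sub
      (hP.cx.adj.const_smul (((c : ℂ) - a) * (z - a)⁻¹))
    rwa [zero_add] at this
  -- Differentiating `g g⁻¹ = 1` converts the `-g_x g⁻¹` of `dress_gauge` into `g (g⁻¹)_x`.
  have h0 := (hg.mul (hasMDerivAt_adj_simpleElt hP z)).unique
    ((HasMDerivAt.const (1 : Mat n ℂ)).congr_of_eventuallyEq
      (hi.mono fun y hy => simpleElt_mul_adj_cx hy hz))
  have h1 : simpleElt a c (P p) z *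
      ((((c : ℂ) - a) * (z - c)⁻¹) • adj (cx D) - (((c : ℂ) - a) * (z - a)⁻¹) • cx D) =
      -(((((c : ℂ) - a) * (z - c)⁻¹) • cx D - (((c : ℂ) - a) * (z - a)⁻¹) • adj (cx D)) *
        adj (simpleElt a c (P p) z)) := eq_neg_of_add_eq_zero_right h0
  rw [mul_add, h1, ← mul_assoc, ← sub_eq_add_neg, ← sub_mul, ← key, mul_assoc, ho, mul_one]

/-- The gauge identity for the temporal part of the connection. -/
theorem TPlus_gauge {a c : ℝ} {m : ℕ} (hm : Odd m) {S : PowerSeries (Mat n ℝ)}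
    (hS : ∀ k, IsSkew n (PowerSeries.coeff k S)) {P D : Mat n ℝ} (hi : IsoIdem P) (hr : RankOne P)
    (hD : D = -(realTPlus m S a * P) + P * realTPlus m S c
      - P * (realTPlus m S c - realTPlus m S a) * P) {z : ℂ} (hz : z ∈ compl₂ a c) :
    TPlus m (gaugeSeries a c P S) z = simpleElt a c P z *
      (TPlus m S z * adj (simpleElt a c P z) +
        ((((c : ℂ) - a) * (z - c)⁻¹) • adj (cx D) - (((c : ℂ) - a) * (z - a)⁻¹) • cx D)) := by
  have hD' := adj_riccati (adj_realTPlus hm hS a) (adj_realTPlus hm hS c) hD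
  have hh : HoloOn (TPlus m S) univ := holoOn_plusPart m (S ^ m) univ
  -- The derivative in `λ` of `(T^m)_+` is again skew, so rank one removes the derivative parts of
  -- the double poles.
  have skew : ∀ b M', HasMDerivAt ℂ (TPlus m S) M' b → adj M' = -M' := fun b M' hM' => by
    have h1 := hM'.adj
    have h2 : HasMDerivAt ℂ (fun z => adj (TPlus m S z)) (-M') b := by
      simp only [adj_TPlus hm hS]
      have := (HasMDerivAt.const (0 : Mat n ℂ)).sub hM'
      simpa using this
    exact h1.unique h2
  obtain ⟨Ma, hMa⟩ := hh.hasMDerivAt isOpen_univ (mem_univ (a : ℂ))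
  obtain ⟨Mc, hMc⟩ := hh.hasMDerivAt isOpen_univ (mem_univ (c : ℂ))
  obtain ⟨a1, a2, a3, b1, b2, b3⟩ := riccati_conditions (A := TPlus m S a) (B := TPlus m S c)
    (D := cx D) (D' := adj (cx D)) hi.cx
    (by rw [hD]; simp only [cx_mul, cx_add, cx_sub, cx_neg, cx_realTPlus])
    (by rw [← cx_adj, hD']; simp only [cx_mul, cx_add, cx_sub, cx_adj, cx_realTPlus])
  obtain ⟨W, hW, hW'⟩ := HoloOn.exists_dress_extension isOpen_univ (mem_univ (a : ℂ))
    (mem_univ (c : ℂ)) hh hMa hMc a1 a2 a3 (hr.cx.adj_mul_mul_self (skew _ _ hMa)) b1 b2 b3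
    (hr.cx.mul_mul_adj (skew _ _ hMc))
  rw [← eq_TPlus_gaugeSeries hi hW hW' z, hW' z hz.1 hz.2, adj_simpleElt, simpleElt_cx]
  congr 1
  abel

end Dressed

/-! ### Existence of a single Darboux transform -/

section Darboux

variable {n j : ℕ} {O : Set (ℝ × ℝ)} {q : ℝ × ℝ → Mat n ℝ} {F : ℝ × ℝ → ℂ → Mat n ℂ}

theorem eventually_x {U : Set (ℝ × ℝ)} (hU : IsOpen U) {p : ℝ × ℝ} (hp : p ∈ U) :
    ∀ᶠ x in 𝓝 p.1, (x, p.2) ∈ U :=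
  (show Continuous fun x : ℝ => (x, p.2) by fun_prop).continuousAt.eventually (hU.mem_nhds hp)

theorem eventually_t {U : Set (ℝ × ℝ)} (hU : IsOpen U) {p : ℝ × ℝ} (hp : p ∈ U) :
    ∀ᶠ t in 𝓝 p.2, (p.1, t) ∈ U :=
  (show Continuous fun t : ℝ => (p.1, t) by fun_prop).continuousAt.eventually (hU.mem_nhds hp)

theorem IsFrame.smooth_frameAt (hF : IsFrame n j O q F) (a : ℝ) :
    SmoothOn (fun p => frameAt F p a) O := (hF.smooth a).re

theorem IsFrame.hasMDerivAt_x (hO : IsOpen O) (hF : IsFrame n j O q F) {p : ℝ × ℝ} (hp : p ∈ O)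
    (z : ℂ) : HasMDerivAt ℝ (fun x => F (x, p.2) z) (F p z * (JB n z + cx (q p))) p.1 := by
  have := (hF.smooth z).hasMDerivAt_x hO hp
  rwa [hF.eq_x p hp z] at this

theorem IsFrame.frameAt_hasMDerivAt_x (hO : IsOpen O) (hF : IsFrame n j O q F) {p : ℝ × ℝ}
    (hp : p ∈ O) (a : ℝ) :
    HasMDerivAt ℝ (fun x => frameAt F (x, p.2) a) (frameAt F p a * conn n (q p) a) p.1 := by
  apply hasMDerivAt_of_cx
  have e : JB n a + cx (q p) = cx (conn n (q p) a) := by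
    rw [conn, cx_add, cx_add, cx_smul, ← add_assoc]
    rfl
  rw [cx_mul, cx_frameAt (hF.loop p hp), ← e]
  refine (hF.hasMDerivAt_x hO hp a).congr_of_eventuallyEq ?_
  exact (eventually_x hO hp).mono fun x hx => cx_frameAt (hF.loop _ hx) a

theorem IsFrame.frameAt_hasMDerivAt_t (hO : IsOpen O) (hF : IsFrame n j O q F)
    {S : ℝ × ℝ → PowerSeries (Mat n ℝ)}
    (hS : ∀ p ∈ O, ∀ z, pdt (fun p' => F p' z) p = F p z * TPlus (2 * j - 1) (S p) z)
    {p : ℝ × ℝ} (hp : p ∈ O) (a : ℝ) : HasMDerivAt ℝ (fun t => frameAt F (p.1, t) a)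
      (frameAt F p a * realTPlus (2 * j - 1) (S p) a) p.2 := by
  apply hasMDerivAt_of_cx
  rw [cx_mul, cx_frameAt (hF.loop p hp), cx_realTPlus, ← hS p hp]
  refine ((hF.smooth a).hasMDerivAt_t hO hp).congr_of_eventuallyEq ?_
  exact (eventually_t hO hp).mono fun x hx => cx_frameAt (hF.loop _ hx) a

/-- Transported rank one projections are smooth. -/
theorem smoothOn_of_link {A C : ℝ × ℝ → Mat n ℝ} {Q : ℝ × ℝ → Mat n ℝ} {P : Mat n ℝ}
    (hP : RankOne P) (hA : SmoothOn A O) (hC : SmoothOn C O)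
    (hl : ∀ p ∈ O, Link P (Q p) (A p) (C p)) (oA : ∀ p ∈ O, A p * adj (A p) = 1)
    (oC : ∀ p ∈ O, C p * adj (C p) = 1) : SmoothOn Q O := by
  have h := fun p hp => (hl p hp).eq_smul hP (mul_eq_one_comm.mp (oA p hp))
    (mul_eq_one_comm.mp (oC p hp))
  have hs : ContDiffOn ℝ ∞ (fun p => (P * (C p * adj (A p))).trace) O :=
    ((SmoothOn.const P).mul (hC.mul hA.adj)).trace
  exact (SmoothOn.smul (hs.inv fun p hp => (h p hp).1)
    ((hA.adj.mul (SmoothOn.const P)).mul hC)).congr fun p hp => (h p hp).2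

theorem smoothOn_darboux {a c : ℝ} {P : ℝ × ℝ → Mat n ℝ} (hq : SmoothOn q O) (hP : SmoothOn P O) :
    SmoothOn (darboux a c q P) O := by
  have hX := hP.sub hP.adj
  have hb := SmoothOn.const (U := O) (beta n)
  refine (hq.add (SmoothOn.const_smul (a - c) ((hb.mul hX).sub (hX.mul hb)))).congr fun p _ => ?_
  rw [darboux, sharp_eq_adj, Ring.lie_def]

theorem continuousOn_simpleElt {a c : ℝ} {P : ℝ × ℝ → Mat n ℝ} (hP : ContinuousOn P O) :
    ContinuousOn (fun w : (ℝ × ℝ) × ℂ => simpleElt a c (P w.1) w.2) (O ×ˢ compl₂ a c) := by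
  have h : ∀ b : ℂ, compl₂ a c ⊆ {b}ᶜ →
      ContinuousOn (fun w : (ℝ × ℝ) × ℂ => ((c : ℂ) - a) * (w.2 - b)⁻¹) (O ×ˢ compl₂ a c) :=
    fun b hb => continuousOn_const.mul
      ((continuous_snd.sub continuous_const).continuousOn.inv₀ fun w hw =>
        sub_ne_zero.mpr (hb hw.2))
  have hcx : ContinuousOn (fun w : (ℝ × ℝ) × ℂ => cx (P w.1)) (O ×ˢ compl₂ a c) := by
    have : Continuous (cx : Mat n ℝ → Mat n ℂ) :=
      continuous_id.matrix_map Complex.continuous_ofReal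
    exact this.comp_continuousOn (hP.comp continuous_fst.continuousOn fun w hw => hw.1)
  simp only [simpleElt_cx, dress]
  exact (continuousOn_const.add ((h c inter_subset_right).smul hcx)).sub
    ((h a inter_subset_left).smul (continuous_adj.comp_continuousOn hcx))

set_option maxHeartbeats 1000000 in
/-- Existence of the Darboux transform: the transformed frame, the transformed solution and the
factorization that defines the dressing action. -/
theorem exists_darboux (hj : 1 ≤ j) (hO : IsOpen O) (hq : SmoothOn q O)
    (hb : ∀ p ∈ O, IsBorel n (q p)) (hF : IsFrame n j O q F) {a c : ℝ} {P : Mat n ℝ}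
    (hi : IsoIdem P) (hr : RankOne P) {Pt : ℝ × ℝ → Mat n ℝ} (ht : IsTransported O F a c P Pt) :
    ∃ F₁ : ℝ × ℝ → ℂ → Mat n ℂ,
      (∀ p ∈ O, ∀ z ∈ compl₂ a c,
        F₁ p z = simpleElt a c P z * (F p z * adj (simpleElt a c (Pt p) z))) ∧
      IsSolution n j O (darboux a c q Pt) ∧ IsFrame n j O (darboux a c q Pt) F₁ ∧
      IsDressing n j O (simpleElt a c P) q F (darboux a c q Pt) F₁ := by
  -- The bound `1 ≤ j` matters: with truncated subtraction, `j = 0` would give the even exponent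
  -- `0`.
  have hm : Odd (2 * j - 1) := ⟨j - 1, by omega⟩
  set m := 2 * j - 1 with hmdef
  have hl := (isTransported_iff hi.idem hF.loop).mp ht
  have oA : ∀ b, ∀ p ∈ O, frameAt F p b * adj (frameAt F p b) = 1 := fun b p hp =>
    frameAt_mul_adj (hF.loop p hp) b
  have oA' : ∀ b, ∀ p ∈ O, adj (frameAt F p b) * frameAt F p b = 1 := fun b p hp =>
    mul_eq_one_comm.mp (oA b p hp)
  have hit : ∀ p ∈ O, IsoIdem (Pt p) := fun p hp => (hl p hp).isoIdem hi (oA' a p hp) (oA c p hp)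
  have hrt : ∀ p ∈ O, RankOne (Pt p) := fun p hp => (hl p hp).rankOne hr (oA' a p hp) (oA' c p hp)
  have hPs : SmoothOn Pt O :=
    smoothOn_of_link hr (hF.smooth_frameAt a) (hF.smooth_frameAt c) hl (oA a) (oA c)
  have hq₁ : SmoothOn (darboux a c q Pt) O := smoothOn_darboux hq hPs
  obtain ⟨S, hS, hSt⟩ := hF.eq_t
  -- the Riccati equations
  have ricx : ∀ p ∈ O, HasMDerivAt ℝ (fun x => Pt (x, p.2)) (-(conn n (q p) a * Pt p) +
      Pt p * conn n (q p) c - Pt p * (conn n (q p) c - conn n (q p) a) * Pt p) p.1 := fun p hp =>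
    hasMDerivAt_link hr (hF.frameAt_hasMDerivAt_x hO hp a) (hF.frameAt_hasMDerivAt_x hO hp c)
      (adj_conn (hb p hp).1 a)
      ((eventually_x hO hp).mono fun x hx => ⟨hl _ hx, oA a _ hx, oA c _ hx⟩)
  have rict : ∀ p ∈ O, HasMDerivAt ℝ (fun t => Pt (p.1, t)) (-(realTPlus m (S p) a * Pt p) +
      Pt p * realTPlus m (S p) c - Pt p * (realTPlus m (S p) c - realTPlus m (S p) a) * Pt p)
      p.2 := fun p hp =>
    hasMDerivAt_link hr (hF.frameAt_hasMDerivAt_t hO hSt hp a)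
      (hF.frameAt_hasMDerivAt_t hO hSt hp c) (adj_realTPlus hm (hS.skew p hp) a)
      ((eventually_t hO hp).mono fun x hx => ⟨hl _ hx, oA a _ hx, oA c _ hx⟩)
  have hS₁ : IsT n O (darboux a c q Pt) (fun p => gaugeSeries a c (Pt p) (S p)) :=
    hS.gauge hO (fun p hp => (hb p hp).1) hPs hit hrt fun p hp => (ricx p hp).pdx_eq
  set S₁ := fun p => gaugeSeries a c (Pt p) (S p)
  -- the new frame
  have hex : ∀ p, ∃ W : ℂ → Mat n ℂ, p ∈ O → HoloOn W univ ∧ ∀ z ∈ compl₂ a c,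
      W z = simpleElt a c P z * (F p z * adj (simpleElt a c (Pt p) z)) := by
    intro p
    by_cases hp : p ∈ O
    · have hlc := (hl p hp).mapMatrix Complex.ofRealHom
      simp only [← cx_eq, cx_frameAt (hF.loop p hp)] at hlc
      obtain ⟨W, hW, hW'⟩ := Link.exists_extension isOpen_univ (mem_univ (a : ℂ))
        (mem_univ (c : ℂ)) (hF.loop p hp).holoOn (fun z _ => (hF.loop p hp).mul_adj z)
        hi.cx hr.cx hlc
      refine ⟨W, fun _ => ⟨hW, fun z hz => ?_⟩⟩
      rw [hW' z hz.1 hz.2, adj_simpleElt, simpleElt_cx]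
    · exact ⟨0, fun h => absurd h hp⟩
  choose F₁ hF₁ using hex
  have hW : ∀ p ∈ O, HoloOn (F₁ p) univ := fun p hp => (hF₁ p hp).1
  have hform : ∀ p ∈ O, ∀ z ∈ compl₂ a c,
      F₁ p z = simpleElt a c P z * (F p z * adj (simpleElt a c (Pt p) z)) :=
    fun p hp => (hF₁ p hp).2
  have hcof : ∀ᶠ z : ℂ in cofinite, z ∈ compl₂ a c :=
    (eventually_cofinite_ne (a : ℂ)).and (eventually_cofinite_ne (c : ℂ))
  have hfin : ((compl₂ (a : ℂ) c)ᶜ).Finite := hcof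
  -- joint continuity
  have hcont : ContinuousOn (Function.uncurry F₁) (O ×ˢ univ) := by
    have h1 : ContinuousOn (Function.uncurry F₁) (O ×ˢ compl₂ a c) := by
      have hg := continuousOn_simpleElt (a := a) (c := c) hPs.continuousOn
      have hg0 := continuousOn_simpleElt (a := a) (c := c) (P := fun _ => P)
        (continuousOn_const (s := O))
      exact (hg0.mul ((hF.cont.mono (prod_mono_right (subset_univ _))).mul
        (continuous_adj.comp_continuousOn hg))).congr fun w hw => hform w.1 hw.1 w.2 hw.2
    refine continuousOn_pi.mpr fun i => continuousOn_pi.mpr fun k => ?_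
    refine continuousOn_of_entire (E := fun p z => F₁ p z i k) hfin
      (fun p hp => holoOn_univ.mp (hW p hp) i k) ?_
    rw [compl_compl]
    exact continuousOn_pi.mp (continuousOn_pi.mp h1 i) k
  -- the differential equations
  have odex : ∀ p ∈ O, ∀ z, HasMDerivAt ℝ (fun x => F₁ (x, p.2) z)
      (F₁ p z * (JB n z + cx (darboux a c q Pt p))) p.1 := by
    intro p hp z
    have hline : Continuous fun w : ℝ × ℂ => ((w.1, p.2), w.2) := by fun_prop
    have hmaps : MapsTo (fun w : ℝ × ℂ => ((w.1, p.2), w.2)) ({x | (x, p.2) ∈ O} ×ˢ univ)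
        (O ×ˢ univ) := fun w hw => ⟨hw.1, mem_univ _⟩
    have hJ : Continuous fun z : ℂ => JB n z :=
      (continuous_id.smul continuous_const).add continuous_const
    have hm' : ContinuousOn (fun w : (ℝ × ℝ) × ℂ =>
        F₁ w.1 w.2 * (JB n w.2 + cx (darboux a c q Pt w.1))) (O ×ˢ univ) :=
      hcont.mul ((hJ.comp continuous_snd).continuousOn.add
        (hq₁.cx.continuousOn.comp continuous_fst.continuousOn fun w hw => hw.1))
    -- The product formula for `F₁` gives the equation for `λ ≠ a, c`; at these two values it is
    -- obtained as a limit.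
    refine hasMDerivAt_of_finite_exception (I := {x | (x, p.2) ∈ O})
      (f := fun x z => F₁ (x, p.2) z)
      (m := fun x z => F₁ (x, p.2) z * (JB n z + cx (darboux a c q Pt (x, p.2))))
      (hO.preimage (by fun_prop)) hfin
      (hcont.comp hline.continuousOn hmaps) (hm'.comp hline.continuousOn hmaps)
      (fun x hx z hz => ?_) hp z
    rw [mem_compl_iff, not_not] at hz
    have hx' : ((x, p.2) : ℝ × ℝ) ∈ O := hx
    have h1 := hasMDerivAt_dressed (g := fun y => simpleElt a c (Pt (y, p.2)) z)
      (simpleElt a c P z) (hF.hasMDerivAt_x hO hx' z)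
      (hasMDerivAt_adj_simpleElt (ricx _ hx') z)
      (mul_eq_one_comm.mp (simpleElt_mul_adj_cx (hit _ hx') hz))
      (conn_gauge (p := (x, p.2)) ((eventually_x hO hx').mono fun y hy => hit _ hy) (hrt _ hx')
        (hb _ hx').1 (ricx _ hx') rfl hz)
    rw [← hform _ hx' z hz] at h1
    exact h1.congr_of_eventuallyEq ((eventually_x hO hx').mono fun y hy => hform _ hy z hz)
  have odet : ∀ p ∈ O, ∀ z, HasMDerivAt ℝ (fun t => F₁ (p.1, t) z)
      (F₁ p z * TPlus m (S₁ p) z) p.2 := by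
    intro p hp z
    have hline : Continuous fun w : ℝ × ℂ => ((p.1, w.1), w.2) := by fun_prop
    have hmaps : MapsTo (fun w : ℝ × ℂ => ((p.1, w.1), w.2)) ({t | (p.1, t) ∈ O} ×ˢ univ)
        (O ×ˢ univ) := fun w hw => ⟨hw.1, mem_univ _⟩
    have hm' : ContinuousOn (fun w : (ℝ × ℝ) × ℂ => F₁ w.1 w.2 * TPlus m (S₁ w.1) w.2)
        (O ×ˢ univ) := hcont.mul (continuousOn_TPlus hS₁.smooth m univ)
    refine hasMDerivAt_of_finite_exception (I := {t | (p.1, t) ∈ O})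
      (f := fun t z => F₁ (p.1, t) z)
      (m := fun t z => F₁ (p.1, t) z * TPlus m (S₁ (p.1, t)) z)
      (hO.preimage (by fun_prop)) hfin
      (hcont.comp hline.continuousOn hmaps) (hm'.comp hline.continuousOn hmaps)
      (fun t ht z hz => ?_) hp z
    rw [mem_compl_iff, not_not] at hz
    have ht' : ((p.1, t) : ℝ × ℝ) ∈ O := ht
    have hFt := (hF.smooth z).hasMDerivAt_t hO ht'
    rw [hSt _ ht' z] at hFt
    have h1 := hasMDerivAt_dressed (g := fun y => simpleElt a c (Pt (p.1, y)) z)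
      (simpleElt a c P z) hFt (hasMDerivAt_adj_simpleElt (rict _ ht') z)
      (mul_eq_one_comm.mp (simpleElt_mul_adj_cx (hit _ ht') hz))
      (TPlus_gauge hm (hS.skew _ ht') (hit _ ht') (hrt _ ht') rfl hz)
    rw [← hform _ ht' z hz] at h1
    exact h1.congr_of_eventuallyEq ((eventually_t hO ht').mono fun y hy => hform _ hy z hz)
  -- At `λ = a, c` the product formula says nothing about smoothness in `(x,t)`, so it is derived
  -- from the linear system.
  have hsm : ∀ z, SmoothOn (fun p => F₁ p z) O := fun z =>
    smoothOn_of_linear_system hO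
      (hcont.comp (f := fun p : ℝ × ℝ => (p, z)) (by fun_prop) fun p hp => ⟨hp, mem_univ _⟩)
      ((SmoothOn.const (JB n z)).add hq₁.cx) (smoothOn_TPlus hS₁.smooth m z)
      (fun p hp => odex p hp z) (fun p hp => odet p hp z)
  -- the loop conditions
  have hc₁ : ∀ p ∈ O, Continuous (F₁ p) := fun p hp => by
    rw [← continuousOn_univ]
    exact (hW p hp).continuousOn
  have hadj : ∀ p ∈ O, ∀ z, adj (F₁ p z) * F₁ p z = 1 := fun p hp z => by
    refine congrFun (eq_of_eventually_cofinite_eq ((continuous_adj.comp (hc₁ p hp)).mul (hc₁ p hp))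
      (continuous_const (y := (1 : Mat n ℂ))) (hcof.mono fun z hz => ?_)) z
    have h1 := mul_eq_one_comm.mp (simpleElt_mul_adj_cx hi hz)
    have h2 := simpleElt_mul_adj_cx (hit p hp) hz
    have h3 := (hF.loop p hp).adj_mul z
    change adj (F₁ p z) * F₁ p z = 1
    rw [hform p hp z hz, adj_mul, adj_mul, adj_adj]
    set g := simpleElt a c P z
    set g' := simpleElt a c (Pt p) z
    calc _ = g' * (adj (F p z) * ((adj g * g) * F p z)) * adj g' := by simp only [mul_assoc]
      _ = 1 := by rw [h1, one_mul, h3, mul_one, h2]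
  have hloop : ∀ p ∈ O, IsPosLoop n (F₁ p) := fun p hp => by
    refine ⟨holoOn_univ.mp (hW p hp), fun z => orth_iff.mpr (hadj p hp z), fun z => ?_⟩
    have hconj : Continuous fun z => (F₁ p (starRingEnd ℂ z)).map (starRingEnd ℂ) :=
      ((hc₁ p hp).comp Complex.continuous_conj).matrix_map Complex.continuous_conj
    refine congrFun (eq_of_eventually_cofinite_eq hconj (hc₁ p hp) (hcof.mono fun z hz => ?_)) z
    have hz' : starRingEnd ℂ z ∈ compl₂ a c := by
      constructor
      · intro h
        apply hz.1
        have := congrArg (starRingEnd ℂ) (mem_singleton_iff.mp h)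
        rwa [Complex.conj_conj, Complex.conj_ofReal] at this
      · intro h
        apply hz.2
        have := congrArg (starRingEnd ℂ) (mem_singleton_iff.mp h)
        rwa [Complex.conj_conj, Complex.conj_ofReal] at this
    have hmm : ∀ A B : Mat n ℂ, (A * B).map (starRingEnd ℂ) =
        A.map (starRingEnd ℂ) * B.map (starRingEnd ℂ) := fun A B => Matrix.map_mul
    have ha : ∀ A : Mat n ℂ, (adj A).map (starRingEnd ℂ) = adj (A.map (starRingEnd ℂ)) :=
      fun A => mapMatrix_adj (starRingEnd ℂ) A
    rw [hform p hp _ hz', hform p hp z hz, hmm, hmm, ha, simpleElt_conj, simpleElt_conj,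
      (hF.loop p hp).real]
  have hframe : IsFrame n j O (darboux a c q Pt) F₁ := by
    refine ⟨hsm, hcont, hloop, fun p hp z => ?_, fun p hp z => (odex p hp z).pdx_eq,
      ⟨S₁, hS₁, fun p hp z => (odet p hp z).pdt_eq⟩, hF.base, fun z => ?_⟩
    · refine congrFun (eq_of_eventually_cofinite_eq (f := fun z => (F₁ p z).det)
        (hc₁ p hp).matrix_det continuous_const (hcof.mono fun z hz => ?_)) z
      rw [hform p hp z hz, Matrix.det_mul, Matrix.det_mul, det_adj, hF.det_one p hp,
        det_simpleElt hi hz.1 hz.2, det_simpleElt (hit p hp) hz.1 hz.2, one_mul, one_mul]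
    · refine congrFun (eq_of_eventually_cofinite_eq (hc₁ _ hF.base)
        (continuous_const (y := (1 : Mat n ℂ))) (hcof.mono fun z hz => ?_)) z
      rw [hform _ hF.base z hz, hF.link_zero (hl _ hF.base), hF.normalized, one_mul,
        simpleElt_mul_adj_cx hi hz]
  -- The rational factor is `h = g_{Pt}`, since `F₁ g_{Pt} = g_P F`, and `R` is its coefficient of
  -- `λ⁻¹`.
  refine ⟨F₁, hform, ⟨hq₁, fun p hp => isBorel_darboux (hb p hp), S₁, hS₁, fun p hp => ?_⟩, hframe,
    hF, isRatLoop_simpleElt hi,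
    ⟨fun p z => simpleElt a c (Pt p) z, fun p => (c - a) • (Pt p - adj (Pt p)), fun p hp =>
      ⟨hloop p hp, isRatLoop_simpleElt (hit p hp), hcof.mono fun z hz => ?_,
        tendsto_smul_simpleElt_sub_one a c (Pt p), ?_⟩⟩⟩
  · -- the flow, from the zero curvature equation at `λ = 0`
    have hTs : SmoothOn (fun p => TZero m (S₁ p)) O := SmoothSeriesOn.pow hS₁.smooth m m
    have e0 : ∀ p, JB n 0 + cx (darboux a c q Pt p) = cx (bMat n + darboux a c q Pt p) := by
      intro p
      rw [JB, zero_smul, zero_add, cx_add]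
      rfl
    have hx := fun p hp => odex p hp 0
    have ht := fun p hp => odet p hp 0
    simp only [e0, TPlus_zero] at hx ht
    have dA := ((HasMDerivAt.const (bMat n)).add (hq₁.hasMDerivAt_t hO hp)).cx
    have dB := (hTs.hasMDerivAt_x hO hp).cx
    have key := zero_curvature (H := fun p => adj (F₁ p 0)) hO (hsm 0) hx ht
      (fun p hp => hadj p hp 0) hp dA dB
    rw [zero_add, ← cx_lie, ← cx_add] at key
    exact cx_injective key
  · rw [hform p hp z hz]
    have h2 := mul_eq_one_comm.mp (simpleElt_mul_adj_cx (hit p hp) hz)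
    rw [mul_assoc, mul_assoc, h2, mul_one]
  · rw [darboux_apply, Ring.lie_def, Ring.lie_def, smul_mul_assoc, mul_smul_comm, smul_sub]

end Darboux

/-- Taking preimages is functorial. Needed because the dressed frame is a product of three factors.
-/
theorem Link.trans {n : ℕ} {K : Type*} [Field K] {P Q R A A' C C' : Mat n K} (h : Link P Q A C)
    (h' : Link Q R A' C') : Link P R (A * A') (C * C') := by
  refine ⟨h'.idem, ?_, ?_, ?_, ?_⟩
  · calc P * (A * A') * R = P * A * (Q * A' * R) := by rw [h'.im_le]; simp only [mul_assoc]
      _ = P * A * Q * A' * R := by simp only [mul_assoc]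
      _ = A * (Q * A' * R) := by rw [h.im_le]; simp only [mul_assoc]
      _ = A * A' * R := by rw [h'.im_le, mul_assoc]
  · calc R * adj (A * A') * P = R * adj A' * (Q * adj A * P) := by
          rw [h.le_im, adj_mul]; simp only [mul_assoc]
      _ = R * adj A' * Q * adj A * P := by simp only [mul_assoc]
      _ = adj A' * (Q * adj A * P) := by rw [h'.le_im]; simp only [mul_assoc]
      _ = adj (A * A') * P := by rw [h.le_im, adj_mul, mul_assoc]
  · calc P * (C * C') * R = P * C * Q * (C' * R) := by rw [h.ke_le]; simp only [mul_assoc]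
      _ = P * C * (Q * C' * R) := by simp only [mul_assoc]
      _ = P * C * Q * C' := by rw [h'.ke_le]; simp only [mul_assoc]
      _ = P * (C * C') := by rw [h.ke_le, mul_assoc]
  · calc R * adj (C * C') * P = R * adj C' * Q * (adj C * P) := by
          rw [h'.le_ke, adj_mul]; simp only [mul_assoc]
      _ = R * adj C' * (Q * adj C * P) := by simp only [mul_assoc]
      _ = R * adj C' * Q * adj C := by rw [h.le_ke]; simp only [mul_assoc]
      _ = R * adj (C * C') := by rw [h'.le_ke, adj_mul, mul_assoc]

/-! ### Part (A) in terms of links -/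

section Permuted

variable {n : ℕ} {a₁ c₁ a₂ c₂ : ℝ} {P₁ P₂ τ₁ τ₂ : Mat n ℝ}

/-- The simple elements are orthogonal at the points involved, so images under them are preimages
under their adjoints. -/
theorem isPermuted_iff (h12 : a₁ ≠ a₂) (h13 : a₁ ≠ c₂) (h14 : c₁ ≠ a₂) (h15 : c₁ ≠ c₂)
    (i₁ : IsoIdem P₁) (i₂ : IsoIdem P₂) :
    IsPermuted a₁ c₁ a₂ c₂ P₁ P₂ τ₁ τ₂ ↔
      Link P₁ τ₁ (adj (simpleElt a₂ c₂ P₂ a₁)) (adj (simpleElt a₂ c₂ P₂ c₁)) ∧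
      Link P₂ τ₂ (adj (simpleElt a₁ c₁ P₁ a₂)) (adj (simpleElt a₁ c₁ P₁ c₂)) :=
  and_congr
    (isProj_map_iff i₁.idem (simpleElt_mul_adj_real i₂ h12 h13)
      (simpleElt_mul_adj_real i₂ h14 h15))
    (isProj_map_iff i₂.idem (simpleElt_mul_adj_real i₁ h12.symm h14.symm)
      (simpleElt_mul_adj_real i₁ h13.symm h15.symm))

theorem IsPermuted.properties (h12 : a₁ ≠ a₂) (h13 : a₁ ≠ c₂) (h14 : c₁ ≠ a₂) (h15 : c₁ ≠ c₂)
    (i₁ : IsoIdem P₁) (i₂ : IsoIdem P₂) (r₁ : RankOne P₁) (r₂ : RankOne P₂)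
    (h : IsPermuted a₁ c₁ a₂ c₂ P₁ P₂ τ₁ τ₂) :
    (IsoIdem τ₁ ∧ RankOne τ₁) ∧ (IsoIdem τ₂ ∧ RankOne τ₂) ∧
      GRelation a₁ c₁ a₂ c₂ P₁ P₂ τ₁ τ₂ := by
  obtain ⟨l₁, l₂⟩ := (isPermuted_iff h12 h13 h14 h15 i₁ i₂).mp h
  have o₁ := simpleElt_mul_adj_real i₂ h12 h13
  have o₂ := simpleElt_mul_adj_real i₂ h14 h15
  have o₃ := simpleElt_mul_adj_real i₁ h12.symm h14.symm
  have o₄ := simpleElt_mul_adj_real i₁ h13.symm h15.symm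
  have aux : ∀ {A : Mat n ℝ}, A * adj A = 1 → adj (adj A) * adj A = 1 := fun h => by
    rwa [adj_adj]
  have aux' : ∀ {A : Mat n ℝ}, A * adj A = 1 → adj A * adj (adj A) = 1 := fun h => by
    rw [adj_adj]; exact mul_eq_one_comm.mp h
  have j₁ := l₁.isoIdem i₁ (aux o₁) (aux' o₂)
  have j₂ := l₂.isoIdem i₂ (aux o₃) (aux' o₄)
  have s₁ := l₁.symm i₁.idem
  have s₂ := l₂.symm i₂.idem
  rw [adj_adj, adj_adj] at s₁ s₂
  have t₁ := l₁.rankOne r₁ (aux o₁) (aux o₂)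
  have t₂ := l₂.rankOne r₂ (aux o₃) (aux o₄)
  exact ⟨⟨j₁, t₁⟩, ⟨j₂, t₂⟩, gRelation_of_link h12 h13 h14 h15 i₁ i₂ j₁ j₂ t₁ t₂ s₁ s₂⟩

theorem GRelation.isPermuted (h11 : a₁ ≠ c₁) (h12 : a₁ ≠ a₂) (h13 : a₁ ≠ c₂) (h14 : c₁ ≠ a₂)
    (h15 : c₁ ≠ c₂) (h22 : a₂ ≠ c₂) (i₁ : IsoIdem P₁) (i₂ : IsoIdem P₂) (j₁ : IsoIdem τ₁)
    (j₂ : IsoIdem τ₂) (h : GRelation a₁ c₁ a₂ c₂ P₁ P₂ τ₁ τ₂) :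
    IsPermuted a₁ c₁ a₂ c₂ P₁ P₂ τ₁ τ₂ :=
  (isPermuted_iff h12 h13 h14 h15 i₁ i₂).mpr
    ⟨h.link h11 h12 h13 h14 h15 i₁ i₂ j₁ j₂,
      h.symm.link h22 h12.symm h14.symm h13.symm h15.symm i₂ i₁ j₂ j₁⟩

end Permuted

/-! ### Continuous transport near a point -/

section Transport

variable {n j : ℕ} {O : Set (ℝ × ℝ)} {q : ℝ × ℝ → Mat n ℝ} {F : ℝ × ℝ → ℂ → Mat n ℂ}

/-- Near the origin, a rank one idempotent can be transported continuously. -/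
theorem exists_continuous_link {Q₀ : Mat n ℝ} {P A C : ℝ × ℝ → Mat n ℝ} {p₀ : ℝ × ℝ}
    (hO : IsOpen O) (hp₀ : p₀ ∈ O) (hP : ContinuousOn P O) (hA : ContinuousOn A O)
    (hC : ContinuousOn C O) (hr : ∀ p ∈ O, RankOne (P p)) (oA : ∀ p ∈ O, A p * adj (A p) = 1)
    (oC : ∀ p ∈ O, C p * adj (C p) = 1) (h₀ : Link (P p₀) Q₀ (A p₀) (C p₀)) :
    ∃ (U : Set (ℝ × ℝ)) (Q : ℝ × ℝ → Mat n ℝ), U ⊆ O ∧ IsOpen U ∧ p₀ ∈ U ∧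
      ContinuousOn Q U ∧ Q p₀ = Q₀ ∧ ∀ p ∈ U, Link (P p) (Q p) (A p) (C p) := by
  set s : ℝ × ℝ → ℝ := fun p => (P p * (C p * adj (A p))).trace with hs
  have hA' : ContinuousOn (fun p => adj (A p)) O := continuous_adj.comp_continuousOn hA
  have hsc : ContinuousOn s O :=
    (continuous_id.matrix_trace).comp_continuousOn (hP.mul (hC.mul hA'))
  -- The link at `p₀` forces the trace to be nonzero there; it stays nonzero nearby, and there the
  -- explicit formula defines `Q`.
  obtain ⟨h1, h2⟩ := h₀.eq_smul (hr _ hp₀) (mul_eq_one_comm.mp (oA _ hp₀))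
    (mul_eq_one_comm.mp (oC _ hp₀))
  refine ⟨O ∩ s ⁻¹' {0}ᶜ, fun p => (s p)⁻¹ • (adj (A p) * P p * C p), inter_subset_left,
    hsc.isOpen_inter_preimage hO isOpen_compl_singleton, ⟨hp₀, h1⟩, ?_, h2.symm, fun p hp =>
    Link.of_trace_ne_zero (hr p hp.1) hp.2 (oA p hp.1) (oC p hp.1)⟩
  exact ((hsc.mono inter_subset_left).inv₀ fun p hp => hp.2).smul
    (((hA'.mul hP).mul hC).mono inter_subset_left)

end Transport

/-! ### Ingredients of the permutability of Darboux transforms -/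

section Permutation

variable {n j : ℕ} {O : Set (ℝ × ℝ)} {q q' : ℝ × ℝ → Mat n ℝ} {F F' : ℝ × ℝ → ℂ → Mat n ℂ}

theorem IsPosLoop.continuous {f : ℂ → Mat n ℂ} (hf : IsPosLoop n f) : Continuous f :=
  continuous_pi fun i => continuous_pi fun k => (hf.holo i k).continuous

/-- A frame determines its solution. -/
theorem IsFrame.potential_unique (hO : IsOpen O) (hF : IsFrame n j O q F)
    (hF' : IsFrame n j O q' F') (h : ∀ p ∈ O, F p = F' p) {p : ℝ × ℝ} (hp : p ∈ O) :
    q p = q' p := by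
  have h1 := hF.eq_x p hp 0
  have h2 := HasMDerivAt.pdx_eq (A := fun p => F p 0)
    ((hF'.hasMDerivAt_x hO hp 0).congr_of_eventuallyEq
      ((eventually_x hO hp).mono fun x hx => congrFun (h _ hx) 0))
  rw [h1, h p hp] at h2
  have h3 := congrArg (adj (F' p 0) * ·) h2
  simp only [← mul_assoc, (hF'.loop p hp).adj_mul, one_mul] at h3
  exact cx_injective (add_left_cancel h3)

theorem IsDressing.congr {f : ℂ → Mat n ℂ} {r r' : ℝ × ℝ → Mat n ℝ} {G G' : ℝ × ℝ → ℂ → Mat n ℂ}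
    (h : IsDressing n j O f q F r G) (hr : ∀ p ∈ O, r' p = r p) (hG : ∀ p ∈ O, G' p = G p) :
    IsDressing n j O f q F r' G' := by
  obtain ⟨k, R, hk⟩ := h.factor
  refine ⟨h.frame, h.rat, k, R, fun p hp => ?_⟩
  rw [hr p hp, hG p hp]
  exact hk p hp

/-- The dressed frame at real points. -/
theorem frameAt_dressed {a c : ℝ} {P : Mat n ℝ} {Pt : ℝ × ℝ → Mat n ℝ} {p : ℝ × ℝ}
    (hF : IsPosLoop n (F p)) (hF' : IsPosLoop n (F' p))
    (h : ∀ z ∈ compl₂ (a : ℂ) c,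
      F' p z = simpleElt a c P z * (F p z * adj (simpleElt a c (Pt p) z)))
    {x : ℝ} (ha : x ≠ a) (hc : x ≠ c) : frameAt F' p x =
      simpleElt a c P x * frameAt F p x * adj (simpleElt a c (Pt p) x) := by
  apply cx_injective
  rw [cx_frameAt hF', h x (ofReal_mem_compl₂ ha hc), cx_mul, cx_mul, cx_adj, cx_frameAt hF,
    simpleElt_real, simpleElt_real, mul_assoc]

theorem continuous_simpleElt_real (a c x : ℝ) :
    Continuous fun A : Mat n ℝ => simpleElt a c A x := by
  have : Continuous fun A : Mat n ℝ => sharp n A := by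
    simp only [sharp_eq_adj]
    exact continuous_adj
  unfold simpleElt
  have h₁ : Continuous fun A : Mat n ℝ => A.map (algebraMap ℝ ℝ) :=
    continuous_id.matrix_map continuous_id
  have h₂ : Continuous fun A : Mat n ℝ => (sharp n A).map (algebraMap ℝ ℝ) :=
    this.matrix_map continuous_id
  fun_prop

variable {a₁ c₁ a₂ c₂ : ℝ} {P₁ P₂ τ₁ τ₂ : Mat n ℝ}

/-- The projections that the two Darboux transforms and their iterates use exist near the
origin. -/
theorem exists_transported (h12 : a₁ ≠ a₂) (h13 : a₁ ≠ c₂) (h14 : c₁ ≠ a₂) (h15 : c₁ ≠ c₂)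
    (i₁ : IsoIdem P₁) (i₂ : IsoIdem P₂) (r₁ : RankOne P₁) (r₂ : RankOne P₂)
    (h : IsPermuted a₁ c₁ a₂ c₂ P₁ P₂ τ₁ τ₂) (hO : IsOpen O) (hF : IsFrame n j O q F) :
    ∃ (U : Set (ℝ × ℝ)) (Q₁ Q₂ σ₁ σ₂ : ℝ × ℝ → Mat n ℝ),
      U ⊆ O ∧ IsOpen U ∧ IsConnected U ∧ (0, 0) ∈ U ∧
      IsTransported U F a₁ c₁ P₁ Q₁ ∧ IsTransported U F a₂ c₂ P₂ Q₂ ∧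
      ∀ p ∈ U, IsPermuted a₁ c₁ a₂ c₂ (Q₁ p) (Q₂ p) (σ₁ p) (σ₂ p) := by
  have cF := fun a => (hF.smooth_frameAt a).continuousOn
  have oF := fun (a : ℝ) p hp => frameAt_mul_adj (hF.loop p hp) a
  have first : ∀ {P : Mat n ℝ} (a c : ℝ), IsoIdem P → RankOne P →
      ∃ (U : Set (ℝ × ℝ)) (Q : ℝ × ℝ → Mat n ℝ), U ⊆ O ∧ IsOpen U ∧ (0, 0) ∈ U ∧
      ContinuousOn Q U ∧ Q (0, 0) = P ∧ ∀ p ∈ U, Link P (Q p) (frameAt F p a) (frameAt F p c) := by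
    intro P a c hi hr
    refine exists_continuous_link hO hF.base continuousOn_const (cF a) (cF c) (fun _ _ => hr)
      (oF a) (oF c) ?_
    rw [hF.frameAt_zero, hF.frameAt_zero]
    constructor <;> simp [adj_one, hi.idem]
  obtain ⟨U₁, Q₁, hU₁, hU₁o, hU₁0, cQ₁, hQ₁0, l₁⟩ := first a₁ c₁ i₁ r₁
  obtain ⟨U₂, Q₂, hU₂, hU₂o, hU₂0, cQ₂, hQ₂0, l₂⟩ := first a₂ c₂ i₂ r₂
  set U := U₁ ∩ U₂
  have hU : IsOpen U := hU₁o.inter hU₂o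
  have i₁' : ∀ p ∈ U, IsoIdem (Q₁ p) := fun p hp =>
    (l₁ p hp.1).isoIdem i₁ (mul_eq_one_comm.mp (oF _ p (hU₁ hp.1))) (oF _ p (hU₁ hp.1))
  have i₂' : ∀ p ∈ U, IsoIdem (Q₂ p) := fun p hp =>
    (l₂ p hp.2).isoIdem i₂ (mul_eq_one_comm.mp (oF _ p (hU₂ hp.2))) (oF _ p (hU₂ hp.2))
  have r₁' : ∀ p ∈ U, RankOne (Q₁ p) := fun p hp =>
    (l₁ p hp.1).rankOne r₁ (mul_eq_one_comm.mp (oF _ p (hU₁ hp.1)))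
      (mul_eq_one_comm.mp (oF _ p (hU₁ hp.1)))
  have r₂' : ∀ p ∈ U, RankOne (Q₂ p) := fun p hp =>
    (l₂ p hp.2).rankOne r₂ (mul_eq_one_comm.mp (oF _ p (hU₂ hp.2)))
      (mul_eq_one_comm.mp (oF _ p (hU₂ hp.2)))
  have second : ∀ {a c x : ℝ} {Q : ℝ × ℝ → Mat n ℝ}, ContinuousOn Q U →
      (∀ p ∈ U, IsoIdem (Q p)) → x ≠ a → x ≠ c →
      ContinuousOn (fun p => adj (simpleElt a c (Q p) x)) U ∧
      ∀ p ∈ U, adj (simpleElt a c (Q p) x) * adj (adj (simpleElt a c (Q p) x)) = 1 :=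
    fun hQ hi ha hc =>
      ⟨(continuous_adj.comp (continuous_simpleElt_real _ _ _)).comp_continuousOn hQ,
      fun p hp => by
        rw [adj_adj]; exact mul_eq_one_comm.mp (simpleElt_mul_adj_real (hi p hp) ha hc)⟩
  have cQ₁' := cQ₁.mono (inter_subset_left : U ⊆ U₁)
  have cQ₂' := cQ₂.mono (inter_subset_right : U ⊆ U₂)
  obtain ⟨m₁, m₂⟩ := (isPermuted_iff h12 h13 h14 h15 i₁ i₂).mp h
  have s1 := second cQ₂' i₂' h12 h13
  have s2 := second cQ₂' i₂' h14 h15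
  have s3 := second cQ₁' i₁' h12.symm h14.symm
  have s4 := second cQ₁' i₁' h13.symm h15.symm
  have h0U : ((0, 0) : ℝ × ℝ) ∈ U := ⟨hU₁0, hU₂0⟩
  -- At the origin the transported projections are `P₁`, `P₂`, so the given `τ₁`, `τ₂` supply the
  -- links from which to continue.
  obtain ⟨V₁, σ₁, hV₁, hV₁o, hV₁0, -, -, k₁⟩ := exists_continuous_link (Q₀ := τ₁) hU h0U cQ₁' s1.1
    s2.1 r₁' s1.2 s2.2 (by rw [hQ₁0, hQ₂0]; exact m₁)
  obtain ⟨V₂, σ₂, hV₂, hV₂o, hV₂0, -, -, k₂⟩ := exists_continuous_link (Q₀ := τ₂) hU h0U cQ₂' s3.1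
    s4.1 r₂' s3.2 s4.2 (by rw [hQ₁0, hQ₂0]; exact m₂)
  -- Shrinking to a ball provides connectedness.
  obtain ⟨ε, hε, hb⟩ := Metric.isOpen_iff.mp (hV₁o.inter hV₂o) (0, 0) ⟨hV₁0, hV₂0⟩
  have hbU : Metric.ball ((0, 0) : ℝ × ℝ) ε ⊆ U := fun p hp => hV₁ (hb hp).1
  have hbO : Metric.ball ((0, 0) : ℝ × ℝ) ε ⊆ O := fun p hp => hU₁ (hbU hp).1
  refine ⟨Metric.ball (0, 0) ε, Q₁, Q₂, σ₁, σ₂, hbO, Metric.isOpen_ball,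
    (convex_ball _ _).isConnected ⟨_, Metric.mem_ball_self hε⟩, Metric.mem_ball_self hε,
    (isTransported_iff i₁.idem fun p hp => hF.loop p (hbO hp)).mpr fun p hp => l₁ p (hbU hp).1,
    (isTransported_iff i₂.idem fun p hp => hF.loop p (hbO hp)).mpr fun p hp => l₂ p (hbU hp).2,
    fun p hp => (isPermuted_iff h12 h13 h14 h15 (i₁' p (hbU hp)) (i₂' p (hbU hp))).mpr
      ⟨k₁ p (hb hp).1, k₂ p (hb hp).2⟩⟩

/-- Transport along the dressed frame. -/
theorem isTransported_dressed (ha : a₂ ≠ a₁) (ha' : a₂ ≠ c₁) (hc : c₂ ≠ a₁) (hc' : c₂ ≠ c₁)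
    {Q₁ Q₂ σ₂ : ℝ × ℝ → Mat n ℝ} (i₂ : IsoIdem P₂) (it : IsoIdem τ₂)
    (hF : ∀ p ∈ O, IsPosLoop n (F p)) (hF' : ∀ p ∈ O, IsPosLoop n (F' p))
    (hform : ∀ p ∈ O, ∀ z ∈ compl₂ (a₁ : ℂ) c₁,
      F' p z = simpleElt a₁ c₁ P₁ z * (F p z * adj (simpleElt a₁ c₁ (Q₁ p) z)))
    (hl : Link P₂ τ₂ (adj (simpleElt a₁ c₁ P₁ a₂)) (adj (simpleElt a₁ c₁ P₁ c₂)))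
    (ht : ∀ p ∈ O, Link P₂ (Q₂ p) (frameAt F p a₂) (frameAt F p c₂))
    (hl' : ∀ p ∈ O, Link (Q₂ p) (σ₂ p) (adj (simpleElt a₁ c₁ (Q₁ p) a₂))
      (adj (simpleElt a₁ c₁ (Q₁ p) c₂))) :
    IsTransported O F' a₂ c₂ τ₂ σ₂ := by
  refine (isTransported_iff it.idem hF').mpr fun p hp => ?_
  have h := hl.symm i₂.idem
  rw [adj_adj, adj_adj] at h
  -- At `a₂` and `c₂` the dressed frame is `g_{P₁} F g_{Q₁}⁻¹`; its factors carry `τ₂` to `P₂`, `P₂`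
  -- to `Q₂(p)` and `Q₂(p)` to `σ₂(p)`.
  rw [frameAt_dressed (hF p hp) (hF' p hp) (hform p hp) ha ha',
    frameAt_dressed (hF p hp) (hF' p hp) (hform p hp) hc hc']
  exact (h.trans (ht p hp)).trans (hl' p hp)

end Permutation

end BnFlow

end

/-! ### Assembly of the theorem -/

open BnFlow
theorem mainTheorem4 (n j : ℕ) (hj : 1 ≤ j)
    (α₁ β₁ α₂ β₂ : ℝ)
    (hd₁ : α₁ ≠ β₁) (hd₂ : α₁ ≠ α₂) (hd₃ : α₁ ≠ β₂)
    (hd₄ : β₁ ≠ α₂) (hd₅ : β₁ ≠ β₂) (hd₆ : α₂ ≠ β₂)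
    (π₁ π₂ τ₁ τ₂ : Mat n ℝ)
    (hπ₁ : π₁ * π₁ = π₁) (hr₁ : π₁.rank = 1) (hi₁ : IsIsotropic n π₁)
    (hπ₂ : π₂ * π₂ = π₂) (hr₂ : π₂.rank = 1) (hi₂ : IsIsotropic n π₂)
    (hτ : IsPermuted α₁ β₁ α₂ β₂ π₁ π₂ τ₁ τ₂) :
    -- relations among simple elements
    (IsIsotropic n τ₁ ∧ IsIsotropic n τ₂ ∧ GRelation α₁ β₁ α₂ β₂ π₁ π₂ τ₁ τ₂) ∧
    -- the converse
    (∀ σ₁ σ₂ : Mat n ℝ, σ₁ * σ₁ = σ₁ → σ₂ * σ₂ = σ₂ → IsIsotropic n σ₁ → IsIsotropic n σ₂ →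
      GRelation α₁ β₁ α₂ β₂ π₁ π₂ σ₁ σ₂ → IsPermuted α₁ β₁ α₂ β₂ π₁ π₂ σ₁ σ₂) ∧
    -- permutability of the Darboux transforms of a solution `q` with normalized frame `F`
    (∀ (Ω : Set (ℝ × ℝ)) (q : ℝ × ℝ → Mat n ℝ) (F : ℝ × ℝ → ℂ → Mat n ℂ),
      IsOpen Ω → IsSolution n j Ω q → IsFrame n j Ω q F →
      -- the projections exist on a neighbourhood of the origin
      (∃ (O : Set (ℝ × ℝ)) (πt₁ πt₂ τt₁ τt₂ : ℝ × ℝ → Mat n ℝ),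
        O ⊆ Ω ∧ IsOpen O ∧ IsConnected O ∧ (0, 0) ∈ O ∧
        IsTransported O F α₁ β₁ π₁ πt₁ ∧ IsTransported O F α₂ β₂ π₂ πt₂ ∧
        ∀ p ∈ O, IsPermuted α₁ β₁ α₂ β₂ (πt₁ p) (πt₂ p) (τt₁ p) (τt₂ p)) ∧
      -- wherever they exist, the formulas hold
      (∀ (O : Set (ℝ × ℝ)) (πt₁ πt₂ τt₁ τt₂ : ℝ × ℝ → Mat n ℝ),
        O ⊆ Ω → IsOpen O → (0, 0) ∈ O →
        IsTransported O F α₁ β₁ π₁ πt₁ → IsTransported O F α₂ β₂ π₂ πt₂ →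
        (∀ p ∈ O, IsPermuted α₁ β₁ α₂ β₂ (πt₁ p) (πt₂ p) (τt₁ p) (τt₂ p)) →
        ∃ (q₁ q₂ q₁₂ : ℝ × ℝ → Mat n ℝ) (F₁ F₂ F₁₂ : ℝ × ℝ → ℂ → Mat n ℂ),
          (∀ p ∈ O, q₁ p = darboux α₁ β₁ q πt₁ p) ∧
          (∀ p ∈ O, q₂ p = darboux α₂ β₂ q πt₂ p) ∧
          (∀ p ∈ O, q₁₂ p = darboux α₂ β₂ q₁ τt₂ p) ∧
          (∀ p ∈ O, q₁₂ p = darboux α₁ β₁ q₂ τt₁ p) ∧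
          (IsSolution n j O q₁ ∧ IsFrame n j O q₁ F₁) ∧
          (IsSolution n j O q₂ ∧ IsFrame n j O q₂ F₂) ∧
          (IsSolution n j O q₁₂ ∧ IsFrame n j O q₁₂ F₁₂) ∧
          IsDressing n j O (simpleElt α₁ β₁ π₁) q F q₁ F₁ ∧
          IsDressing n j O (simpleElt α₂ β₂ π₂) q F q₂ F₂ ∧
          IsDressing n j O (simpleElt α₂ β₂ τ₂) q₁ F₁ q₁₂ F₁₂ ∧
          IsDressing n j O (simpleElt α₁ β₁ τ₁) q₂ F₂ q₁₂ F₁₂ ∧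
          -- these are the only values of the dressing action
          (∀ r G, IsDressing n j O (simpleElt α₁ β₁ π₁) q F r G →
            (∀ p ∈ O, r p = q₁ p) ∧
            ∀ r' G', IsDressing n j O (simpleElt α₂ β₂ τ₂) r G r' G' → ∀ p ∈ O, r' p = q₁₂ p) ∧
          (∀ r G, IsDressing n j O (simpleElt α₂ β₂ π₂) q F r G →
            (∀ p ∈ O, r p = q₂ p) ∧
            ∀ r' G', IsDressing n j O (simpleElt α₁ β₁ τ₁) r G r' G' → ∀ p ∈ O, r' p = q₁₂ p))) := by
  have i₁ : IsoIdem π₁ := isoIdem_iff.mpr ⟨hπ₁, hi₁⟩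
  have i₂ : IsoIdem π₂ := isoIdem_iff.mpr ⟨hπ₂, hi₂⟩
  have r₁ := rankOne_of_rank_eq_one hπ₁ hr₁
  have r₂ := rankOne_of_rank_eq_one hπ₂ hr₂
  obtain ⟨⟨k₁, s₁⟩, ⟨k₂, s₂⟩, hg⟩ := hτ.properties hd₂ hd₃ hd₄ hd₅ i₁ i₂ r₁ r₂
  refine ⟨⟨(isoIdem_iff.mp k₁).2, (isoIdem_iff.mp k₂).2, hg⟩, fun σ₁ σ₂ h₁ h₂ h₁' h₂' h =>
    h.isPermuted hd₁ hd₂ hd₃ hd₄ hd₅ hd₆ i₁ i₂ (isoIdem_iff.mpr ⟨h₁, h₁'⟩)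
      (isoIdem_iff.mpr ⟨h₂, h₂'⟩), fun Ω q F hΩ hq hF =>
    ⟨exists_transported hd₂ hd₃ hd₄ hd₅ i₁ i₂ r₁ r₂ hτ hΩ hF, ?_⟩⟩
  intro O πt₁ πt₂ τt₁ τt₂ hO hOo h0 ht₁ ht₂ hp
  have hFO := hF.mono hO h0
  obtain ⟨F₁, f₁, sol₁, fr₁, dr₁⟩ := exists_darboux hj hOo (fun i k => (hq.smooth i k).mono hO)
    (fun p h => hq.borel p (hO h)) hFO i₁ r₁ ht₁
  obtain ⟨F₂, f₂, sol₂, fr₂, dr₂⟩ := exists_darboux hj hOo (fun i k => (hq.smooth i k).mono hO)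
    (fun p h => hq.borel p (hO h)) hFO i₂ r₂ ht₂
  obtain ⟨m₁, m₂⟩ := (isPermuted_iff hd₂ hd₃ hd₄ hd₅ i₁ i₂).mp hτ
  have l₁ := (isTransported_iff i₁.idem hFO.loop).mp ht₁
  have l₂ := (isTransported_iff i₂.idem hFO.loop).mp ht₂
  have oF := fun (a : ℝ) p h => frameAt_mul_adj (hFO.loop p h) a
  have oF' := fun (a : ℝ) p h => mul_eq_one_comm.mp (oF a p h)
  have it₁ : ∀ p ∈ O, IsoIdem (πt₁ p) := fun p h => (l₁ p h).isoIdem i₁ (oF' _ p h) (oF _ p h)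
  have it₂ : ∀ p ∈ O, IsoIdem (πt₂ p) := fun p h => (l₂ p h).isoIdem i₂ (oF' _ p h) (oF _ p h)
  have pl := fun p h => (isPermuted_iff hd₂ hd₃ hd₄ hd₅ (it₁ p h) (it₂ p h)).mp (hp p h)
  -- Part (A), applied at each `(x,t)` to the transported projections.
  have gt := fun p h => ((hp p h).properties hd₂ hd₃ hd₄ hd₅ (it₁ p h) (it₂ p h)
    ((l₁ p h).rankOne r₁ (oF' _ p h) (oF' _ p h))
    ((l₂ p h).rankOne r₂ (oF' _ p h) (oF' _ p h))).2.2
  obtain ⟨F₁₂, f₁₂, sol₁₂, fr₁₂, dr₁₂⟩ := exists_darboux hj hOo sol₁.smooth sol₁.borel fr₁ k₂ s₂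
    (isTransported_dressed hd₂.symm hd₄.symm hd₃.symm hd₅.symm i₂ k₂ hFO.loop fr₁.loop f₁ m₂ l₂
      fun p h => (pl p h).2)
  obtain ⟨F₂₁, f₂₁, -, fr₂₁, dr₂₁⟩ := exists_darboux hj hOo sol₂.smooth sol₂.borel fr₂ k₁ s₁
    (isTransported_dressed hd₂ hd₃ hd₄ hd₅ i₁ k₁ hFO.loop fr₂.loop f₂ m₁ l₁
      fun p h => (pl p h).1)
  -- Away from the poles both frames have the form `G F H⁻¹`, with `G` a product of two constant
  -- simple elements and `H` the corresponding product of transported ones. Relation (2) equates the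
  -- two choices of `G`, and its pointwise version the two choices of `H`.
  have hFF : ∀ p ∈ O, F₁₂ p = F₂₁ p := fun p h => by
    refine eq_of_eventually_cofinite_eq (fr₁₂.loop p h).continuous (fr₂₁.loop p h).continuous ?_
    filter_upwards [eventually_cofinite_ne (α₁ : ℂ), eventually_cofinite_ne (β₁ : ℂ),
      eventually_cofinite_ne (α₂ : ℂ), eventually_cofinite_ne (β₂ : ℂ)] with z z₁ z₂ z₃ z₄
    rw [f₁₂ p h z ⟨z₃, z₄⟩, f₁ p h z ⟨z₁, z₂⟩, f₂₁ p h z ⟨z₁, z₂⟩, f₂ p h z ⟨z₃, z₄⟩]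
    calc _ = (simpleElt α₂ β₂ τ₂ z * simpleElt α₁ β₁ π₁ z) * F p z *
          adj (simpleElt α₂ β₂ (τt₂ p) z * simpleElt α₁ β₁ (πt₁ p) z) := by
          rw [adj_mul]; simp only [mul_assoc]
      _ = _ := by
          rw [hg z z₁ z₂ z₃ z₄, gt p h z z₁ z₂ z₃ z₄, adj_mul]; simp only [mul_assoc]
  have hqq : ∀ p ∈ O, darboux α₂ β₂ (darboux α₁ β₁ q πt₁) τt₂ p =
      darboux α₁ β₁ (darboux α₂ β₂ q πt₂) τt₁ p := fun p h =>
    fr₁₂.potential_unique hOo fr₂₁ hFF h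
  -- The second order of iteration, rewritten with the potential and frame of the first.
  have dr₂₁' := dr₂₁.congr hqq hFF
  refine ⟨darboux α₁ β₁ q πt₁, darboux α₂ β₂ q πt₂, darboux α₂ β₂ (darboux α₁ β₁ q πt₁) τt₂,
    F₁, F₂, F₁₂, fun _ _ => rfl, fun _ _ => rfl, fun _ _ => rfl, hqq, ⟨sol₁, fr₁⟩, ⟨sol₂, fr₂⟩,
    ⟨sol₁₂, fr₁₂⟩, dr₁, dr₂, dr₁₂, dr₂₁', fun r G h => ?_, fun r G h => ?_⟩
  · obtain ⟨u, v⟩ := dr₁.unique h (fun _ _ => rfl) fun _ _ => rfl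
    exact ⟨u, fun r' G' h' => (dr₁₂.unique h' u v).1⟩
  · obtain ⟨u, v⟩ := dr₂.unique h (fun _ _ => rfl) fun _ _ => rfl
    exact ⟨u, fun r' G' h' => (dr₂₁'.unique h' u v).1⟩
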